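/- Let $\mathsf G$ be a (finite-dimensional, real) Lie group with Lie algebra $\mathfrak g$, and let $H_0$ be a left-invariant closed $3$-form on $\mathsf G$. Let $E=(T\mathsf G\oplus T^*\mathsf G)_{H_0}$ be the exact Courant algebroid with neutral inner product $\langle X+\xi,Y+\eta\rangle=\frac12(\xi(Y)+\eta(X))$, anchor $\pi(X+\xi)=X$, and the $H_0$-twisted Dorfman bracket. A generalized metric is an endomorphism $\mathcal G$ of $E$ that is orthogonal for $\langle\cdot,\cdot\rangle$ and for which $\langle\mathcal G\cdot,\cdot\rangle$ is symmetric and positive definite; it has a unique expression $$\mathcal G=\mathcal G(g,b)=e^{b}\begin{pmatrix}0&g^{-1}\\ g&0\end{pmatrix}e^{-b},\qquad e^b(X+\xi)=X+\xi+\iota_Xb,$$ with $g$ a Riemannian metric and $b$ a $2$-form. Its generalized Ricci curvature is, with $H=H_0+db$ and $\mathrm{Ric}^B=\mathrm{Ric}_g-\frac14H^2$, where $H^2(X,Y)=\sum_{i,j}H(X,e_i,e_j)H(Y,e_i,e_j)$ for a $g$-orthonormal frame $(e_i)$, and $d^*_gH=-\sum_i(\nabla_{e_i}H)(e_i,\cdot,\cdot)$,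 $$\mathcal Rc(\mathcal G)=e^b\begin{pmatrix}g^{-1}\mathrm{Ric}^B&\frac12g^{-1}(d^*_gH)g^{-1}\\-\frac12d^*_gH&-\mathrm{Ric}^Bg^{-1}\end{pmatrix}e^{-b}.$$ A left-invariant solution of the generalized Ricci flow is a family of left-invariant generalized metrics on $E$ with $\mathcal G_t^{-1}\frac{\partial}{\partial t}\mathcal G_t=-2\,\mathcal Rc(\mathcal G_t)$. A Dorfman bracket on $\mathfrak g\oplus\mathfrak g^*$ is a skew-symmetric bilinear map $\boldsymbol\mu:(\mathfrak g\oplus\mathfrak g^*)^2\to\mathfrak g\oplus\mathfrak g^*$ satisfying the Jacobi identity, such that $\langle\boldsymbol\mu(\cdot,\cdot),\cdot\rangle$ is totally skew-symmetric and $\boldsymbol\mu(\mathfrak g^*,\mathfrak g^*)=0$. It is determined by its Lie bracket $\mu=\boldsymbol\mu_{\mathfrak g}=\pi\circ\boldsymbol\mu|_{\mathfrak g\times\mathfrak g}$ and its $3$-form $\boldsymbol\mu_{\Lambda^3}=2\langle\boldsymbol\mu(\cdot,\cdot),\cdot\rangle|_{\mathfrak g}$. Given a left-invariant generalized metric $\bar{\mathcal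 G}=\mathcal G(\bar g,\bar b)$, let $\mathcal Rc_{\boldsymbol\mu}\in\mathrm{End}(\mathfrak g\oplus\mathfrak g^*)$ be the expression above at the identity, formed with $\bar g$, $\bar b$, $H=\boldsymbol\mu_{\Lambda^3}+d_\mu\bar b$ and the Ricci tensor and codifferential of the metric Lie algebra $(\mathfrak g,\mu,\bar g)$, and let $$A_{\boldsymbol\mu}=e^{\bar b}\begin{pmatrix}0&\frac12\bar g^{-1}(d^*_\mu H)\bar g^{-1}\\\frac12d^*_\mu H&0\end{pmatrix}e^{-\bar b}$$ (in the preferred splitting of $\bar{\mathcal G}$ one has $\bar b=0$). The generalized bracket flow with background $\bar{\mathcal G}$ is the ordinary differential equation $$\frac{d}{dt}\boldsymbol\mu=-\Theta(\mathcal Rc_{\boldsymbol\mu}-A_{\boldsymbol\mu})\boldsymbol\mu,\qquad \Theta(L)\boldsymbol\mu=L\boldsymbol\mu(\cdot,\cdot)-\boldsymbol\mu(L\cdot,\cdot)-\boldsymbol\mu(\cdot,L\cdot),$$ for curves of skew-symmetric brackets. **Theorem.** Let $(\mathcal G_t)_{t\in[0,T)}$ be a left-invariant solution of the generalized Ricci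 flow on $(T\mathsf G\oplus T^*\mathsf G)_{H_0}$, and let $(\boldsymbol\mu(t))_{t\in[0,T')}$ be a solution of the generalized bracket flow with background $\mathcal G_0$ and initial condition $\boldsymbol\mu(0)_{\mathfrak g}=[\cdot,\cdot]_{\mathfrak g}$, $\boldsymbol\mu(0)_{\Lambda^3}=H_0$, both defined on a maximal interval of time. Then $T=T'$, every $\boldsymbol\mu(t)$ is a Dorfman bracket, and there is a smooth one-parameter family of generalized isometries $$F_t:\big((\mathfrak g\oplus\mathfrak g^*)_{H_0},\mathcal G_t\big)\longrightarrow\big((\mathfrak g\oplus\mathfrak g^*)_{\boldsymbol\mu(t)},\mathcal G_0\big),\qquad t\in[0,T),\quad F_0=\mathrm{Id},$$ that is, of linear automorphisms $F_t$ of $\mathfrak g\oplus\mathfrak g^*$ that cover linear automorphisms of $\mathfrak g$ under $\pi$, preserve $\langle\cdot,\cdot\rangle$, satisfy $F_t\,\boldsymbol\mu(0)(\cdot,\cdot)=\boldsymbol\mu(t)(F_t\cdot,F_t\cdot)$, and satisfy $F_t\,\mathcal G_t=\mathcal G_0\,F_t$ at the identity. Moreover, every maximal left-invariant solution of the generalized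 Ricci flow on $[0,T)$ has such a maximal generalized bracket flow on $[0,T)$, and conversely every maximal generalized bracket flow on $[0,T')$ with initial condition $\boldsymbol\mu(0)$ as above and background a left-invariant generalized metric $\mathcal G_0$ arises in this way from a maximal left-invariant solution of the generalized Ricci flow on $[0,T')$ with initial value $\mathcal G_0$. -/

import Mathlib

open scoped Manifold ContDiff

noncomputable section

namespace GenGeom

/-! ### Linear algebra of `V ⊕ V*` -/

section Fibre

set_option linter.unusedSectionVars false

variable {V : Type*} [AddCommGroup V] [Module ℝ V] [FiniteDimensional ℝ V]

/-- `V ⊕ V*`; an element `X + ξ` is the pair `(X, ξ)`. -/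
abbrev GT (V : Type*) [AddCommGroup V] [Module ℝ V] : Type _ := V × Module.Dual ℝ V

/-- Bilinear forms `V × V → ℝ`, seen as maps `V → V*`. -/
abbrev Form2 (V : Type*) [AddCommGroup V] [Module ℝ V] : Type _ := V →ₗ[ℝ] Module.Dual ℝ V

/-- Trilinear forms `V × V × V → ℝ`. -/
abbrev Form3 (V : Type*) [AddCommGroup V] [Module ℝ V] : Type _ :=
  V →ₗ[ℝ] V →ₗ[ℝ] Module.Dual ℝ V

/-- Bilinear products on `V`. -/
abbrev Prod2 (V : Type*) [AddCommGroup V] [Module ℝ V] : Type _ := V →ₗ[ℝ] V →ₗ[ℝ] V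

/-- Bilinear brackets on `V ⊕ V*`. -/
abbrev Brkt (V : Type*) [AddCommGroup V] [Module ℝ V] : Type _ :=
  GT V →ₗ[ℝ] GT V →ₗ[ℝ] GT V

/-- The neutral inner product `⟨X + ξ, Y + η⟩ = (ξ(Y) + η(X)) / 2`. -/
def pairing (a b : GT V) : ℝ := (a.2 b.1 + b.2 a.1) / 2

/-- The linear map that takes the same values as `f` on a basis of `V`. All functions `f` to which
this is applied below are linear, so that it only serves to bundle a linear function. -/
def lin {W : Type*} [AddCommGroup W] [Module ℝ W] (f : V → W) : V →ₗ[ℝ] W :=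
  (Module.finBasis ℝ V).constr ℝ fun i => f (Module.finBasis ℝ V i)

/-- A linear function is not changed by `lin`. -/
theorem lin_coe {W : Type*} [AddCommGroup W] [Module ℝ W] (f : V →ₗ[ℝ] W) :
    lin (fun v => f v) = f := by
  unfold lin
  exact (Module.finBasis ℝ V).ext fun i => by simp

/-- Bundling of a bilinear function. -/
def lin₂ {W : Type*} [AddCommGroup W] [Module ℝ W] (f : V → V → W) : V →ₗ[ℝ] V →ₗ[ℝ] W :=
  lin fun u => lin fun v => f u v

/-- Bundling of a trilinear function. -/
def lin₃ {W : Type*} [AddCommGroup W] [Module ℝ W] (f : V → V → V → W) :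
    V →ₗ[ℝ] V →ₗ[ℝ] V →ₗ[ℝ] W :=
  lin fun u => lin fun v => lin fun w => f u v w

/-- A generalized metric on `V ⊕ V*`: an endomorphism `𝒢`, orthogonal for the neutral inner
product, such that `⟨𝒢 a, b⟩` is symmetric and positive definite. -/
structure GenMetric (V : Type*) [AddCommGroup V] [Module ℝ V] where
  toEnd : Module.End ℝ (GT V)
  orth : ∀ a b, pairing (toEnd a) (toEnd b) = pairing a b
  symm : ∀ a b, pairing (toEnd a) b = pairing (toEnd b) a
  pos : ∀ a, a ≠ 0 → 0 < pairing (toEnd a) a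

namespace GenMetric

/-- The map `V* → V`, `ξ ↦ π (𝒢 ξ)`. For `𝒢 = 𝒢(g, b)` it is `g⁻¹`. -/
def sharpMap (𝒢 : GenMetric V) : Module.Dual ℝ V →ₗ[ℝ] V :=
  LinearMap.fst ℝ V (Module.Dual ℝ V) ∘ₗ 𝒢.toEnd ∘ₗ LinearMap.inr ℝ V (Module.Dual ℝ V)

theorem sharpMap_injective (𝒢 : GenMetric V) : Function.Injective 𝒢.sharpMap := by
  rw [← LinearMap.ker_eq_bot, LinearMap.ker_eq_bot']
  intro ξ h
  by_contra hξ
  have h1 := 𝒢.pos (0, ξ) (by simpa using hξ)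
  have h2 : (𝒢.toEnd (0, ξ)).1 = 0 := h
  simp [pairing, h2] at h1

/-- The inner product `g : V ≃ V*` of a generalized metric `𝒢 = 𝒢(g, b)`, where
`𝒢(g, b) = e^b (0, g⁻¹; g, 0) e^{-b} = (-g⁻¹ b, g⁻¹; g - b g⁻¹ b, b g⁻¹)`. -/
def g (𝒢 : GenMetric V) : V ≃ₗ[ℝ] Module.Dual ℝ V :=
  (LinearMap.linearEquivOfInjective 𝒢.sharpMap 𝒢.sharpMap_injective
    Subspace.dual_finrank_eq).symm

/-- The two-form `b : V → V*` of a generalized metric `𝒢 = 𝒢(g, b)`: as the upper left block of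
`𝒢(g, b)` is `-g⁻¹ b`, one has `b X = -g (π (𝒢 X))`. -/
def b (𝒢 : GenMetric V) : Form2 V :=
  -(𝒢.g.toLinearMap ∘ₗ LinearMap.fst ℝ V (Module.Dual ℝ V) ∘ₗ 𝒢.toEnd ∘ₗ
    LinearMap.inl ℝ V (Module.Dual ℝ V))

end GenMetric

/-- `e^b (X + ξ) = X + ξ + b(X, ·)`. -/
def expB (b : Form2 V) : Module.End ℝ (GT V) :=
  LinearMap.prod (LinearMap.fst ℝ V (Module.Dual ℝ V))
    (LinearMap.snd ℝ V (Module.Dual ℝ V) + b ∘ₗ LinearMap.fst ℝ V (Module.Dual ℝ V))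

/-- The endomorphism of `V ⊕ V*` with blocks `(p, q; r, s)`. -/
def blocks (p : V →ₗ[ℝ] V) (q : Module.Dual ℝ V →ₗ[ℝ] V) (r : V →ₗ[ℝ] Module.Dual ℝ V)
    (s : Module.Dual ℝ V →ₗ[ℝ] Module.Dual ℝ V) : Module.End ℝ (GT V) :=
  LinearMap.prod (LinearMap.coprod p q) (LinearMap.coprod r s)

/-- The trace of the bilinear form `B` with respect to the inner product `g`, that is
`∑ᵢ B(eᵢ, eᵢ)` for a `g`-orthonormal basis `(eᵢ)`. -/
def formTrace (g : V ≃ₗ[ℝ] Module.Dual ℝ V) (B : V → V → ℝ) : ℝ :=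
  LinearMap.trace ℝ V (lin fun u => g.symm (lin fun z => B u z))

/-- The symmetric form `H²(X, Y) = g(ι_X H, ι_Y H) = ∑ᵢⱼ H(X, eᵢ, eⱼ) H(Y, eᵢ, eⱼ)` for a
`g`-orthonormal basis `(eᵢ)`. -/
def sqForm (g : V ≃ₗ[ℝ] Module.Dual ℝ V) (H : Form3 V) : Form2 V :=
  lin₂ fun X Y => formTrace g fun u z => g (g.symm (H X u)) (g.symm (H Y z))

/-- The endomorphism
`e^b (g⁻¹ Ric^B, ½ g⁻¹ δ g⁻¹; -½ δ, -Ric^B g⁻¹) e^{-b}`, `Ric^B = Ric - ¼ H²`,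
which is the generalized Ricci curvature when `Ric` is the Ricci tensor of `g`, `H` the three-form
of the preferred splitting, and `δ = d^* H`. -/
def rcEnd (g : V ≃ₗ[ℝ] Module.Dual ℝ V) (b Ric : Form2 V) (H : Form3 V) (δ : Form2 V) :
    Module.End ℝ (GT V) :=
  let g' : Module.Dual ℝ V →ₗ[ℝ] V := g.symm.toLinearMap
  let RicB : Form2 V := Ric - (1 / 4 : ℝ) • sqForm g H
  expB b ∘ₗ
    blocks (g' ∘ₗ RicB) ((1 / 2 : ℝ) • (g' ∘ₗ δ ∘ₗ g')) (-((1 / 2 : ℝ) • δ)) (-(RicB ∘ₗ g')) ∘ₗ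
    expB (-b)

/-- The endomorphism `e^b (0, ½ g⁻¹ δ g⁻¹; ½ δ, 0) e^{-b}`. -/
def skewEnd (g : V ≃ₗ[ℝ] Module.Dual ℝ V) (b δ : Form2 V) : Module.End ℝ (GT V) :=
  let g' : Module.Dual ℝ V →ₗ[ℝ] V := g.symm.toLinearMap
  expB b ∘ₗ
    blocks 0 ((1 / 2 : ℝ) • (g' ∘ₗ δ ∘ₗ g')) ((1 / 2 : ℝ) • δ) 0 ∘ₗ
    expB (-b)

end Fibre

/-! ### Dorfman brackets on `𝔤 ⊕ 𝔤*` and the generalized bracket flow -/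

section Algebraic

variable {V : Type*} [AddCommGroup V] [Module ℝ V] [FiniteDimensional ℝ V]

/-- A Dorfman bracket: a skew-symmetric bilinear map `m` on `V ⊕ V*` such that `⟨m(·,·),·⟩` is
totally skew-symmetric, `m(V*, V*) = 0`, and the Jacobi identity holds. -/
def IsDorfman (m : Brkt V) : Prop :=
  (∀ a, m a a = 0) ∧
  (∀ a b c, pairing (m a b) c = -pairing (m a c) b) ∧
  (∀ ξ η : Module.Dual ℝ V, m (0, ξ) (0, η) = 0) ∧
  (∀ a b c, m (m a b) c + m (m b c) a + m (m c a) b = 0)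

/-- The projection of a bracket `m` to its Lie bracket `μ(X, Y) = π m(X, Y)`. -/
def liePart (m : Brkt V) : Prod2 V := lin₂ fun X Y => (m (X, 0) (Y, 0)).1

/-- The projection of a bracket `m` to its three-form `H(X, Y, Z) = 2 ⟨m(X, Y), Z⟩`. -/
def formPart (m : Brkt V) : Form3 V :=
  lin₃ fun X Y Z => 2 * pairing (m (X, 0) (Y, 0)) (Z, 0)

/-- The bracket `X + ξ, Y + η ↦ μ(X, Y) - η ∘ μ_X + ξ ∘ μ_Y + ι_Y ι_X H` with `μ_X = μ(X, ·)`. -/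
def dorfman (μ : Prod2 V) (H : Form3 V) : Brkt V :=
  LinearMap.mk₂ ℝ
    (fun a b : GT V => ((μ a.1 b.1, -(b.2 ∘ₗ μ a.1) + a.2 ∘ₗ μ b.1 + H a.1 b.1) : GT V))
    (fun a a' b => by ext <;> simp; abel)
    (fun c a b => by ext <;> simp)
    (fun a b b' => by ext <;> simp; abel)
    (fun c a b => by ext <;> simp)

/-- The differential of a left-invariant two-form. -/
def dAlg (μ : Prod2 V) (b : Form2 V) : Form3 V :=
  lin₃ fun X Y Z => -b (μ X Y) Z + b (μ X Z) Y - b (μ Y Z) X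

/-- The Levi-Civita connection of a metric Lie algebra (Koszul formula for left-invariant fields):
`2 g(∇_X Y, Z) = g(μ(X, Y), Z) - g(μ(X, Z), Y) - g(μ(Y, Z), X)`. -/
def nablaAlg (μ : Prod2 V) (g : V ≃ₗ[ℝ] Module.Dual ℝ V) (X Y : V) : V :=
  g.symm (lin fun Z => (1 / 2 : ℝ) * (g (μ X Y) Z - g (μ X Z) Y - g (μ Y Z) X))

/-- The curvature `R(X, Y)Z = ∇_X ∇_Y Z - ∇_Y ∇_X Z - ∇_{μ(X, Y)} Z`. -/
def riemAlg (μ : Prod2 V) (g : V ≃ₗ[ℝ] Module.Dual ℝ V) (X Y Z : V) : V :=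
  nablaAlg μ g X (nablaAlg μ g Y Z) - nablaAlg μ g Y (nablaAlg μ g X Z) -
    nablaAlg μ g (μ X Y) Z

/-- The Ricci tensor `Ric(Y, Z) = tr (X ↦ R(X, Y)Z)`. -/
def ricAlg (μ : Prod2 V) (g : V ≃ₗ[ℝ] Module.Dual ℝ V) : Form2 V :=
  lin₂ fun Y Z => LinearMap.trace ℝ V (lin fun X => riemAlg μ g X Y Z)

/-- The codifferential `(d^* H)(Y, Z) = -∑ᵢ (∇_{eᵢ} H)(eᵢ, Y, Z)` of a left-invariant three-form,
where `(eᵢ)` is a `g`-orthonormal basis. -/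
def codiffAlg (μ : Prod2 V) (g : V ≃ₗ[ℝ] Module.Dual ℝ V) (H : Form3 V) : Form2 V :=
  lin₂ fun Y Z => -formTrace g fun u z =>
    -H (nablaAlg μ g u z) Y Z - H z (nablaAlg μ g u Y) Z - H z Y (nablaAlg μ g u Z)

/-- The generalized Ricci curvature (at the identity) of the left-invariant metric exact Courant
algebroid given by the bracket `m` and the generalized metric `𝒢 = 𝒢(g, b)`. If `b = 0`, it is
`(Ric^B, ½ g⁻¹ (d^* H) g⁻¹; -½ d^* H, -(Ric^B)^*)`, and `e^{-b}` is an isometry from the structure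
with three-form `H` and generalized metric `𝒢(g, b)` to the one with `H + db` and `𝒢(g, 0)`. -/
def rcAlg (𝒢 : GenMetric V) (m : Brkt V) : Module.End ℝ (GT V) :=
  let μ := liePart m
  let H := formPart m + dAlg μ 𝒢.b
  rcEnd 𝒢.g 𝒢.b (ricAlg μ 𝒢.g) H (codiffAlg μ 𝒢.g H)

/-- The endomorphism `A_m`, skew-symmetric for both `⟨·,·⟩` and `⟨𝒢 ·,·⟩`. If `b = 0`, it is
`(0, ½ g⁻¹ (d^* H) g⁻¹; ½ d^* H, 0)`. -/
def skewAlg (𝒢 : GenMetric V) (m : Brkt V) : Module.End ℝ (GT V) :=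
  let μ := liePart m
  skewEnd 𝒢.g 𝒢.b (codiffAlg μ 𝒢.g (formPart m + dAlg μ 𝒢.b))

/-- The infinitesimal action `Θ(L) m = L m(·,·) - m(L·,·) - m(·,L·)`. -/
def Theta (L : Module.End ℝ (GT V)) (m : Brkt V) (a b : GT V) : GT V :=
  L (m a b) - m (L a) b - m a (L b)

/-- `m` solves on `[0, T)` the generalized bracket flow
`dm/dt = -Θ(Rc_m - A_m) m`, `m(0) = m₀`, with background generalized metric `𝒢`, as a curve of
skew-symmetric brackets. The equation is tested against the non-degenerate pairing `⟨·,·⟩`. -/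
structure IsBracketFlow (𝒢 : GenMetric V) (m₀ : Brkt V) (m : ℝ → Brkt V) (T : EReal) :
    Prop where
  pos : 0 < T
  init : m 0 = m₀
  skew : ∀ t : ℝ, 0 ≤ t → (t : EReal) < T → ∀ a, m t a a = 0
  eqn : ∀ t : ℝ, 0 ≤ t → (t : EReal) < T → ∀ a b c : GT V,
    HasDerivWithinAt (fun s => pairing (m s a b) c)
      (pairing (-Theta (rcAlg 𝒢 (m t) - skewAlg 𝒢 (m t)) (m t) a b) c) (Set.Ici 0) t

/-- A solution of the generalized bracket flow on `[0, T)` that does not extend beyond `T`. -/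
def IsMaximalBracketFlow (𝒢 : GenMetric V) (m₀ : Brkt V) (m : ℝ → Brkt V) (T : EReal) :
    Prop :=
  IsBracketFlow 𝒢 m₀ m T ∧
  ∀ (m' : ℝ → Brkt V) (T' : EReal), IsBracketFlow 𝒢 m₀ m' T' →
    (∀ t : ℝ, 0 ≤ t → (t : EReal) < T → m' t = m t) → T' ≤ T

/-- An isometry of left-invariant metric exact Courant algebroids, from `(V ⊕ V*, m₁, 𝒢₁)` to
`(V ⊕ V*, m₂, 𝒢₂)`: a linear isomorphism `F` that covers a linear isomorphism `h` of `V` (for the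
anchor maps), preserves the neutral inner product and the brackets, and intertwines the generalized
metrics. -/
structure IsIsometry (F : GT V ≃ₗ[ℝ] GT V) (m₁ : Brkt V) (𝒢₁ : GenMetric V)
    (m₂ : Brkt V) (𝒢₂ : GenMetric V) : Prop where
  anchor : ∃ h : V ≃ₗ[ℝ] V, ∀ a, (F a).1 = h a.1
  pairing_eq : ∀ a b, pairing (F a) (F b) = pairing a b
  bracket_eq : ∀ a b, F (m₁ a b) = m₂ (F a) (F b)
  metric_eq : ∀ a, F (𝒢₁.toEnd a) = 𝒢₂.toEnd (F a)

end Algebraic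

/-! ### Generalized geometry on a Lie group -/

section LieGroup

variable {E : Type*} [NormedAddCommGroup E] [NormedSpace ℝ E] [FiniteDimensional ℝ E]
  {G : Type*} [TopologicalSpace G] [ChartedSpace E G] [Group G]

instance tangentFinite (x : G) : FiniteDimensional ℝ (TangentSpace 𝓘(ℝ, E) x) :=
  inferInstanceAs (FiniteDimensional ℝ E)

/-- Vector fields on `G`. -/
abbrev VField (E : Type*) [NormedAddCommGroup E] [NormedSpace ℝ E]
    (G : Type*) [TopologicalSpace G] [ChartedSpace E G] : Type _ :=
  Π x : G, TangentSpace 𝓘(ℝ, E) x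

/-- Fields of bilinear forms on `G`. -/
abbrev Field2 (E : Type*) [NormedAddCommGroup E] [NormedSpace ℝ E]
    (G : Type*) [TopologicalSpace G] [ChartedSpace E G] : Type _ :=
  Π x : G, Form2 (TangentSpace 𝓘(ℝ, E) x)

/-- Fields of trilinear forms on `G`. -/
abbrev Field3 (E : Type*) [NormedAddCommGroup E] [NormedSpace ℝ E]
    (G : Type*) [TopologicalSpace G] [ChartedSpace E G] : Type _ :=
  Π x : G, Form3 (TangentSpace 𝓘(ℝ, E) x)

/-- Fields of inner products on `G`, as isomorphisms `TG ≃ T*G`. -/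
abbrev FieldMetric (E : Type*) [NormedAddCommGroup E] [NormedSpace ℝ E]
    (G : Type*) [TopologicalSpace G] [ChartedSpace E G] : Type _ :=
  Π x : G, TangentSpace 𝓘(ℝ, E) x ≃ₗ[ℝ] Module.Dual ℝ (TangentSpace 𝓘(ℝ, E) x)

/-- Generalized metrics on `TG ⊕ T*G`. -/
abbrev FieldGenMetric (E : Type*) [NormedAddCommGroup E] [NormedSpace ℝ E]
    (G : Type*) [TopologicalSpace G] [ChartedSpace E G] : Type _ :=
  Π x : G, GenMetric (TangentSpace 𝓘(ℝ, E) x)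

/-- The differential at `y` of the left translation by `x`. -/
def dL (x y : G) : TangentSpace 𝓘(ℝ, E) y →L[ℝ] TangentSpace 𝓘(ℝ, E) (x * y) :=
  mfderiv 𝓘(ℝ, E) 𝓘(ℝ, E) (x * ·) y

/-- The left-invariant vector field with value `v` at `x`. -/
def leftExt (x : G) (v : TangentSpace 𝓘(ℝ, E) x) : VField E G :=
  mulInvariantVectorField (I := 𝓘(ℝ, E))
    (mfderiv 𝓘(ℝ, E) 𝓘(ℝ, E) (x⁻¹ * ·) x v : TangentSpace 𝓘(ℝ, E) (x⁻¹ * x))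

/-- The derivative at `x` of the function `f` along the vector field `U`. -/
def der (U : VField E G) (f : G → ℝ) (x : G) : ℝ :=
  mfderiv 𝓘(ℝ, E) 𝓘(ℝ, ℝ) f x (U x)

/-- The Lie bracket of vector fields. -/
def lieB (U W : VField E G) : VField E G := VectorField.mlieBracket 𝓘(ℝ, E) U W

/-- The exterior derivative of a two-form, `(db)(U, V, W) = U b(V, W) - V b(U, W) + W b(U, V)
- b([U, V], W) + b([U, W], V) - b([V, W], U)`. -/
def d2 (b : Field2 E G) : Field3 E G := fun x =>
  lin₃ fun u v w =>
    let U := leftExt x u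
    let V := leftExt x v
    let W := leftExt x w
    der U (fun y => b y (V y) (W y)) x - der V (fun y => b y (U y) (W y)) x
      + der W (fun y => b y (U y) (V y)) x
      - b x (lieB U V x) w + b x (lieB U W x) v - b x (lieB V W x) u

/-- The exterior derivative of a three-form, evaluated on four tangent vectors. -/
def d3 (H : Field3 E G) (x : G) (u v w z : TangentSpace 𝓘(ℝ, E) x) : ℝ :=
  let U := leftExt x u
  let V := leftExt x v
  let W := leftExt x w
  let Z := leftExt x z
  der U (fun y => H y (V y) (W y) (Z y)) x - der V (fun y => H y (U y) (W y) (Z y)) x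
    + der W (fun y => H y (U y) (V y) (Z y)) x - der Z (fun y => H y (U y) (V y) (W y)) x
    - H x (lieB U V x) w z + H x (lieB U W x) v z - H x (lieB U Z x) v w
    - H x (lieB V W x) u z + H x (lieB V Z x) u w - H x (lieB W Z x) u v

/-- The Levi-Civita connection, by the Koszul formula
`2 g(∇_U V, W) = U g(V, W) + V g(U, W) - W g(U, V) + g([U, V], W) - g([U, W], V) - g([V, W], U)`. -/
def nabla (g : FieldMetric E G) (U V : VField E G) : VField E G := fun x =>
  (g x).symm (lin fun w =>
    let W := leftExt x w
    (1 / 2 : ℝ) * (der U (fun y => g y (V y) (W y)) x + der V (fun y => g y (U y) (W y)) x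
      - der W (fun y => g y (U y) (V y)) x
      + g x (lieB U V x) w - g x (lieB U W x) (V x) - g x (lieB V W x) (U x)))

/-- The curvature `R(U, V)W = ∇_U ∇_V W - ∇_V ∇_U W - ∇_{[U, V]} W`. -/
def riem (g : FieldMetric E G) (U V W : VField E G) : VField E G :=
  nabla g U (nabla g V W) - nabla g V (nabla g U W) - nabla g (lieB U V) W

/-- The Ricci tensor `Ric(v, w) = tr (u ↦ R(u, v)w)`; the curvature being tensorial, it is
evaluated on left-invariant extensions. -/
def ric (g : FieldMetric E G) : Field2 E G := fun x =>
  lin₂ fun v w => LinearMap.trace ℝ (TangentSpace 𝓘(ℝ, E) x)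
    (lin fun u => riem g (leftExt x u) (leftExt x v) (leftExt x w) x)

/-- The covariant derivative `(∇_U H)(A, B, C)` of a three-form. -/
def nablaForm (g : FieldMetric E G) (H : Field3 E G) (U A B C : VField E G) (x : G) : ℝ :=
  der U (fun y => H y (A y) (B y) (C y)) x - H x (nabla g U A x) (B x) (C x)
    - H x (A x) (nabla g U B x) (C x) - H x (A x) (B x) (nabla g U C x)

/-- The codifferential `(d^*_g H)(v, w) = -∑ᵢ (∇_{eᵢ} H)(eᵢ, v, w)` of a three-form. -/
def codiff (g : FieldMetric E G) (H : Field3 E G) : Field2 E G := fun x =>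
  lin₂ fun v w => -formTrace (g x) fun u z =>
    nablaForm g H (leftExt x u) (leftExt x z) (leftExt x v) (leftExt x w) x

/-- The generalized Ricci curvature of the generalized metric `𝒢 = 𝒢(g, b)` on the exact Courant
algebroid `(TG ⊕ T*G)_H`, that is, the conjugate by the isometry `e^{-b}` of the one of `𝒢(g, 0)` on
`(TG ⊕ T*G)_{H + db}`. -/
def genRic (H : Field3 E G) (𝒢 : FieldGenMetric E G) (x : G) :
    Module.End ℝ (GT (TangentSpace 𝓘(ℝ, E) x)) :=
  let g : FieldMetric E G := fun y => (𝒢 y).g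
  let b : Field2 E G := fun y => (𝒢 y).b
  let H' : Field3 E G := H + d2 b
  rcEnd (g x) (b x) (ric g x) (H' x) (codiff g H' x)

/-- `H` is a left-invariant closed differential three-form on `G`. -/
structure IsClosedLeftInvariant3Form (H : Field3 E G) : Prop where
  alt₁ : ∀ x u v, H x u u v = 0
  alt₂ : ∀ x u v, H x u v v = 0
  invariant : ∀ x y u v w, H (x * y) (dL x y u) (dL x y v) (dL x y w) = H y u v w
  closed : ∀ x u v w z, d3 H x u v w z = 0

/-- The generalized metric `𝒢` is left-invariant: it commutes with the lift
`(v, ξ) ↦ (dL_x v, ξ ∘ (dL_x)⁻¹)` of the left translations to `TG ⊕ T*G`. -/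
def IsLeftInvariant (𝒢 : FieldGenMetric E G) : Prop :=
  ∀ (x y : G) (v : TangentSpace 𝓘(ℝ, E) y)
    (η : Module.Dual ℝ (TangentSpace 𝓘(ℝ, E) (x * y))),
    ((𝒢 (x * y)).toEnd (dL x y v, η)).1 =
      dL x y ((𝒢 y).toEnd (v, η ∘ₗ (dL x y).toLinearMap)).1 ∧
    ((𝒢 (x * y)).toEnd (dL x y v, η)).2 ∘ₗ (dL x y).toLinearMap =
      ((𝒢 y).toEnd (v, η ∘ₗ (dL x y).toLinearMap)).2

/-- `𝒢` is on `[0, T)` a left-invariant solution on `(TG ⊕ T*G)_H` of the generalized Ricci flow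
`𝒢⁻¹ ∂𝒢/∂t = -2 Rc(𝒢)`. The equation is tested, in each fibre, against the non-degenerate pairing
`⟨·,·⟩`. -/
structure IsGenRicciFlow (H : Field3 E G) (𝒢 : ℝ → FieldGenMetric E G) (T : EReal) : Prop where
  pos : 0 < T
  invariant : ∀ t : ℝ, 0 ≤ t → (t : EReal) < T → IsLeftInvariant (𝒢 t)
  eqn : ∀ t : ℝ, 0 ≤ t → (t : EReal) < T → ∀ (x : G) (a c : GT (TangentSpace 𝓘(ℝ, E) x)),
    HasDerivWithinAt (fun s => pairing ((𝒢 s x).toEnd a) c)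
      (pairing (-(2 : ℝ) • (𝒢 t x).toEnd (genRic H (𝒢 t) x a)) c) (Set.Ici 0) t

/-- A left-invariant solution of the generalized Ricci flow on `[0, T)` that does not extend beyond
`T` as a left-invariant solution. -/
def IsMaximalGenRicciFlow (H : Field3 E G) (𝒢 : ℝ → FieldGenMetric E G) (T : EReal) : Prop :=
  IsGenRicciFlow H 𝒢 T ∧
  ∀ (𝒢' : ℝ → FieldGenMetric E G) (T' : EReal), IsGenRicciFlow H 𝒢' T' →
    (∀ t : ℝ, 0 ≤ t → (t : EReal) < T → 𝒢' t = 𝒢 t) → T' ≤ T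

/-- The Dorfman bracket on `𝔤 ⊕ 𝔤*`, `𝔤 = T_e G`, of the left-invariant exact Courant algebroid
`(TG ⊕ T*G)_H`: its Lie bracket is that of `𝔤`, its three-form is `H` at the identity. -/
def groupBracket (H : Field3 E G) : Brkt (GroupLieAlgebra 𝓘(ℝ, E) G) :=
  dorfman (lin₂ fun X Y : GroupLieAlgebra 𝓘(ℝ, E) G => ⁅X, Y⁆) (H 1)

end LieGroup

end GenGeom

end

open scoped Manifold ContDiff

noncomputable section

set_option maxSynthPendingDepth 3

namespace GenGeom

/-! ### Bundled multilinear functions, traces, and non-degeneracy of the neutral inner product. -/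

section LinearAlgebra

set_option linter.unusedSectionVars false

variable {V : Type*} [AddCommGroup V] [Module ℝ V] [FiniteDimensional ℝ V]
  {W : Type*} [AddCommGroup W] [Module ℝ W]

/-! By left invariance, the generalized Ricci flow is an ordinary differential equation for the
value of the metric at the identity, with the bracket `m₀` of `𝔤 ⊕ 𝔤*` held fixed (`IsMetricFlow`,
via `IsLeftInvariant.genRic_liftTriv`). The bracket flow instead holds the metric fixed and moves
the bracket. A moving frame exchanges the two points of view.

Let `L = Rc - A` be the generator, called `gauge`. Subtracting `A` cancels the block of `Rc` from
`V*` to `V`, so `L` preserves `V*`. On a Dorfman bracket `Ric^B` is symmetric and `d^*H` is skew, so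
`L` is skew for the neutral product. Finally `𝒢` anticommutes with `Rc` and commutes with `A`, so
that `L 𝒢 = 𝒢 L - 2 𝒢 Rc` (`gauge_toEnd`). All these objects are natural under isomorphisms of
metric Courant algebroids (`CourantIso.gauge_map`).

Given a metric flow, solve the linear equation `K' = L(𝒢_t, m₀) K` with `K(0) = 1`. Then `K` is
orthogonal, preserves `V*`, and `K⁻¹ 𝒢_t K` is constant. By naturality the brackets `K⁻¹ m₀(K·, K·)`
solve the bracket flow with background `𝒢_0`, and `F = K⁻¹` is the required family
(`IsMetricFlow.exists_bracketFlow`).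

Given a bracket flow, solve `F' = -L(𝒢₀, m_t) F`. Uniqueness for linear equations shows that `F`
carries `m₀` to `m_t`, which makes the Lie part of `m_t` a Lie bracket. Skewness of `L` is not yet
known, since the flow is only assumed to consist of skew-symmetric brackets. However, the defect
`⟨m(a, b), c⟩ + ⟨m(a, c), b⟩` satisfies a homogeneous linear equation along the flow, so it stays
zero. Hence `F` is orthogonal, `m_t` is Dorfman, and `F⁻¹ 𝒢₀ F` solves the metric equation
(`IsBracketFlow.exists_metricFlow`).

The bracket equation has a polynomial right-hand side, hence unique solutions; uniqueness for the
metric equation follows by passing to brackets (`IsMetricFlow.eqOn`). Since each flow on `[0, T)`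
yields one of the other kind on the same interval, the maximal intervals agree. Only linear
equations ever have to be solved. -/

theorem lin_apply {f : V → W} (hf : IsLinearMap ℝ f) (v : V) : lin f v = f v :=
  congrArg (fun l : V →ₗ[ℝ] W => l v) (lin_coe (hf.mk' f))

/-- The formula involves only the values of `f` on a basis. This is why the dependence of `lin f` on
`f` is linear, and regular in parameters, without any linearity of `f` itself. -/
theorem lin_eq_sum (f : V → W) (v : V) :
    lin f v = ∑ i, (Module.finBasis ℝ V).repr v i • f (Module.finBasis ℝ V i) := by
  simp [lin, Module.Basis.constr_apply_fintype]

theorem comp_lin {U : Type*} [AddCommGroup U] [Module ℝ U] (l : W →ₗ[ℝ] U) (f : V → W) :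
    l ∘ₗ lin f = lin fun v => l (f v) := by
  ext v
  simp [lin_eq_sum]

theorem lin₂_apply {f : V → V → W} (h₁ : ∀ v, IsLinearMap ℝ fun u => f u v)
    (h₂ : ∀ u, IsLinearMap ℝ (f u)) (u v : V) : lin₂ f u v = f u v := by
  have h : IsLinearMap ℝ fun u => lin fun v => f u v := by
    constructor
    · intro x y; ext v
      rw [LinearMap.add_apply, lin_apply (h₂ _), lin_apply (h₂ _), lin_apply (h₂ _)]
      exact (h₁ v).map_add x y
    · intro c x; ext v
      rw [LinearMap.smul_apply, lin_apply (h₂ _), lin_apply (h₂ _)]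
      exact (h₁ v).map_smul c x
  rw [lin₂, lin_apply h, lin_apply (h₂ u)]

theorem lin₃_apply {f : V → V → V → W} (h₁ : ∀ v w, IsLinearMap ℝ fun u => f u v w)
    (h₂ : ∀ u w, IsLinearMap ℝ fun v => f u v w) (h₃ : ∀ u v, IsLinearMap ℝ (f u v))
    (u v w : V) : lin₃ f u v w = f u v w := by
  have h : lin₃ f = lin fun u => lin₂ (f u) := rfl
  have h' : IsLinearMap ℝ fun u => lin₂ (f u) := by
    constructor
    · intro x y; ext v w
      rw [LinearMap.add_apply, LinearMap.add_apply, lin₂_apply (h₂ _) (h₃ _),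
        lin₂_apply (h₂ _) (h₃ _), lin₂_apply (h₂ _) (h₃ _)]
      exact (h₁ v w).map_add x y
    · intro c x; ext v w
      rw [LinearMap.smul_apply, LinearMap.smul_apply, lin₂_apply (h₂ _) (h₃ _),
        lin₂_apply (h₂ _) (h₃ _)]
      exact (h₁ v w).map_smul c x
  rw [h, lin_apply h', lin₂_apply (h₂ _) (h₃ _)]

theorem lin₂_coe (f : V →ₗ[ℝ] V →ₗ[ℝ] W) : (lin₂ fun u v => f u v) = f := by
  ext u v
  exact lin₂_apply (fun v => (f.flip v).isLinear) (fun u => (f u).isLinear) u v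

theorem lin₃_coe (f : V →ₗ[ℝ] V →ₗ[ℝ] V →ₗ[ℝ] W) : (lin₃ fun u v w => f u v w) = f := by
  have : ∀ u, (lin₂ fun v w => f u v w) = f u := fun u => lin₂_coe (f u)
  change (lin fun u => lin₂ fun v w => f u v w) = f
  simp only [this, lin_coe]

theorem formTrace_eq (g : V ≃ₗ[ℝ] Module.Dual ℝ V) (B : V → V → ℝ) :
    formTrace g B = LinearMap.trace ℝ V (g.symm.toLinearMap ∘ₗ lin₂ B) := by
  rw [lin₂, comp_lin]; rfl

theorem formTrace_coe (g : V ≃ₗ[ℝ] Module.Dual ℝ V) (B : Form2 V) :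
    formTrace g (fun u v => B u v) = LinearMap.trace ℝ V (g.symm.toLinearMap ∘ₗ B) := by
  rw [formTrace_eq, lin₂_coe]

theorem lin_add (f f' : V → W) : (lin fun v => f v + f' v) = lin f + lin f' := by
  ext v
  simp [lin_eq_sum, Finset.sum_add_distrib]

theorem lin_smul (c : ℝ) (f : V → W) : (lin fun v => c • f v) = c • lin f := by
  ext v
  simp [lin_eq_sum, Finset.smul_sum, smul_comm c]

theorem formTrace_add (g : V ≃ₗ[ℝ] Module.Dual ℝ V) (B C : V → V → ℝ) :
    (formTrace g fun u v => B u v + C u v) = formTrace g B + formTrace g C := by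
  simp only [formTrace, lin_add, map_add]

theorem formTrace_smul (g : V ≃ₗ[ℝ] Module.Dual ℝ V) (c : ℝ) (B : V → V → ℝ) :
    (formTrace g fun u v => c * B u v) = c * formTrace g B := by
  simp only [formTrace, ← smul_eq_mul, lin_smul, map_smul]

/-- Conjugating the transpose of `g⁻¹ B` by the symmetric map `g` gives `g⁻¹` composed with the
flipped form; transposition and conjugation preserve the trace. -/
theorem trace_symm_comp_flip (g : V ≃ₗ[ℝ] Module.Dual ℝ V) (hg : ∀ X Y, g X Y = g Y X)
    (B : Form2 V) :
    LinearMap.trace ℝ V (g.symm.toLinearMap ∘ₗ B.flip) =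
      LinearMap.trace ℝ V (g.symm.toLinearMap ∘ₗ B) := by
  rw [← LinearMap.trace_transpose' (g.symm.toLinearMap ∘ₗ B),
    ← LinearMap.trace_conj' _ g.symm]
  congr 1
  ext X
  apply g.injective
  ext Y
  simp [LinearEquiv.conj_apply, Module.Dual.transpose_apply, hg X]

theorem formTrace_flip (g : V ≃ₗ[ℝ] Module.Dual ℝ V) (hg : ∀ X Y, g X Y = g Y X)
    (B : Form2 V) : formTrace g (fun u v => B v u) = formTrace g (fun u v => B u v) := by
  rw [formTrace_coe, ← trace_symm_comp_flip g hg, ← formTrace_coe]; rfl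

/-! ### The neutral inner product -/

/-- The neutral inner product as a bilinear map. -/
def pairL (V : Type*) [AddCommGroup V] [Module ℝ V] : GT V →ₗ[ℝ] GT V →ₗ[ℝ] ℝ :=
  LinearMap.mk₂ ℝ pairing (fun a a' b => by simp [pairing]; ring)
    (fun c a b => by simp [pairing]; ring) (fun a b b' => by simp [pairing]; ring)
    (fun c a b => by simp [pairing]; ring)

theorem pairing_eq_pairL (a b : GT V) : pairing a b = pairL V a b := rfl

theorem pairing_comm (a b : GT V) : pairing a b = pairing b a := by
  simp [pairing, add_comm]

theorem exists_pairing_eq (φ : Module.Dual ℝ (GT V)) : ∃ c, ∀ a, φ a = pairing a c := by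
  -- Reflexivity of `V` represents the part of `φ` on `V*` by a vector. The factors 2 in the witness
  -- cancel the ½ of the neutral product.
  obtain ⟨X, hX⟩ := (Module.evalEquiv ℝ V).surjective (φ ∘ₗ LinearMap.inr ℝ V _)
  refine ⟨((2 : ℝ) • X, (2 : ℝ) • (φ ∘ₗ LinearMap.inl ℝ V _)), fun a => ?_⟩
  have h := LinearMap.congr_fun hX a.2
  simp only [Module.evalEquiv_apply, LinearMap.comp_apply] at h
  have h2 : φ a = φ (LinearMap.inl ℝ V _ a.1) + φ (LinearMap.inr ℝ V _ a.2) := by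
    rw [← map_add]; simp
  rw [h2, ← h]
  simp [pairing]; ring

theorem eq_of_pairing_left {a b : GT V} (h : ∀ c, pairing a c = pairing b c) : a = b := by
  have h2 : a.2 = b.2 := by
    ext Y
    simpa [pairing] using h (Y, 0)
  refine Prod.ext ?_ h2
  rw [← sub_eq_zero, ← Module.forall_dual_apply_eq_zero_iff ℝ]
  intro η
  have := h (0, η)
  simp [pairing] at this
  simp [this]

end LinearAlgebra

/-! ### Generalized metrics in normal form, and the block structure of `Rc` and `A`. -/

section FibreMetric

set_option linter.unusedSectionVars false

variable {V : Type*} [AddCommGroup V] [Module ℝ V] [FiniteDimensional ℝ V]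

theorem expB_apply (b : Form2 V) (a : GT V) : expB b a = (a.1, a.2 + b a.1) := rfl

theorem blocks_apply (p : V →ₗ[ℝ] V) (q : Module.Dual ℝ V →ₗ[ℝ] V) (r : V →ₗ[ℝ] Module.Dual ℝ V)
    (s : Module.Dual ℝ V →ₗ[ℝ] Module.Dual ℝ V) (a : GT V) :
    blocks p q r s a = (p a.1 + q a.2, r a.1 + s a.2) := rfl

theorem expB_expB_neg (b : Form2 V) (a : GT V) : expB b (expB (-b) a) = a := by
  simp [expB_apply]

theorem expB_neg_expB (b : Form2 V) (a : GT V) : expB (-b) (expB b a) = a := by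
  simp [expB_apply]

theorem pairing_expB_left (b : Form2 V) (hb : ∀ X Y, b X Y = -b Y X) (x y : GT V) :
    pairing (expB b x) y = pairing x (expB (-b) y) := by
  simp [pairing, expB_apply, hb x.1 y.1]; ring

namespace GenMetric

variable (𝒢 : GenMetric V)

theorem ext_toEnd {𝒢₁ 𝒢₂ : GenMetric V} (h : 𝒢₁.toEnd = 𝒢₂.toEnd) : 𝒢₁ = 𝒢₂ := by
  cases 𝒢₁; cases 𝒢₂; cases h; rfl

/-- Symmetry says that `𝒢` is its own adjoint, orthogonality that the adjoint is the inverse; so `𝒢²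
= 1`. -/
theorem toEnd_toEnd (a : GT V) : 𝒢.toEnd (𝒢.toEnd a) = a :=
  eq_of_pairing_left fun c => by
    rw [𝒢.symm, pairing_comm, 𝒢.orth]

theorem g_symm_apply (ξ : Module.Dual ℝ V) : 𝒢.g.symm ξ = (𝒢.toEnd (0, ξ)).1 := by
  simp [g, sharpMap]

theorem b_apply (X : V) : 𝒢.b X = -𝒢.g (𝒢.toEnd (X, 0)).1 := by
  simp [b]

theorem g_symm_comm (ξ η : Module.Dual ℝ V) : ξ (𝒢.g.symm η) = η (𝒢.g.symm ξ) := by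
  have := 𝒢.symm (0, η) (0, ξ)
  simpa [pairing, ← g_symm_apply] using this

theorem g_comm (X Y : V) : 𝒢.g X Y = 𝒢.g Y X := by
  simpa using 𝒢.g_symm_comm (𝒢.g X) (𝒢.g Y)

theorem toEnd_fst (a : GT V) : (𝒢.toEnd a).1 = 𝒢.g.symm (a.2 - 𝒢.b a.1) := by
  have : a = (a.1, 0) + (0, a.2) := by simp
  conv_lhs => rw [this, map_add, Prod.fst_add, ← g_symm_apply]
  simp [b_apply, add_comm]

theorem toEnd_inr_snd (ξ : Module.Dual ℝ V) : (𝒢.toEnd (0, ξ)).2 = 𝒢.b (𝒢.g.symm ξ) := by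
  have h := congrArg Prod.fst (𝒢.toEnd_toEnd (0, ξ))
  rw [toEnd_fst] at h
  have h2 := 𝒢.g.symm.injective (h.trans (map_zero _).symm)
  rw [sub_eq_zero] at h2
  rw [h2, g_symm_apply]

theorem b_skew (X Y : V) : 𝒢.b X Y = -𝒢.b Y X := by
  have h := 𝒢.symm (0, 𝒢.g X) (Y, 0)
  simp only [pairing, toEnd_inr_snd, LinearEquiv.symm_apply_apply, toEnd_fst] at h
  simp at h
  rw [𝒢.g_comm X] at h
  simpa using h

/-- The normal form `𝒢(g, b)` recovered from the abstract definition. The first row of blocks is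
read off from the definitions of `g` and `b`, and `𝒢² = 1` then determines the second row; in
particular the lower left block is `g - b g⁻¹ b`. -/
theorem toEnd_apply (a : GT V) :
    𝒢.toEnd a = expB 𝒢.b (blocks 0 𝒢.g.symm.toLinearMap 𝒢.g.toLinearMap 0 (expB (-𝒢.b) a)) := by
  have key : ∀ X, (𝒢.toEnd (X, 0)).2 = 𝒢.g X - 𝒢.b (𝒢.g.symm (𝒢.b X)) := by
    intro X
    have h := congrArg Prod.fst (𝒢.toEnd_toEnd (X, 0))
    rw [toEnd_fst, toEnd_fst] at h
    simp only [LinearEquiv.symm_apply_eq] at h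
    simp at h
    rw [← h]; simp
  have : a = (a.1, 0) + (0, a.2) := by simp
  refine Prod.ext ?_ ?_
  · rw [toEnd_fst]; simp [expB_apply, blocks_apply, sub_eq_add_neg]
  · conv_lhs => rw [this, map_add, Prod.snd_add, key, toEnd_inr_snd]
    simp [expB_apply, blocks_apply]; abel

/-- An intrinsic description of `b` and `g`: `𝒢` carries the graph of `b` onto `V*`, and `g` is the
resulting map. Isomorphisms transport `g` and `b` because of this. -/
theorem toEnd_expB (X : V) : 𝒢.toEnd (expB 𝒢.b (X, 0)) = (0, 𝒢.g X) := by
  rw [toEnd_apply, expB_neg_expB]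
  simp [expB_apply, blocks_apply]

end GenMetric

variable (g : V ≃ₗ[ℝ] Module.Dual ℝ V) (b Ric δ : Form2 V) (H : Form3 V)

theorem rcEnd_apply (a : GT V) : rcEnd g b Ric H δ a = expB b
    (blocks (g.symm.toLinearMap ∘ₗ (Ric - (1 / 4 : ℝ) • sqForm g H))
      ((1 / 2 : ℝ) • (g.symm.toLinearMap ∘ₗ δ ∘ₗ g.symm.toLinearMap)) (-((1 / 2 : ℝ) • δ))
      (-((Ric - (1 / 4 : ℝ) • sqForm g H) ∘ₗ g.symm.toLinearMap)) (expB (-b) a)) := rfl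

theorem skewEnd_apply (a : GT V) : skewEnd g b δ a = expB b
    (blocks 0 ((1 / 2 : ℝ) • (g.symm.toLinearMap ∘ₗ δ ∘ₗ g.symm.toLinearMap))
      ((1 / 2 : ℝ) • δ) 0 (expB (-b) a)) := rfl

/-- In the splitting given by `b` this is a product of block matrices. Anticommuting with the
involution `𝒢` means that `𝒢 Rc` is tangent to the solutions of `𝒢² = 1`, whereas `A` below commutes
with `𝒢` and so generates transformations fixing it. -/
theorem toEnd_rcEnd (𝒢 : GenMetric V) (a : GT V) :
    𝒢.toEnd (rcEnd 𝒢.g 𝒢.b Ric H δ a) = -rcEnd 𝒢.g 𝒢.b Ric H δ (𝒢.toEnd a) := by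
  simp only [𝒢.toEnd_apply, rcEnd_apply, expB_neg_expB, ← map_neg]
  congr 1
  simp [blocks_apply]
  constructor <;> abel

theorem toEnd_skewEnd (𝒢 : GenMetric V) (a : GT V) :
    𝒢.toEnd (skewEnd 𝒢.g 𝒢.b δ a) = skewEnd 𝒢.g 𝒢.b δ (𝒢.toEnd a) := by
  simp only [𝒢.toEnd_apply, skewEnd_apply, expB_neg_expB]
  congr 1
  simp [blocks_apply]

/-- The purpose of `A`: the upper right block of `Rc` cancels and the lower left one doubles,
leaving a block triangular endomorphism that preserves `V*`. -/
theorem rcEnd_sub_skewEnd_apply (a : GT V) : (rcEnd g b Ric H δ - skewEnd g b δ) a = expB b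
    (blocks (g.symm.toLinearMap ∘ₗ (Ric - (1 / 4 : ℝ) • sqForm g H)) 0 (-δ)
      (-((Ric - (1 / 4 : ℝ) • sqForm g H) ∘ₗ g.symm.toLinearMap)) (expB (-b) a)) := by
  rw [LinearMap.sub_apply, rcEnd_apply, skewEnd_apply, ← map_sub]
  congr 1
  simp only [blocks_apply]
  refine Prod.ext ?_ ?_
  · simp
  · simp
    module

/-- The diagonal blocks are skew because `Ric^B` is symmetric, so only the symmetric part of `δ`
remains. It is kept because `δ` is not known to be skew along a bracket flow until the brackets are
known to be Dorfman. -/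
theorem pairing_rcEnd_sub_skewEnd (hg : ∀ X Y, g X Y = g Y X) (hb : ∀ X Y, b X Y = -b Y X)
    (hR : ∀ X Y, (Ric - (1 / 4 : ℝ) • sqForm g H) X Y = (Ric - (1 / 4 : ℝ) • sqForm g H) Y X)
    (x y : GT V) :
    pairing ((rcEnd g b Ric H δ - skewEnd g b δ) x) y +
      pairing x ((rcEnd g b Ric H δ - skewEnd g b δ) y) =
      -(δ x.1 y.1 + δ y.1 x.1) / 2 := by
  have hg' : ∀ ξ η : Module.Dual ℝ V, ξ (g.symm η) = η (g.symm ξ) := fun ξ η => by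
    have := hg (g.symm ξ) (g.symm η); simpa using this
  rw [pairing_comm x, rcEnd_sub_skewEnd_apply, rcEnd_sub_skewEnd_apply, pairing_expB_left b hb,
    pairing_expB_left b hb]
  generalize Ric - (1 / 4 : ℝ) • sqForm g H = R at hR
  have e1 : ∀ z : GT V, (expB (-b) z).1 = z.1 := fun z => rfl
  simp only [pairing, blocks_apply, e1]
  generalize (expB (-b) x).2 = ξ
  generalize (expB (-b) y).2 = η
  simp [hg' η, hg' ξ, hR (g.symm ξ), hR (g.symm η)]
  ring

theorem rcEnd_sub_skewEnd_inr (ξ : Module.Dual ℝ V) :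
    ((rcEnd g b Ric H δ - skewEnd g b δ) (0, ξ)).1 = 0 := by
  rw [rcEnd_sub_skewEnd_apply]; simp [expB_apply, blocks_apply]

/-! ### Symmetry of the curvature forms -/

theorem sqForm_apply (X Y : V) :
    sqForm g H X Y = formTrace g fun u z => g (g.symm (H X u)) (g.symm (H Y z)) := by
  rw [sqForm, lin₂_apply] <;> intro <;> constructor <;> intros <;>
    simp [formTrace_add, formTrace_smul]

theorem sqForm_comm (hg : ∀ X Y, g X Y = g Y X) (X Y : V) : sqForm g H X Y = sqForm g H Y X := by
  have h := formTrace_flip g hg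
    ((g.toLinearMap ∘ₗ g.symm.toLinearMap ∘ₗ H Y).compl₂ (g.symm.toLinearMap ∘ₗ H X))
  rw [sqForm_apply, sqForm_apply]
  refine Eq.trans ?_ h
  congr 1
  ext u v
  exact hg (g.symm (H X u)) (g.symm (H Y v))

end FibreMetric

/-! ### Curvature symmetries of metric Lie algebras, and elementary properties of Dorfman brackets.
-/

section MetricLieAlgebra

set_option linter.unusedSectionVars false

variable {V : Type*} [AddCommGroup V] [Module ℝ V] [FiniteDimensional ℝ V]
  (μ : Prod2 V) (g : V ≃ₗ[ℝ] Module.Dual ℝ V) (H : Form3 V)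

theorem g_nablaAlg (X Y Z : V) : g (nablaAlg μ g X Y) Z =
    (1 / 2 : ℝ) * (g (μ X Y) Z - g (μ X Z) Y - g (μ Y Z) X) := by
  rw [nablaAlg, LinearEquiv.apply_symm_apply, lin_apply]
  constructor <;> intros <;> simp <;> ring

/-- The Levi-Civita connection of a metric Lie algebra as a bilinear map. -/
def nablaL : Prod2 V :=
  LinearMap.mk₂ ℝ (nablaAlg μ g)
    (fun X X' Y => by apply g.injective; ext Z; simp [g_nablaAlg]; ring)
    (fun c X Y => by apply g.injective; ext Z; simp [g_nablaAlg]; ring)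
    (fun X Y Y' => by apply g.injective; ext Z; simp [g_nablaAlg]; ring)
    (fun c X Y => by apply g.injective; ext Z; simp [g_nablaAlg]; ring)

theorem nablaAlg_eq (X Y : V) : nablaAlg μ g X Y = nablaL μ g X Y := rfl

theorem nablaL_sub_comm (hμ : ∀ X Y, μ X Y = -μ Y X) (X Y : V) :
    nablaL μ g X Y - nablaL μ g Y X = μ X Y := by
  apply g.injective; ext Z
  simp only [map_sub, LinearMap.sub_apply, ← nablaAlg_eq, g_nablaAlg]
  rw [hμ Y X]; simp; ring

theorem g_nablaL_skew (hg : ∀ X Y, g X Y = g Y X) (hμ : ∀ X Y, μ X Y = -μ Y X) (X Y Z : V) :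
    g (nablaL μ g X Y) Z = -g Y (nablaL μ g X Z) := by
  rw [hg Y]
  simp only [← nablaAlg_eq, g_nablaAlg]
  rw [hμ Z Y]; simp; ring

theorem riemAlg_eq (X Y Z : V) : riemAlg μ g X Y Z =
    nablaL μ g X (nablaL μ g Y Z) - nablaL μ g Y (nablaL μ g X Z) - nablaL μ g (μ X Y) Z := rfl

/-- Exchanging arguments of `∇` by torsion-freeness cancels every term containing `∇`, and minus the
Jacobi sum is left. -/
theorem riemAlg_bianchi (hμ : ∀ X Y, μ X Y = -μ Y X)
    (hJ : ∀ X Y Z, μ (μ X Y) Z + μ (μ Y Z) X + μ (μ Z X) Y = 0) (X Y Z : V) :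
    riemAlg μ g X Y Z + riemAlg μ g Y Z X + riemAlg μ g Z X Y = 0 := by
  have h := nablaL_sub_comm μ g hμ
  have e : ∀ X Y, nablaL μ g X Y = μ X Y + nablaL μ g Y X := fun X Y => by rw [← h X Y]; abel
  have e2 : ∀ A X Y, nablaL μ g A (nablaL μ g X Y) =
      nablaL μ g A (μ X Y) + nablaL μ g A (nablaL μ g Y X) := fun A X Y => by
    rw [e X Y, map_add]
  simp only [riemAlg_eq]
  rw [e (μ X Y), e (μ Y Z), e (μ Z X), e2 X Y, e2 Y Z, e2 Z X]
  rw [← neg_eq_zero, ← hJ X Y Z]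
  abel

/-- Pair symmetry combined with the two skew-symmetries, in the form that exchanges the traced slots
as well as the arguments of `Ric`; symmetry of `Ric` is then `formTrace_flip`. -/
theorem g_riemAlg_symm (hg : ∀ X Y, g X Y = g Y X) (hμ : ∀ X Y, μ X Y = -μ Y X)
    (hJ : ∀ X Y Z, μ (μ X Y) Z + μ (μ Y Z) X + μ (μ Z X) Y = 0) (X Y Z W : V) :
    g (riemAlg μ g X Y Z) W = g (riemAlg μ g W Z Y) X := by
  have a1 : ∀ X Y Z W, g (riemAlg μ g X Y Z) W = -g (riemAlg μ g Y X Z) W := fun X Y Z W => by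
    simp only [riemAlg_eq, hμ Y X]; simp; ring
  have a2 : ∀ X Y Z W, g (riemAlg μ g X Y Z) W = -g (riemAlg μ g X Y W) Z := fun X Y Z W => by
    have h₁ : ∀ A B C, g (nablaL μ g A B) C = -g (nablaL μ g A C) B := fun A B C => by
      rw [g_nablaL_skew μ g hg hμ, hg]
    have h₂ : ∀ A B C D, g (nablaL μ g A (nablaL μ g B C)) D =
        g (nablaL μ g B (nablaL μ g A D)) C := fun A B C D => by
      rw [g_nablaL_skew μ g hg hμ, h₁ B, neg_neg]
    simp only [riemAlg_eq, map_sub, LinearMap.sub_apply]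
    linarith [h₂ X Y Z W, h₂ Y X Z W, h₁ (μ X Y) Z W]
  have b : ∀ X Y Z W, g (riemAlg μ g X Y Z) W + g (riemAlg μ g Y Z X) W +
      g (riemAlg μ g Z X Y) W = 0 := fun X Y Z W => by
    rw [← LinearMap.add_apply, ← map_add, ← LinearMap.add_apply, ← map_add,
      riemAlg_bianchi μ g hμ hJ]
    simp
  -- The classical octahedron argument: the four Bianchi identities on cyclic shifts of the vectors,
  -- reduced by skew-symmetry in each pair of slots.
  linarith [b X Y Z W, b Y Z W X, b Z W X Y, b W X Y Z, a1 X Y Z W, a1 Y Z X W, a1 Z X Y W,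
    a1 Y Z W X, a1 Z W Y X, a1 W Y Z X, a1 Z W X Y, a1 W X Z Y, a1 X Z W Y, a1 W X Y Z,
    a1 X Y W Z, a1 Y W X Z, a2 X Y Z W, a2 Y Z X W, a2 Z X Y W, a2 W Z Y X,
    a2 Y Z W X, a2 Z W Y X, a2 W Y Z X, a2 Z W X Y, a2 W X Z Y, a2 X Z W Y, a2 W X Y Z,
    a2 X Y W Z, a2 Y W X Z, a2 W Z X Y, a1 W Z X Y, a1 W Z Y X]

theorem riemAlg_isLinear (Y Z : V) : IsLinearMap ℝ fun X => riemAlg μ g X Y Z := by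
  simp only [riemAlg_eq]
  constructor <;> intros <;> simp <;> module

theorem ricAlg_apply (Y Z : V) :
    ricAlg μ g Y Z = LinearMap.trace ℝ V (lin fun X => riemAlg μ g X Y Z) := by
  rw [ricAlg, lin₂_apply] <;> intro <;> simp only [riemAlg_eq] <;> constructor <;> intros
  all_goals simp only [← map_smul, ← map_add, ← lin_add, ← lin_smul]
  all_goals congr 2; ext; simp; module

theorem trace_lin_eq_formTrace {f : V → V} :
    LinearMap.trace ℝ V (lin f) = formTrace g fun u v => g (f u) v := by
  have : lin f = g.symm.toLinearMap ∘ₗ g.toLinearMap ∘ₗ lin f := by ext; simp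
  rw [formTrace_eq, this, comp_lin g.toLinearMap, lin₂]
  congr 3
  ext u : 1
  exact (lin_coe (g (f u))).symm

theorem ricAlg_comm (hg : ∀ X Y, g X Y = g Y X) (hμ : ∀ X Y, μ X Y = -μ Y X)
    (hJ : ∀ X Y Z, μ (μ X Y) Z + μ (μ Y Z) X + μ (μ Z X) Y = 0) (Y Z : V) :
    ricAlg μ g Y Z = ricAlg μ g Z Y := by
  rw [ricAlg_apply, ricAlg_apply, trace_lin_eq_formTrace g, trace_lin_eq_formTrace g]
  have h := formTrace_flip g hg (g.toLinearMap ∘ₗ (riemAlg_isLinear μ g Z Y).mk')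
  refine Eq.trans ?_ h
  congr 1
  ext u v
  exact g_riemAlg_symm μ g hg hμ hJ u Y Z v

theorem codiffAlg_apply (Y Z : V) : codiffAlg μ g H Y Z = -formTrace g fun u z =>
    -H (nablaAlg μ g u z) Y Z - H z (nablaAlg μ g u Y) Z - H z Y (nablaAlg μ g u Z) := by
  rw [codiffAlg, lin₂_apply] <;> intro <;> simp only [nablaAlg_eq] <;> constructor <;> intros
  all_goals simp only [smul_eq_mul, mul_neg, ← neg_add, ← formTrace_add, ← formTrace_smul]
  all_goals congr 2; ext u v; simp; ring

theorem codiffAlg_add (K : Form3 V) :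
    codiffAlg μ g (H + K) = codiffAlg μ g H + codiffAlg μ g K := by
  ext Y Z
  simp only [LinearMap.add_apply, codiffAlg_apply]
  rw [← neg_add, ← formTrace_add]
  congr 2; ext; ring

theorem codiffAlg_smul (c : ℝ) : codiffAlg μ g (c • H) = c • codiffAlg μ g H := by
  ext Y Z
  simp only [LinearMap.smul_apply, codiffAlg_apply, smul_eq_mul]
  rw [mul_neg, ← formTrace_smul]
  congr 2; ext; ring

/-- A trilinear form with the last two arguments exchanged. -/
def flip₂₃ (H : Form3 V) : Form3 V :=
  (LinearMap.lflip (R₀ := ℝ) (M := V) (N := V) (P := ℝ)).toLinearMap ∘ₗ H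

theorem flip₂₃_apply (X Y Z : V) : flip₂₃ H X Y Z = H X Z Y := rfl

/-- The codifferential commutes with exchanging the last two arguments, so the symmetric part of
`d^*H` sees only the failure of `H` to be skew in them. -/
theorem codiffAlg_add_flip (Y Z : V) :
    codiffAlg μ g H Y Z + codiffAlg μ g H Z Y = codiffAlg μ g (H + flip₂₃ H) Y Z := by
  rw [codiffAlg_add, LinearMap.add_apply, LinearMap.add_apply]
  refine congrArg (codiffAlg μ g H Y Z + ·) ?_
  rw [codiffAlg_apply, codiffAlg_apply]
  refine congrArg (fun B => -formTrace g B) (funext fun u => funext fun z => ?_)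
  simp only [flip₂₃_apply]
  ring

theorem dAlg_apply (b : Form2 V) (X Y Z : V) :
    dAlg μ b X Y Z = -b (μ X Y) Z + b (μ X Z) Y - b (μ Y Z) X := by
  rw [dAlg, lin₃_apply] <;> intros <;> constructor <;> intros <;> simp <;> ring

/-! ### Brackets on `V ⊕ V*` -/

variable (m : Brkt V)

/-- The restriction of a bracket to `V`. -/
def restrict (m : Brkt V) : V →ₗ[ℝ] V →ₗ[ℝ] GT V :=
  m.compl₁₂ (LinearMap.inl ℝ V (Module.Dual ℝ V)) (LinearMap.inl ℝ V (Module.Dual ℝ V))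

theorem restrict_apply (X Y : V) : restrict m X Y = m (X, 0) (Y, 0) := rfl

theorem liePart_eq : liePart m = (restrict m).compr₂ (LinearMap.fst ℝ V (Module.Dual ℝ V)) := by
  rw [← lin₂_coe ((restrict m).compr₂ (LinearMap.fst ℝ V (Module.Dual ℝ V))), liePart]
  congr 1

theorem liePart_apply (X Y : V) : liePart m X Y = (m (X, 0) (Y, 0)).1 := by
  rw [liePart_eq]; rfl

theorem formPart_eq : formPart m = (restrict m).compr₂ (LinearMap.snd ℝ V (Module.Dual ℝ V)) := by
  rw [← lin₃_coe ((restrict m).compr₂ (LinearMap.snd ℝ V (Module.Dual ℝ V))), formPart]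
  congr 1
  ext X Y Z
  simp [pairing, restrict_apply]
  ring

theorem formPart_apply (X Y Z : V) :
    formPart m X Y Z = 2 * pairing (m (X, 0) (Y, 0)) (Z, 0) := by
  rw [formPart_eq]
  simp [pairing, restrict_apply]
  ring

theorem dorfman_apply (a b : GT V) :
    dorfman μ H a b = (μ a.1 b.1, -(b.2 ∘ₗ μ a.1) + a.2 ∘ₗ μ b.1 + H a.1 b.1) := rfl

theorem liePart_dorfman : liePart (dorfman μ H) = μ := by
  ext X Y; simp [liePart_apply, dorfman_apply]

theorem formPart_dorfman : formPart (dorfman μ H) = H := by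
  ext X Y Z; simp [formPart_apply, dorfman_apply, pairing]; ring

namespace IsDorfman

variable {m} (hm : IsDorfman m)
include hm

theorem skew (a b : GT V) : m a b = -m b a := by
  have := hm.1 (a + b)
  simp only [map_add, LinearMap.add_apply, hm.1, zero_add, add_zero] at this
  exact eq_neg_of_add_eq_zero_right this

/-- Total skewness moves `η ∈ V*` into the bracket, where `m(V*, V*) = 0`. So `V*` is an ideal and
the bracket descends to `V`. -/
theorem inr_fst (ξ : Module.Dual ℝ V) (a : GT V) : (m (0, ξ) a).1 = 0 := by
  rw [← Module.forall_dual_apply_eq_zero_iff ℝ]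
  intro η
  have := hm.2.1 (0, ξ) a (0, η)
  rw [hm.2.2.1] at this
  simpa [pairing] using this

theorem fst_eq (a b : GT V) : (m a b).1 = liePart m a.1 b.1 := by
  have e : ∀ a : GT V, a = (a.1, 0) + (0, a.2) := by simp
  rw [liePart_apply]
  conv_lhs => rw [e a, e b]
  simp only [map_add, LinearMap.add_apply, Prod.fst_add, hm.inr_fst, hm.skew _ (0, b.2),
    Prod.fst_neg]
  simp

theorem liePart_skew (X Y : V) : liePart m X Y = -liePart m Y X := by
  rw [liePart_apply, liePart_apply, hm.skew]; rfl

theorem liePart_jacobi (X Y Z : V) : liePart m (liePart m X Y) Z + liePart m (liePart m Y Z) X +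
    liePart m (liePart m Z X) Y = 0 := by
  have := congrArg Prod.fst (hm.2.2.2 (X, 0) (Y, 0) (Z, 0))
  simpa [hm.fst_eq] using this

/-- Expanding on the graph of `b`, the terms linear in `b` give `db` and the others vanish. Thus `H
+ db` depends only on the bracket, the neutral product and the graph of `b`, all of which
isomorphisms preserve. -/
theorem preferred_form (b : Form2 V) (hb : ∀ X Y, b X Y = -b Y X) (X Y Z : V) :
    (formPart m + dAlg (liePart m) b) X Y Z =
      2 * pairing (m (expB b (X, 0)) (expB b (Y, 0))) (expB b (Z, 0)) := by
  have e : ∀ X, expB b (X, 0) = (X, 0) + (0, b X) := fun X => by simp [expB_apply]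
  have f : ∀ (a : GT V) (ξ : Module.Dual ℝ V), pairing a (0, ξ) = ξ a.1 / 2 := fun a ξ => by
    simp [pairing]
  have h₂ := hm.2.1 (X, 0) (0, b Y) (Z, 0)
  have h₄ := hm.2.1 (Y, 0) (0, b X) (Z, 0)
  rw [f, ← liePart_apply] at h₂ h₄
  have h₄' : pairing (m (0, b X) (Y, 0)) (Z, 0) = -pairing (m (Y, 0) (0, b X)) (Z, 0) := by
    rw [hm.skew, pairing_eq_pairL, map_neg]; rfl
  have h₃ : (m (X, 0) (0, b Y)).1 = 0 := by rw [hm.skew, Prod.fst_neg, hm.inr_fst, neg_zero]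
  simp only [LinearMap.add_apply, formPart_apply, dAlg_apply, e, map_add, hm.2.2.1, add_zero,
    pairing_eq_pairL]
  simp only [← pairing_eq_pairL, f, h₂, h₄, h₄', h₃, hm.inr_fst, ← liePart_apply, map_zero]
  rw [hb (liePart m X Y), hb (liePart m X Z), hb (liePart m Y Z)]
  ring

end IsDorfman

end MetricLieAlgebra

/-! ### Naturality of the curvature endomorphisms under isomorphisms of metric Courant algebroids.
-/

section Naturality

set_option linter.unusedSectionVars false

variable {V : Type*} [AddCommGroup V] [Module ℝ V] [FiniteDimensional ℝ V]
  {W : Type*} [AddCommGroup W] [Module ℝ W] [FiniteDimensional ℝ W]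
  {h : V ≃ₗ[ℝ] W} {g : V ≃ₗ[ℝ] Module.Dual ℝ V} {g' : W ≃ₗ[ℝ] Module.Dual ℝ W}
  {μ : Prod2 V} {μ' : Prod2 W} {H : Form3 V} {H' : Form3 W}

theorem form_eq_of_map {B : Form2 V} {B' : Form2 W} (hB : ∀ X Y, B' (h X) (h Y) = B X Y) (X : V) :
    B' (h X) = B X ∘ₗ h.symm.toLinearMap := by
  ext Y
  simpa using hB X (h.symm Y)

theorem g_symm_map (hg : ∀ X Y, g' (h X) (h Y) = g X Y) (ξ : Module.Dual ℝ V) :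
    g'.symm (ξ ∘ₗ h.symm.toLinearMap) = h (g.symm ξ) := by
  rw [LinearEquiv.symm_apply_eq]
  have := form_eq_of_map (B := g.toLinearMap) (B' := g'.toLinearMap) hg (g.symm ξ)
  simpa using this.symm

theorem trace_lin_map {f : V → V} {f' : W → W} (hf' : IsLinearMap ℝ f')
    (hf : ∀ X, f' (h X) = h (f X)) :
    LinearMap.trace ℝ W (lin f') = LinearMap.trace ℝ V (lin f) := by
  have : f = (h.symm.toLinearMap ∘ₗ hf'.mk' ∘ₗ h.toLinearMap : V →ₗ[ℝ] V) := by
    ext X; simp [hf]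
  rw [← LinearMap.trace_conj' (lin f) h]
  congr 1
  ext X
  rw [lin_apply hf', this, lin_coe]
  simp [LinearEquiv.conj_apply]

theorem formTrace_map (hg : ∀ X Y, g' (h X) (h Y) = g X Y) {B : V → V → ℝ} {B' : W → W → ℝ}
    (h₁ : ∀ Y, IsLinearMap ℝ fun X => B' X Y) (h₂ : ∀ X, IsLinearMap ℝ (B' X))
    (hB : ∀ X Y, B' (h X) (h Y) = B X Y) : formTrace g' B' = formTrace g B := by
  apply trace_lin_map (h := h)
  · constructor
    · intro X Y
      simp only [(h₁ _).map_add, lin_add, map_add]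
    · intro c X
      simp only [(h₁ _).map_smul, lin_smul, map_smul]
  · intro X
    rw [← g_symm_map hg]
    congr 1
    ext Y
    obtain ⟨Y, rfl⟩ := h.surjective Y
    have : (fun z => B X z) = ((h₂ (h X)).mk' ∘ₗ h.toLinearMap : V →ₗ[ℝ] ℝ) := by
      ext Z; simp [hB]
    rw [lin_apply (h₂ _), this, lin_coe]
    simp

theorem nablaAlg_map (hg : ∀ X Y, g' (h X) (h Y) = g X Y) (hμ : ∀ X Y, μ' (h X) (h Y) = h (μ X Y))
    (X Y : V) : nablaAlg μ' g' (h X) (h Y) = h (nablaAlg μ g X Y) := by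
  apply g'.injective
  ext Z
  obtain ⟨Z, rfl⟩ := h.surjective Z
  simp only [hg, g_nablaAlg, hμ]

theorem ricAlg_map (hg : ∀ X Y, g' (h X) (h Y) = g X Y) (hμ : ∀ X Y, μ' (h X) (h Y) = h (μ X Y))
    (Y Z : V) : ricAlg μ' g' (h Y) (h Z) = ricAlg μ g Y Z := by
  rw [ricAlg_apply, ricAlg_apply]
  refine trace_lin_map (h := h) (riemAlg_isLinear μ' g' (h Y) (h Z)) fun X => ?_
  simp only [riemAlg, nablaAlg_map hg hμ, hμ, map_sub]

theorem codiffAlg_map (hg : ∀ X Y, g' (h X) (h Y) = g X Y)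
    (hμ : ∀ X Y, μ' (h X) (h Y) = h (μ X Y)) (hH : ∀ X Y Z, H' (h X) (h Y) (h Z) = H X Y Z)
    (Y Z : V) : codiffAlg μ' g' H' (h Y) (h Z) = codiffAlg μ g H Y Z := by
  rw [codiffAlg_apply, codiffAlg_apply]
  refine congrArg Neg.neg (formTrace_map hg ?_ ?_ ?_)
  · intro; simp only [nablaAlg_eq]; constructor <;> intros <;> simp <;> ring
  · intro; simp only [nablaAlg_eq]; constructor <;> intros <;> simp <;> ring
  · intro u z; simp only [nablaAlg_map hg hμ, hH]

theorem sqForm_map (hg : ∀ X Y, g' (h X) (h Y) = g X Y)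
    (hH : ∀ X Y Z, H' (h X) (h Y) (h Z) = H X Y Z) (X Y : V) :
    sqForm g' H' (h X) (h Y) = sqForm g H X Y := by
  rw [sqForm_apply, sqForm_apply]
  refine formTrace_map hg ?_ ?_ ?_
  · intro; constructor <;> intros <;> simp
  · intro; constructor <;> intros <;> simp
  · intro u z
    have : ∀ X u, g'.symm (H' (h X) (h u)) = h (g.symm (H X u)) := fun X u => by
      rw [← g_symm_map hg]; congr 1; ext Z; simpa using hH X u (h.symm Z)
    rw [this, this, hg]

/-- An isomorphism `F` of metric exact Courant algebroids, covering the isomorphism `h`. -/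
structure CourantIso (h : V ≃ₗ[ℝ] W) (F : GT V ≃ₗ[ℝ] GT W) (m : Brkt V) (𝒢 : GenMetric V)
    (m' : Brkt W) (𝒢' : GenMetric W) : Prop where
  anchor : ∀ a, (F a).1 = h a.1
  pairing_eq : ∀ a b, pairing (F a) (F b) = pairing a b
  bracket_eq : ∀ a b, F (m a b) = m' (F a) (F b)
  metric_eq : ∀ a, F (𝒢.toEnd a) = 𝒢'.toEnd (F a)

/-- The anchor condition sends `V*` into `W*`; pairing with lifts of vectors then leaves no freedom
there. -/
theorem inr_of_anchor {F : GT V ≃ₗ[ℝ] GT W} (ha : ∀ a, (F a).1 = h a.1)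
    (hp : ∀ a b, pairing (F a) (F b) = pairing a b) (ξ : Module.Dual ℝ V) :
    F (0, ξ) = (0, ξ ∘ₗ h.symm.toLinearMap) := by
  refine Prod.ext (by simp [ha]) ?_
  ext Y
  have := hp (0, ξ) (h.symm Y, 0)
  simpa [pairing, ha] using this

/-- The bracket of a Courant algebroid isomorphic to a Dorfman bracket is one. -/
theorem IsDorfman.map {m : Brkt V} (hm : IsDorfman m) {F : GT V ≃ₗ[ℝ] GT W} {m' : Brkt W}
    (ha : ∀ a, (F a).1 = h a.1)
    (hp : ∀ a b, pairing (F a) (F b) = pairing a b) (hb : ∀ a b, F (m a b) = m' (F a) (F b)) :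
    IsDorfman m' := by
  refine ⟨fun a => ?_, fun a b c => ?_, fun ξ η => ?_, fun a b c => ?_⟩
  · obtain ⟨a, rfl⟩ := F.surjective a
    rw [← hb, hm.1, map_zero]
  · obtain ⟨a, rfl⟩ := F.surjective a
    obtain ⟨b, rfl⟩ := F.surjective b
    obtain ⟨c, rfl⟩ := F.surjective c
    rw [← hb, ← hb, hp, hp, hm.2.1]
  · have e : ∀ ξ : Module.Dual ℝ W, (0, ξ) = F (0, ξ ∘ₗ h.toLinearMap) := fun ξ => by
      rw [inr_of_anchor ha hp]
      refine Prod.ext rfl ?_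
      ext; simp
    rw [e, e, ← hb, hm.2.2.1, map_zero]
  · obtain ⟨a, rfl⟩ := F.surjective a
    obtain ⟨b, rfl⟩ := F.surjective b
    obtain ⟨c, rfl⟩ := F.surjective c
    rw [← hb, ← hb, ← hb, ← hb, ← hb, ← hb, ← map_add, ← map_add, hm.2.2.2, map_zero]

namespace CourantIso

variable {F : GT V ≃ₗ[ℝ] GT W} {m : Brkt V} {𝒢 : GenMetric V} {m' : Brkt W} {𝒢' : GenMetric W}
  (I : CourantIso h F m 𝒢 m' 𝒢')
include I

theorem map_inr (ξ : Module.Dual ℝ V) : F (0, ξ) = (0, ξ ∘ₗ h.symm.toLinearMap) :=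
  inr_of_anchor I.anchor I.pairing_eq ξ

/-- The graph of `b` consists of the elements that the generalized metric sends into `V*`, and `F`
respects both `𝒢` and the cotangent part. -/
theorem map_expB_inl (X : V) : F (expB 𝒢.b (X, 0)) = expB 𝒢'.b (h X, 0) := by
  have h₁ := congrArg Prod.fst (I.metric_eq (expB 𝒢.b (X, 0)))
  rw [𝒢.toEnd_expB, I.map_inr, 𝒢'.toEnd_fst, I.anchor] at h₁
  have h₂ := 𝒢'.g.symm.injective ((map_zero _).trans h₁)
  refine Prod.ext (by rw [I.anchor]; rfl) ?_
  rw [eq_comm, sub_eq_zero] at h₂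
  rw [h₂]
  simp [expB_apply]

theorem g_map (X Y : V) : 𝒢'.g (h X) (h Y) = 𝒢.g X Y := by
  have := congrArg Prod.snd (I.metric_eq (expB 𝒢.b (X, 0)))
  rw [I.map_expB_inl, 𝒢.toEnd_expB, 𝒢'.toEnd_expB, I.map_inr] at this
  simpa using (LinearMap.congr_fun this (h Y)).symm

theorem map_expB (a : GT V) :
    F (expB 𝒢.b a) = expB 𝒢'.b (h a.1, a.2 ∘ₗ h.symm.toLinearMap) := by
  have e : ∀ (b : Form2 V) (a : GT V), expB b a = expB b (a.1, 0) + (0, a.2) := fun b a => by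
    simp [expB_apply, add_comm]
  have e' : ∀ (b : Form2 W) (a : GT W), expB b a = expB b (a.1, 0) + (0, a.2) := fun b a => by
    simp [expB_apply, add_comm]
  rw [e, map_add, I.map_expB_inl, I.map_inr, ← e' _ (h a.1, a.2 ∘ₗ h.symm.toLinearMap)]

theorem liePart_map (hm' : IsDorfman m') (X Y : V) :
    liePart m' (h X) (h Y) = h (liePart m X Y) := by
  have := congrArg Prod.fst (I.bracket_eq (X, 0) (Y, 0))
  rw [hm'.fst_eq] at this
  simp only [I.anchor, ← liePart_apply] at this
  exact this.symm

theorem form_map (hm : IsDorfman m) (hm' : IsDorfman m') (X Y Z : V) :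
    (formPart m' + dAlg (liePart m') 𝒢'.b) (h X) (h Y) (h Z) =
      (formPart m + dAlg (liePart m) 𝒢.b) X Y Z := by
  rw [hm.preferred_form _ 𝒢.b_skew, hm'.preferred_form _ 𝒢'.b_skew]
  simp only [← I.map_expB_inl, ← I.bracket_eq, I.pairing_eq]

theorem rcAlg_map (hm : IsDorfman m) (hm' : IsDorfman m') (a : GT V) :
    F (rcAlg 𝒢 m a) = rcAlg 𝒢' m' (F a) := by
  have hg := I.g_map
  have hμ := I.liePart_map hm'
  have hH := I.form_map hm hm'
  have hR := form_eq_of_map (h := h)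
    (B := ricAlg (liePart m) 𝒢.g -
      (1 / 4 : ℝ) • sqForm 𝒢.g (formPart m + dAlg (liePart m) 𝒢.b))
    (B' := ricAlg (liePart m') 𝒢'.g -
      (1 / 4 : ℝ) • sqForm 𝒢'.g (formPart m' + dAlg (liePart m') 𝒢'.b)) (fun X Y => by
      simp only [LinearMap.sub_apply, LinearMap.smul_apply, ricAlg_map hg hμ, sqForm_map hg hH])
  have hδ := form_eq_of_map (codiffAlg_map hg hμ hH)
  -- Passing to the preferred splittings on both sides turns `F` into the lift of `h`, and the claim
  -- becomes block by block invariance of `g`, `Ric^B` and `d^*H`.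
  obtain ⟨a, rfl⟩ : ∃ a', a = expB 𝒢.b a' := ⟨_, (expB_expB_neg _ _).symm⟩
  rw [I.map_expB, rcAlg, rcEnd_apply, rcAlg, rcEnd_apply, expB_neg_expB, expB_neg_expB, I.map_expB]
  generalize ricAlg (liePart m) 𝒢.g -
    (1 / 4 : ℝ) • sqForm 𝒢.g (formPart m + dAlg (liePart m) 𝒢.b) = R at hR ⊢
  generalize ricAlg (liePart m') 𝒢'.g -
    (1 / 4 : ℝ) • sqForm 𝒢'.g (formPart m' + dAlg (liePart m') 𝒢'.b) = R' at hR ⊢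
  congr 1
  simp only [blocks_apply, LinearMap.comp_apply, LinearEquiv.coe_coe, g_symm_map hg,
    LinearMap.smul_apply, LinearMap.neg_apply, hR, hδ, map_add, map_smul]
  refine Prod.ext rfl ?_
  ext; simp

theorem skewAlg_map (hm : IsDorfman m) (hm' : IsDorfman m') (a : GT V) :
    F (skewAlg 𝒢 m a) = skewAlg 𝒢' m' (F a) := by
  have hg := I.g_map
  have hδ := form_eq_of_map (codiffAlg_map hg (I.liePart_map hm') (I.form_map hm hm'))
  obtain ⟨a, rfl⟩ : ∃ a', a = expB 𝒢.b a' := ⟨_, (expB_expB_neg _ _).symm⟩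
  rw [I.map_expB, skewAlg, skewEnd_apply, skewAlg, skewEnd_apply, expB_neg_expB, expB_neg_expB,
    I.map_expB]
  congr 1
  simp only [blocks_apply, LinearMap.comp_apply, LinearEquiv.coe_coe, g_symm_map hg,
    LinearMap.smul_apply, LinearMap.zero_apply, hδ, map_smul, zero_add, add_zero]
  refine Prod.ext rfl ?_
  ext; simp

end CourantIso

end Naturality

/-! ### Linear differential equations solved by the series of iterated integrals. -/

section LinearODE

open MeasureTheory Set

variable {F : Type*} [NormedAddCommGroup F] [NormedSpace ℝ F]

/-- The terms of the series of iterated integrals of the linear equation `y' = A y`, `y(0) = x`. -/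
def iteratedIntegral (A : ℝ → F →L[ℝ] F) (x : F) : ℕ → ℝ → F
  | 0 => fun _ => x
  | n + 1 => fun t => ∫ s in (0 : ℝ)..t, A s (iteratedIntegral A x n s)

variable {A : ℝ → F →L[ℝ] F} {U : Set ℝ}

theorem hasDerivAt_integral_of_continuousOn [CompleteSpace F] {f : ℝ → F} (hU : IsOpen U)
    (hU' : U.OrdConnected) (h0 : 0 ∈ U) (hf : ContinuousOn f U) {t : ℝ} (ht : t ∈ U) :
    HasDerivAt (fun u => ∫ s in (0 : ℝ)..u, f s) (f t) t :=
  intervalIntegral.integral_hasDerivAt_right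
    ((hf.mono (hU'.uIcc_subset h0 ht)).intervalIntegrable)
    (hf.stronglyMeasurableAtFilter hU t ht) (hf.continuousAt (hU.mem_nhds ht))

theorem continuousOn_iteratedIntegral [CompleteSpace F] (hU : IsOpen U)
    (hU' : U.OrdConnected) (h0 : 0 ∈ U) (hA : ContinuousOn A U) (x : F) (n : ℕ) :
    ContinuousOn (iteratedIntegral A x n) U := by
  induction n with
  | zero => exact continuousOn_const
  | succ n ih =>
    exact fun t ht => (hasDerivAt_integral_of_continuousOn hU hU' h0
      (hA.clm_apply ih) ht).continuousAt.continuousWithinAt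

/-- Each integration raises the power of `|t|` by one and divides by the new exponent, which
produces the factorial. Unoriented integrals treat both signs of `t` at once. -/
theorem norm_iteratedIntegral_le {a b C : ℝ} (x : F) (h0 : 0 ∈ Icc a b)
    (hc : ∀ n, ContinuousOn (fun s => A s (iteratedIntegral A x n s)) (Icc a b))
    (hC : ∀ t ∈ Icc a b, ‖A t‖ ≤ C) (n : ℕ) :
    ∀ t ∈ Icc a b, ‖iteratedIntegral A x n t‖ ≤ ‖x‖ * C ^ n / n.factorial * |t| ^ n := by
  have hC0 : 0 ≤ C := (norm_nonneg _).trans (hC 0 h0)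
  induction n with
  | zero => intro t _; simp [iteratedIntegral]
  | succ n ih =>
    intro t ht
    have hsub : uIcc 0 t ⊆ Icc a b := uIcc_subset_Icc h0 ht
    have hi : ContinuousOn (fun s => ‖A s (iteratedIntegral A x n s)‖) (uIcc 0 t) :=
      ((hc n).mono hsub).norm
    have hj : Continuous fun s : ℝ => C * (‖x‖ * C ^ n / n.factorial) * |s - 0| ^ n := by
      fun_prop
    calc ‖iteratedIntegral A x (n + 1) t‖
        ≤ ∫ s in uIoc 0 t, ‖A s (iteratedIntegral A x n s)‖ :=
          intervalIntegral.norm_integral_le_integral_norm_uIoc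
      _ ≤ ∫ s in uIoc 0 t, C * (‖x‖ * C ^ n / n.factorial) * |s - 0| ^ n := by
          refine setIntegral_mono_on ?_ ?_ measurableSet_uIoc fun s hs => ?_
          · exact intervalIntegrable_iff.1 hi.intervalIntegrable
          · exact intervalIntegrable_iff.1 (hj.intervalIntegrable _ _)
          · have hs' := hsub (uIoc_subset_uIcc hs)
            refine ((A s).le_opNorm _).trans ?_
            rw [sub_zero, mul_assoc]
            exact mul_le_mul (hC s hs') (ih s hs') (norm_nonneg _) hC0
      _ = ‖x‖ * C ^ (n + 1) / (n + 1).factorial * |t| ^ (n + 1) := by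
          rw [integral_const_mul, integral_pow_abs_sub_uIoc, sub_zero, Nat.factorial_succ]
          push_cast
          field_simp
          ring

/-- On compact subintervals `A` is bounded and the series is dominated by an exponential series, so
it can be differentiated term by term. Linearity thus gives a solution on all of `U`, with no escape
in finite time. -/
theorem exists_hasDerivAt_linear [CompleteSpace F]
    (hU : IsOpen U) (hU' : U.OrdConnected) (h0 : 0 ∈ U)
    (hI : ∀ t ∈ U, ∃ a b, t ∈ Ioo a b ∧ 0 ∈ Ioo a b ∧ Icc a b ⊆ U)
    (hA : ContinuousOn A U) (x : F) :
    ∃ y : ℝ → F, y 0 = x ∧ ∀ t ∈ U, HasDerivAt y (A t (y t)) t := by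
  have hc := continuousOn_iteratedIntegral hU hU' h0 hA x
  have h00 : ∀ n, n ≠ 0 → iteratedIntegral A x n 0 = 0 := fun n hn => by
    obtain ⟨n, rfl⟩ := Nat.exists_eq_succ_of_ne_zero hn
    simp [iteratedIntegral]
  refine ⟨fun t => ∑' n, iteratedIntegral A x n t, ?_, fun t ht => ?_⟩
  · change (∑' n, iteratedIntegral A x n 0) = x
    rw [tsum_eq_single 0 h00]; rfl
  obtain ⟨a, b, hta, h0a, hab⟩ := hI t ht
  obtain ⟨C, hC⟩ := isCompact_Icc.exists_bound_of_continuousOn (hA.mono hab)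
  have hC0 : 0 ≤ C := (norm_nonneg _).trans (hC 0 (Ioo_subset_Icc_self h0a))
  have hb := norm_iteratedIntegral_le x (Ioo_subset_Icc_self h0a)
    (fun n => (hA.clm_apply (hc n)).mono hab) hC
  set R := max |a| |b|
  have hR : ∀ s ∈ Icc a b, |s| ≤ R := fun s hs => abs_le_max_abs_abs hs.1 hs.2
  have hb' : ∀ n, ∀ s ∈ Icc a b,
      ‖iteratedIntegral A x n s‖ ≤ ‖x‖ * ((C * R) ^ n / n.factorial) := fun n s hs => by
    refine (hb n s hs).trans ?_
    rw [mul_pow, mul_div_assoc, mul_assoc, div_mul_eq_mul_div]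
    have := hR s hs
    gcongr
  have hs : Summable fun n : ℕ => ‖x‖ * ((C * R) ^ n / n.factorial) :=
    (Real.summable_pow_div_factorial _).mul_left _
  have hsum : ∀ s ∈ Icc a b, Summable fun n => iteratedIntegral A x n s := fun s hs' =>
    Summable.of_norm_bounded hs fun n => hb' n s hs'
  -- The derivative of the constant term is 0, and that of each later term is `A` applied to its
  -- predecessor; the shift by one makes the differentiated series `A` applied to the series itself.
  let g' : ℕ → ℝ → F := fun n s => Nat.casesOn n 0 fun k => A s (iteratedIntegral A x k s)
  let u : ℕ → ℝ := fun n => Nat.casesOn n 0 fun k : ℕ => C * (‖x‖ * ((C * R) ^ k / k.factorial))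
  have key : HasDerivAt (fun z => ∑' n, iteratedIntegral A x n z) (∑' n, g' n t) t := by
    refine hasDerivAt_tsum_of_isPreconnected (u := u) (t := Ioo a b) (y₀ := 0) ?_ isOpen_Ioo
      isPreconnected_Ioo ?_ ?_ h0a (hsum 0 (Ioo_subset_Icc_self h0a)) hta
    · rw [← summable_nat_add_iff 1]
      exact hs.mul_left C
    · intro n s hs'
      cases n with
      | zero => exact hasDerivAt_const _ _
      | succ n =>
        exact hasDerivAt_integral_of_continuousOn hU hU' h0 (hA.clm_apply (hc n))
          (hab (Ioo_subset_Icc_self hs'))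
    · intro n s hs'
      have hs' := Ioo_subset_Icc_self hs'
      cases n with
      | zero => simp [g', u]
      | succ n =>
        exact ((A s).le_opNorm _).trans
          (mul_le_mul (hC s hs') (hb' n s hs') (norm_nonneg _) hC0)
  have ht' := hsum t (Ioo_subset_Icc_self hta)
  have e : (∑' n, g' n t) = A t (∑' n, iteratedIntegral A x n t) := by
    rw [ContinuousLinearMap.map_tsum _ ht']
    have hg : Summable fun n => g' n t := by
      rw [← summable_nat_add_iff 1]
      exact (A t).summable ht'
    rw [hg.tsum_eq_zero_add]
    simp [g']
  rwa [e] at key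

end LinearODE

/-! ### A calculus of families whose components lie in a given algebra of functions. -/

section Regularity

set_option linter.unusedSectionVars false

open Module Set

variable {X : Type*} {A : Subalgebra ℝ (X → ℝ)}
  {V : Type*} [AddCommGroup V] [Module ℝ V] [FiniteDimensional ℝ V]
  {W : Type*} [AddCommGroup W] [Module ℝ W]
  {Z : Type*} [AddCommGroup Z] [Module ℝ Z]

/-- The functions `c : X → W` all of whose components belong to the algebra `A` of functions. -/
def Reg (A : Subalgebra ℝ (X → ℝ)) (c : X → W) : Prop :=
  ∀ φ : Dual ℝ W, (fun x => φ (c x)) ∈ A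

namespace Reg

theorem const (w : W) : Reg A fun _ => w := fun φ => A.algebraMap_mem (φ w)

theorem map {c : X → W} (hc : Reg A c) (l : W →ₗ[ℝ] Z) : Reg A fun x => l (c x) :=
  fun φ => hc (φ ∘ₗ l)

theorem add {c d : X → W} (hc : Reg A c) (hd : Reg A d) : Reg A fun x => c x + d x := fun φ => by
  simp only [map_add]
  exact A.add_mem (hc φ) (hd φ)

theorem sub {c d : X → W} (hc : Reg A c) (hd : Reg A d) : Reg A fun x => c x - d x := fun φ => by
  simp only [map_sub]
  exact A.sub_mem (hc φ) (hd φ)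

theorem neg {c : X → W} (hc : Reg A c) : Reg A fun x => -c x := fun φ => by
  simp only [map_neg]
  exact A.neg_mem (hc φ)

theorem sum {ι : Type*} (s : Finset ι) {c : ι → X → W} (hc : ∀ i, Reg A (c i)) :
    Reg A fun x => ∑ i ∈ s, c i x := fun φ => by
  have := A.sum_mem (t := s) fun i _ => hc i φ
  convert this using 1
  ext x; simp

theorem mem {f : X → ℝ} (hf : Reg A f) : f ∈ A := hf LinearMap.id

theorem of_mem {f : X → ℝ} (hf : f ∈ A) : Reg A f := fun φ => by
  have : (fun x => φ (f x)) = φ 1 • f := by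
    ext x
    rw [← mul_one (f x), ← smul_eq_mul, map_smul]
    simp [mul_comm]
  rw [this]
  exact A.smul_mem hf _

theorem smul {f : X → ℝ} {c : X → W} (hf : Reg A f) (hc : Reg A c) :
    Reg A fun x => f x • c x := fun φ => by
  simp only [map_smul]
  exact A.mul_mem hf.mem (hc φ)

theorem mul {f f' : X → ℝ} (hf : Reg A f) (hf' : Reg A f') : Reg A fun x => f x * f' x :=
  hf.smul hf'

theorem const_smul {c : X → W} (hc : Reg A c) (r : ℝ) : Reg A fun x => r • c x :=
  (const r).smul hc

theorem bilin (B : V →ₗ[ℝ] W →ₗ[ℝ] Z) {c : X → V} {d : X → W} (hc : Reg A c) (hd : Reg A d) :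
    Reg A fun x => B (c x) (d x) := by
  have : (fun x => B (c x) (d x)) = fun x =>
      ∑ i, (finBasis ℝ V).coord i (c x) • B (finBasis ℝ V i) (d x) := by
    ext x
    conv_lhs => rw [← (finBasis ℝ V).sum_repr (c x)]
    simp only [map_sum, map_smul, LinearMap.sum_apply, LinearMap.smul_apply, Basis.coord_apply]
  rw [this]
  exact sum _ fun i => (of_mem (hc _)).smul (hd.map _)

theorem of_apply {c : X → V →ₗ[ℝ] W} (hc : ∀ v, Reg A fun x => c x v) : Reg A c := by
  have : c = fun x => ∑ i, LinearMap.smulRightₗ ((finBasis ℝ V).coord i) (c x (finBasis ℝ V i)) := by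
    ext x v
    conv_lhs => rw [← (finBasis ℝ V).sum_repr v]
    simp only [map_sum, map_smul, LinearMap.sum_apply,
      LinearMap.smulRight_apply, Basis.coord_apply, LinearMap.smulRightₗ_apply]
  rw [this]
  exact sum _ fun i => (hc _).map _

theorem apply {c : X → V →ₗ[ℝ] W} {d : X → V} [FiniteDimensional ℝ W] (hc : Reg A c)
    (hd : Reg A d) : Reg A fun x => c x (d x) :=
  bilin LinearMap.id hc hd

theorem comp [FiniteDimensional ℝ W] {c : X → V →ₗ[ℝ] W} [FiniteDimensional ℝ Z]
    {d : X → W →ₗ[ℝ] Z} (hd : Reg A d) (hc : Reg A c) : Reg A fun x => d x ∘ₗ c x :=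
  of_apply fun v => hd.apply (hc.apply (const v))

theorem lin {f : X → V → W} (hf : ∀ v, Reg A fun x => f x v) : Reg A fun x => lin (f x) :=
  of_apply fun v => by
    simp only [lin_eq_sum]
    exact sum _ fun i => (hf _).const_smul _

theorem lin₂ {f : X → V → V → W} (hf : ∀ u v, Reg A fun x => f x u v) :
    Reg A fun x => lin₂ (f x) :=
  lin fun u => lin fun v => hf u v

theorem lin₃ {f : X → V → V → V → W} (hf : ∀ u v w, Reg A fun x => f x u v w) :
    Reg A fun x => lin₃ (f x) :=
  lin fun u => lin fun v => lin fun w => hf u v w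

theorem prodMk {c : X → W} {d : X → Z} (hc : Reg A c) (hd : Reg A d) :
    Reg A fun x => (c x, d x) := by
  have : (fun x => (c x, d x)) = fun x => LinearMap.inl ℝ W Z (c x) + LinearMap.inr ℝ W Z (d x) := by
    ext x <;> simp
  rw [this]
  exact (hc.map _).add (hd.map _)

theorem fst {c : X → W × Z} (hc : Reg A c) : Reg A fun x => (c x).1 :=
  hc.map (LinearMap.fst ℝ W Z)

theorem snd {c : X → W × Z} (hc : Reg A c) : Reg A fun x => (c x).2 :=
  hc.map (LinearMap.snd ℝ W Z)

theorem pairing {c d : X → GT V} (hc : Reg A c) (hd : Reg A d) :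
    Reg A fun x => pairing (c x) (d x) :=
  bilin (pairL V) hc hd

theorem det {n : Type*} [Fintype n] [DecidableEq n] {M : X → Matrix n n ℝ}
    (hM : ∀ i j, (fun x => M x i j) ∈ A) : (fun x => (M x).det) ∈ A := by
  have : (fun x => (M x).det) = ∑ σ : Equiv.Perm n,
      (σ.sign : ℤ) • ∏ i, (fun x => M x (σ i) i) := by
    ext x
    simp [Matrix.det_apply, Units.smul_def]
  rw [this]
  exact A.sum_mem fun σ _ => A.zsmul_mem (A.prod_mem fun i _ => hM _ _) _

/-- Inversion of linear isomorphisms preserves regularity. -/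
theorem symm [FiniteDimensional ℝ W] (hA : ∀ f ∈ A, (∀ x, f x ≠ 0) → f⁻¹ ∈ A)
    {e : X → V ≃ₗ[ℝ] W} (he : Reg A fun x => (e x).toLinearMap) :
    Reg A fun x => (e x).symm.toLinearMap := by
  classical
  rcases isEmpty_or_nonempty X with hX | ⟨⟨x₀⟩⟩
  · intro φ; convert A.zero_mem
  -- The basis of `W` is the image of that of `V` under `e x₀`, so both carry the same index type
  -- and the matrices are square; the inverse is then adjugate over determinant.
  let v := finBasis ℝ V
  let w := v.map (e x₀)
  let M : X → Matrix _ _ ℝ := fun x => LinearMap.toMatrix v w (e x).toLinearMap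
  let N : X → Matrix _ _ ℝ := fun x => LinearMap.toMatrix w v (e x).symm.toLinearMap
  have hM : ∀ i j, (fun x => M x i j) ∈ A := fun i j => by
    have := (he.apply (const (v j))).map (w.coord i)
    simpa [M, LinearMap.toMatrix_apply] using this.mem
  have hMN : ∀ x, M x * N x = 1 := fun x => by
    rw [← LinearMap.toMatrix_comp, LinearEquiv.comp_coe]; simp
  have hdet : ∀ x, (M x).det ≠ 0 := fun x h => by
    have := congrArg Matrix.det (hMN x)
    simp [h] at this
  have hN : ∀ x, N x = (M x).det⁻¹ • (M x).adjugate := fun x => by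
    rw [← Matrix.inv_eq_right_inv (hMN x), Matrix.inv_def, Ring.inverse_eq_inv']
  have hN' : ∀ i j, (fun x => N x i j) ∈ A := fun i j => by
    have h₁ := hA _ (det hM) hdet
    have h₂ : (fun x => (M x).adjugate i j) ∈ A := by
      simp only [Matrix.adjugate_apply]
      refine det fun k l => ?_
      by_cases hk : k = j
      · subst hk; simp only [Matrix.updateRow_self]; exact A.algebraMap_mem _
      · simpa [Matrix.updateRow_ne hk] using hM k l
    have := A.mul_mem h₁ h₂
    convert this using 1
    ext x; simp [hN]
  have hS : ∀ x, (e x).symm.toLinearMap = Matrix.toLin w v (N x) := fun x => by simp [N]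
  refine of_apply fun u => ?_
  have : (fun x => (e x).symm.toLinearMap u) = fun x =>
      ∑ i, (∑ j, w.repr u j • N x i j) • v i := by
    ext x
    rw [hS, Matrix.toLin_apply]
    simp [Matrix.mulVec, dotProduct, mul_comm]
  rw [this]
  exact sum _ fun i => (sum _ fun j => (of_mem (hN' i j)).const_smul _).smul (const _)

end Reg

end Regularity

/-! ### Differential equations for curves in spaces without a norm, tested against linear
functionals. -/

section WeakODE

set_option linter.unusedSectionVars false

open Module Set

variable {V : Type*} [AddCommGroup V] [Module ℝ V] [FiniteDimensional ℝ V]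
  {W : Type*} [AddCommGroup W] [Module ℝ W]
  {Z : Type*} [AddCommGroup Z] [Module ℝ Z]

/-- The algebra of functions that are `C^n` on `s`. -/
def contDiffAlg {X : Type*} [NormedAddCommGroup X] [NormedSpace ℝ X] (n : ℕ∞ω) (s : Set X) :
    Subalgebra ℝ (X → ℝ) where
  carrier := {f | ContDiffOn ℝ n f s}
  mul_mem' ha hb := ContDiffOn.mul ha hb
  add_mem' ha hb := ContDiffOn.add ha hb
  algebraMap_mem' _ := contDiffOn_const

/-- The algebra of continuous functions on a topological space. -/
def contAlg (X : Type*) [TopologicalSpace X] : Subalgebra ℝ (X → ℝ) where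
  carrier := {f | Continuous f}
  mul_mem' ha hb := Continuous.mul ha hb
  add_mem' ha hb := Continuous.add ha hb
  algebraMap_mem' _ := continuous_const

/-- The interval `[0, T)`. -/
def timeSet (T : EReal) : Set ℝ := {t | 0 ≤ t ∧ (t : EReal) < T}

theorem isOpen_lt_time (T : EReal) : IsOpen {t : ℝ | (t : EReal) < T} :=
  isOpen_Iio.preimage continuous_coe_real_ereal

theorem uniqueDiffOn_timeSet (T : EReal) : UniqueDiffOn ℝ (timeSet T) :=
  (uniqueDiffOn_Ici 0).inter (isOpen_lt_time T)

theorem Icc_subset_timeSet {T : EReal} {t : ℝ} (ht : t ∈ timeSet T) : Icc 0 t ⊆ timeSet T :=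
  fun _ hs => ⟨hs.1, (EReal.coe_le_coe_iff.2 hs.2).trans_lt ht.2⟩

theorem zero_mem_timeSet {T : EReal} (hT : 0 < T) : (0 : ℝ) ∈ timeSet T := ⟨le_rfl, hT⟩

/-- The curve `y` in the finite-dimensional space `W`, defined on `[0, ∞)`, has the derivative `y'`
at `t`. -/
def WDeriv (y : ℝ → W) (y' : W) (t : ℝ) : Prop :=
  ∀ φ : Dual ℝ W, HasDerivWithinAt (fun s => φ (y s)) (φ y') (Ici 0) t

namespace WDeriv

variable {t : ℝ}

theorem const (w : W) : WDeriv (fun _ => w) 0 t := fun φ => by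
  simpa using hasDerivWithinAt_const t (Ici 0) (φ w)

theorem map {y : ℝ → W} {y' : W} (h : WDeriv y y' t) (l : W →ₗ[ℝ] Z) :
    WDeriv (fun s => l (y s)) (l y') t := fun φ => h (φ ∘ₗ l)

theorem sub {y z : ℝ → W} {y' z' : W} (h : WDeriv y y' t) (h' : WDeriv z z' t) :
    WDeriv (fun s => y s - z s) (y' - z') t := fun φ => by
  simp only [map_sub]
  exact (h φ).sub (h' φ)

theorem sum {ι : Type*} (u : Finset ι) {y : ι → ℝ → W} {y' : ι → W}
    (h : ∀ i, WDeriv (y i) (y' i) t) : WDeriv (fun s => ∑ i ∈ u, y i s) (∑ i ∈ u, y' i) t :=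
  fun φ => by
    simp only [map_sum]
    exact HasDerivWithinAt.fun_sum fun i _ => h i φ

theorem real {f : ℝ → ℝ} {f' : ℝ} (h : WDeriv f f' t) : HasDerivWithinAt f f' (Ici 0) t :=
  h LinearMap.id

theorem of_real {f : ℝ → ℝ} {f' : ℝ} (h : HasDerivWithinAt f f' (Ici 0) t) : WDeriv f f' t :=
  fun φ => by
    have e : ∀ r : ℝ, φ r = φ 1 * r := fun r => by
      rw [mul_comm, ← smul_eq_mul, ← map_smul, smul_eq_mul, mul_one]
    rw [e f', funext fun s => e (f s)]
    exact h.const_mul _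

theorem smul {f : ℝ → ℝ} {f' : ℝ} {y : ℝ → W} {y' : W} (hf : WDeriv f f' t)
    (h : WDeriv y y' t) : WDeriv (fun s => f s • y s) (f' • y t + f t • y') t := fun φ => by
  simp only [map_smul, map_add, smul_eq_mul]
  exact hf.real.fun_mul (h φ)

theorem bilin (B : V →ₗ[ℝ] W →ₗ[ℝ] Z) {y : ℝ → V} {z : ℝ → W} {y' : V} {z' : W}
    (h : WDeriv y y' t) (h' : WDeriv z z' t) :
    WDeriv (fun s => B (y s) (z s)) (B y' (z t) + B (y t) z') t := by
  have e : ∀ a c, B a c = ∑ i, (finBasis ℝ V).coord i a • B (finBasis ℝ V i) c := fun a c => by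
    conv_lhs => rw [← (finBasis ℝ V).sum_repr a]
    simp only [map_sum, map_smul, LinearMap.sum_apply, LinearMap.smul_apply, Basis.coord_apply]
  have := sum Finset.univ fun i => (h.map ((finBasis ℝ V).coord i)).smul (h'.map (B (finBasis ℝ V i)))
  rw [Finset.sum_add_distrib, ← e, ← e] at this
  simpa only [← e] using this

theorem of_apply {y : ℝ → V →ₗ[ℝ] W} {y' : V →ₗ[ℝ] W}
    (h : ∀ v, WDeriv (fun s => y s v) (y' v) t) : WDeriv y y' t := by
  have e : ∀ l : V →ₗ[ℝ] W, l = ∑ i, LinearMap.smulRightₗ ((finBasis ℝ V).coord i)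
      (l (finBasis ℝ V i)) := fun l => by
    ext v
    conv_lhs => rw [← (finBasis ℝ V).sum_repr v]
    simp only [map_sum, map_smul, LinearMap.sum_apply,
      LinearMap.smulRight_apply, Basis.coord_apply, LinearMap.smulRightₗ_apply]
  have := sum Finset.univ fun i =>
    (h (finBasis ℝ V i)).map (LinearMap.smulRightₗ ((finBasis ℝ V).coord i))
  rw [← e] at this
  simpa only [← e] using this

theorem apply [FiniteDimensional ℝ W] {y : ℝ → V →ₗ[ℝ] W} {y' : V →ₗ[ℝ] W} {z : ℝ → V} {z' : V}
    (h : WDeriv y y' t) (h' : WDeriv z z' t) :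
    WDeriv (fun s => y s (z s)) (y' (z t) + y t z') t :=
  bilin LinearMap.id h h'

theorem apply_const [FiniteDimensional ℝ W] {y : ℝ → V →ₗ[ℝ] W} {y' : V →ₗ[ℝ] W}
    (h : WDeriv y y' t) (v : V) : WDeriv (fun s => y s v) (y' v) t := by
  simpa using h.apply (const v)

theorem pairing {y z : ℝ → GT V} {y' z' : GT V} (h : WDeriv y y' t) (h' : WDeriv z z' t) :
    HasDerivWithinAt (fun s => pairing (y s) (z s))
      (GenGeom.pairing y' (z t) + GenGeom.pairing (y t) z') (Ici 0) t :=
  (bilin (pairL V) h h').real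

theorem of_pairing {y : ℝ → GT V} {y' : GT V} (h : ∀ c, HasDerivWithinAt
    (fun s => GenGeom.pairing (y s) c) (GenGeom.pairing y' c) (Ici 0) t) : WDeriv y y' t :=
  fun φ => by
    obtain ⟨c, hc⟩ := exists_pairing_eq φ
    simp only [hc]
    exact h c

/-- In coordinates, weak derivatives are derivatives. -/
theorem hasDerivWithinAt {y : ℝ → V} {y' : V} (h : WDeriv y y' t) :
    HasDerivWithinAt (fun s => (finBasis ℝ V).equivFun (y s)) ((finBasis ℝ V).equivFun y')
      (Ici 0) t :=
  hasDerivWithinAt_pi.2 fun i => h ((finBasis ℝ V).coord i)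

theorem of_hasDerivWithinAt {x : ℝ → Fin (finrank ℝ V) → ℝ} {x' : Fin (finrank ℝ V) → ℝ}
    (h : HasDerivWithinAt x x' (Ici 0) t) :
    WDeriv (fun s => (finBasis ℝ V).equivFun.symm (x s)) ((finBasis ℝ V).equivFun.symm x') t :=
  fun φ => (LinearMap.toContinuousLinearMap
    (φ ∘ₗ (finBasis ℝ V).equivFun.symm.toLinearMap)).hasFDerivAt.comp_hasDerivWithinAt t h

theorem congr_deriv {y : ℝ → W} {y' y'' : W} (h : WDeriv y y' t) (e : y' = y'') :
    WDeriv y y'' t := e ▸ h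

theorem congr {T : EReal} {y z : ℝ → W} {y' : W} (h : WDeriv y y' t)
    (e : ∀ s ∈ timeSet T, z s = y s) (ht : t ∈ timeSet T) : WDeriv z y' t := fun φ => by
  refine (h φ).congr_of_eventuallyEq ?_ (by rw [e t ht])
  filter_upwards [inter_mem_nhdsWithin (Ici 0) ((isOpen_lt_time T).mem_nhds ht.2)] with s hs
  rw [e s hs]

end WDeriv

/-- On `[0, b]` both solutions are continuous, hence stay in a common ball in coordinates, where a
Lipschitz bound suffices for Grönwall uniqueness. -/
theorem eqOn_of_wderiv {T : EReal} {v : ℝ → V → V} (hv : ∀ b ∈ timeSet T, ∀ R : ℝ, ∃ K,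
      ∀ t ∈ Icc 0 b, LipschitzOnWith K
        (fun x => (finBasis ℝ V).equivFun (v t ((finBasis ℝ V).equivFun.symm x)))
        (Metric.closedBall 0 R))
    {y z : ℝ → V} (hy : ∀ t ∈ timeSet T, WDeriv y (v t (y t)) t)
    (hz : ∀ t ∈ timeSet T, WDeriv z (v t (z t)) t) (h0 : y 0 = z 0) :
    ∀ t ∈ timeSet T, y t = z t := by
  intro b hb
  have hI := Icc_subset_timeSet hb
  have hc : ∀ {y : ℝ → V}, (∀ t ∈ timeSet T, WDeriv y (v t (y t)) t) →
      ContinuousOn (fun s => (finBasis ℝ V).equivFun (y s)) (Icc 0 b) := fun hy t ht =>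
    ((hy t (hI ht)).hasDerivWithinAt.continuousWithinAt).mono fun s hs => hs.1
  obtain ⟨R₁, hR₁⟩ := isCompact_Icc.exists_bound_of_continuousOn (hc hy)
  obtain ⟨R₂, hR₂⟩ := isCompact_Icc.exists_bound_of_continuousOn (hc hz)
  obtain ⟨K, hK⟩ := hv b hb (max R₁ R₂)
  have hd : ∀ {y : ℝ → V}, (∀ t ∈ timeSet T, WDeriv y (v t (y t)) t) → ∀ t ∈ Ico 0 b,
      HasDerivWithinAt (fun s => (finBasis ℝ V).equivFun (y s))
        ((finBasis ℝ V).equivFun (v t ((finBasis ℝ V).equivFun.symm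
          ((finBasis ℝ V).equivFun (y t))))) (Ici t) t := fun hy t ht => by
    rw [LinearEquiv.symm_apply_apply]
    exact (hy t (hI (Ico_subset_Icc_self ht))).hasDerivWithinAt.mono (Ici_subset_Ici.2 ht.1)
  have := ODE_solution_unique_of_mem_Icc_right
    (v := fun t x => (finBasis ℝ V).equivFun (v t ((finBasis ℝ V).equivFun.symm x)))
    (s := fun _ => Metric.closedBall 0 (max R₁ R₂)) (K := K)
    (fun t ht => hK t (Ico_subset_Icc_self ht)) (hc hy) (hd hy)
    (fun t ht => by simpa using Or.inl (hR₁ t (Ico_subset_Icc_self ht))) (hc hz) (hd hz)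
    (fun t ht => by simpa using Or.inr (hR₂ t (Ico_subset_Icc_self ht))) (by simp [h0])
  exact (finBasis ℝ V).equivFun.injective (this ⟨hb.1, le_rfl⟩)

/-- Solutions of an autonomous `C^1` differential equation are unique. -/
theorem eqOn_of_wderiv_of_reg {T : EReal} {v : V → V}
    (hv : Reg (contDiffAlg 1 univ) fun x => v ((finBasis ℝ V).equivFun.symm x))
    {y z : ℝ → V} (hy : ∀ t ∈ timeSet T, WDeriv y (v (y t)) t)
    (hz : ∀ t ∈ timeSet T, WDeriv z (v (z t)) t) (h0 : y 0 = z 0) :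
    ∀ t ∈ timeSet T, y t = z t := by
  refine eqOn_of_wderiv (v := fun _ => v) (fun b _ R => ?_) hy hz h0
  have : ContDiffOn ℝ 1
      (fun x => (finBasis ℝ V).equivFun (v ((finBasis ℝ V).equivFun.symm x))) univ :=
    contDiffOn_pi.2 fun i => hv ((finBasis ℝ V).coord i)
  obtain ⟨K, hK⟩ := (this.mono (subset_univ _)).exists_lipschitzOnWith one_ne_zero
    (convex_closedBall 0 R) (isCompact_closedBall 0 R)
  exact ⟨K, fun _ _ => hK⟩

theorem reg_equivFun_symm (n : ℕ∞ω) :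
    Reg (contDiffAlg n univ) fun x => (finBasis ℝ V).equivFun.symm x := fun φ =>
  (LinearMap.toContinuousLinearMap
    (φ ∘ₗ (finBasis ℝ V).equivFun.symm.toLinearMap)).contDiff.contDiffOn

/-- An endomorphism of `V` in coordinates. -/
def coordEnd (L : End ℝ V) : (Fin (finrank ℝ V) → ℝ) →L[ℝ] (Fin (finrank ℝ V) → ℝ) :=
  LinearMap.toContinuousLinearMap
    ((finBasis ℝ V).equivFun.toLinearMap ∘ₗ L ∘ₗ (finBasis ℝ V).equivFun.symm.toLinearMap)

theorem coordEnd_apply (L : End ℝ V) (x : Fin (finrank ℝ V) → ℝ) : coordEnd L x =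
    (finBasis ℝ V).equivFun (L ((finBasis ℝ V).equivFun.symm x)) := rfl

theorem continuousOn_coordEnd {s : Set ℝ} {A : ℝ → End ℝ V} (hA : Reg (contDiffAlg 0 s) A) :
    ContinuousOn (fun t => coordEnd (A t)) s := by
  rw [continuousOn_clm_apply]
  intro x
  refine continuousOn_pi.2 fun i => ?_
  have := (hA.apply (Reg.const ((finBasis ℝ V).equivFun.symm x))) ((finBasis ℝ V).coord i)
  exact contDiffOn_zero.1 this

/-- Solutions of linear differential equations are unique. -/
theorem eqOn_of_wderiv_linear {T : EReal} {A : ℝ → End ℝ V}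
    (hA : Reg (contDiffAlg 0 (timeSet T)) A)
    {y z : ℝ → V} (hy : ∀ t ∈ timeSet T, WDeriv y (A t (y t)) t)
    (hz : ∀ t ∈ timeSet T, WDeriv z (A t (z t)) t) (h0 : y 0 = z 0) :
    ∀ t ∈ timeSet T, y t = z t := by
  refine eqOn_of_wderiv (v := fun t x => A t x) (fun b hb R => ?_) hy hz h0
  obtain ⟨C, hC⟩ := isCompact_Icc.exists_bound_of_continuousOn
    ((continuousOn_coordEnd hA).mono (Icc_subset_timeSet hb))
  refine ⟨C.toNNReal, fun t ht => ?_⟩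
  refine LipschitzWith.lipschitzOnWith (((coordEnd (A t)).lipschitz).weaken ?_)
  rw [← NNReal.coe_le_coe]
  exact (hC t ht).trans (Real.le_coe_toNNReal C)

/-- A curve with vanishing derivative is constant. -/
theorem eq_of_wderiv_zero {T : EReal} {y : ℝ → V} (hy : ∀ t ∈ timeSet T, WDeriv y 0 t) :
    ∀ t ∈ timeSet T, y t = y 0 :=
  eqOn_of_wderiv_linear (A := fun _ => 0) (Reg.const _) hy (fun _ _ => WDeriv.const _) rfl

/-- Linear differential equations have global solutions. -/
theorem exists_wderiv_linear {T : EReal} (hT : 0 < T) {A : ℝ → End ℝ V}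
    (hA : Reg (contDiffAlg 0 (timeSet T)) A) (x : V) :
    ∃ y : ℝ → V, y 0 = x ∧ ∀ t ∈ timeSet T, WDeriv y (A t (y t)) t := by
  -- The coefficient is frozen at its value at 0 for negative times, so that the equation lives on
  -- the open interval of all `t < T`.
  have hm : ∀ t : ℝ, (t : EReal) < T → ((max t 0 : ℝ) : EReal) < T := fun t ht => by
    rcases max_choice t 0 with h | h <;> rw [h]
    exacts [ht, hT]
  obtain ⟨y, hy0, hy⟩ := exists_hasDerivAt_linear (A := fun t => coordEnd (A (max t 0)))
    (isOpen_lt_time T) ⟨fun s _ t ht u hu => (EReal.coe_le_coe_iff.2 hu.2).trans_lt ht⟩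
    (show (0 : ℝ) ∈ {t : ℝ | (t : EReal) < T} from hT)
    (fun t ht => by
      obtain ⟨b, hb, hbT⟩ := EReal.lt_iff_exists_real_btwn.1 (hm t ht)
      rw [EReal.coe_lt_coe_iff, max_lt_iff] at hb
      refine ⟨min t 0 - 1, b, ⟨?_, hb.1⟩, ⟨?_, hb.2⟩, fun s hs =>
        (EReal.coe_le_coe_iff.2 hs.2).trans_lt hbT⟩
      · linarith [min_le_left t 0]
      · linarith [min_le_right t 0])
    ((continuousOn_coordEnd hA).comp (f := fun t : ℝ => max t 0) (by fun_prop) fun t ht =>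
      ⟨le_max_right _ _, hm t ht⟩) ((finBasis ℝ V).equivFun x)
  refine ⟨fun t => (finBasis ℝ V).equivFun.symm (y t), by simp [hy0], fun t ht => ?_⟩
  have := hy t ht.2
  rw [max_eq_left ht.1] at this
  simpa [coordEnd_apply] using WDeriv.of_hasDerivWithinAt this.hasDerivWithinAt

/-- The bootstrap step: when the right-hand side inherits the regularity of the solution, induction
makes the solution smooth. -/
theorem reg_succ_of_wderiv {T : EReal} {n : ℕ} {y y' : ℝ → W}
    (h : ∀ t ∈ timeSet T, WDeriv y (y' t) t) (hy' : Reg (contDiffAlg n (timeSet T)) y') :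
    Reg (contDiffAlg (n + 1 : ℕ) (timeSet T)) y := fun φ => by
  have hd : ∀ t ∈ timeSet T, HasDerivWithinAt (fun s => φ (y s)) (φ (y' t)) (timeSet T) t :=
    fun t ht => (h t ht φ).mono fun s hs => hs.1
  change ContDiffOn ℝ ((n + 1 : ℕ) : ℕ∞ω) _ _
  push_cast
  rw [contDiffOn_succ_iff_derivWithin (uniqueDiffOn_timeSet T)]
  refine ⟨fun t ht => (hd t ht).differentiableWithinAt, by simp, ?_⟩
  exact ContDiffOn.congr (hy' φ) fun t ht => (hd t ht).derivWithin (uniqueDiffOn_timeSet T t ht)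

theorem reg_zero_of_wderiv {T : EReal} {y y' : ℝ → W}
    (h : ∀ t ∈ timeSet T, WDeriv y (y' t) t) : Reg (contDiffAlg 0 (timeSet T)) y := fun φ =>
  contDiffOn_zero.2 fun t ht => (h t ht φ).continuousWithinAt.mono fun _ hs => hs.1

end WeakODE

/-! ### Regular dependence of the curvature endomorphisms on bracket and metric. -/

section RegularityOfCurvature

set_option linter.unusedSectionVars false

open Module Set

variable {X : Type*} {A : Subalgebra ℝ (X → ℝ)}
  {V : Type*} [AddCommGroup V] [Module ℝ V] [FiniteDimensional ℝ V]
  {g : X → V ≃ₗ[ℝ] Dual ℝ V} {μ : X → Prod2 V} {H : X → Form3 V} {b δ R : X → Form2 V}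

theorem reg_formTrace (hg' : Reg A fun x => (g x).symm.toLinearMap) {B : X → V → V → ℝ}
    (hB : ∀ u v, Reg A fun x => B x u v) : Reg A fun x => formTrace (g x) (B x) :=
  (Reg.lin fun u => hg'.apply (Reg.lin fun v => hB u v)).map (LinearMap.trace ℝ V)

theorem reg_nablaL (hg : Reg A fun x => (g x).toLinearMap)
    (hg' : Reg A fun x => (g x).symm.toLinearMap) (hμ : Reg A μ) :
    Reg A fun x => nablaL (μ x) (g x) :=
  Reg.of_apply fun U => Reg.of_apply fun Y => by
    have h : ∀ U Y Z, Reg A fun x => g x (μ x U Y) Z := fun U Y Z =>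
      (hg.apply ((hμ.apply (Reg.const U)).apply (Reg.const Y))).apply (Reg.const Z)
    exact hg'.apply (Reg.lin fun Z => (Reg.const _).mul (((h _ _ _).sub (h _ _ _)).sub (h _ _ _)))

theorem reg_ricAlg (hg : Reg A fun x => (g x).toLinearMap)
    (hg' : Reg A fun x => (g x).symm.toLinearMap) (hμ : Reg A μ) :
    Reg A fun x => ricAlg (μ x) (g x) := by
  have h := reg_nablaL hg hg' hμ
  refine Reg.lin₂ fun Y Z => (Reg.lin fun U => ?_).map (LinearMap.trace ℝ V)
  have c : ∀ U : V, Reg A fun _ => U := Reg.const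
  exact (((h.apply (c U)).apply ((h.apply (c Y)).apply (c Z))).sub
    ((h.apply (c Y)).apply ((h.apply (c U)).apply (c Z)))).sub
    ((h.apply ((hμ.apply (c U)).apply (c Y))).apply (c Z))

theorem reg_codiffAlg (hg : Reg A fun x => (g x).toLinearMap)
    (hg' : Reg A fun x => (g x).symm.toLinearMap) (hμ : Reg A μ) (hH : Reg A H) :
    Reg A fun x => codiffAlg (μ x) (g x) (H x) := by
  have h := reg_nablaL hg hg' hμ
  have c : ∀ U : V, Reg A fun _ => U := Reg.const
  refine Reg.lin₂ fun Y Z => (reg_formTrace hg' fun u z => ?_).neg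
  have n : ∀ u z, Reg A fun x => nablaAlg (μ x) (g x) u z := fun u z =>
    (h.apply (c u)).apply (c z)
  exact (((((hH.apply (n u z)).apply (c Y)).apply (c Z)).neg).sub
    (((hH.apply (c z)).apply (n u Y)).apply (c Z))).sub
    (((hH.apply (c z)).apply (c Y)).apply (n u Z))

theorem reg_sqForm (hg : Reg A fun x => (g x).toLinearMap)
    (hg' : Reg A fun x => (g x).symm.toLinearMap) (hH : Reg A H) :
    Reg A fun x => sqForm (g x) (H x) := by
  have c : ∀ U : V, Reg A fun _ => U := Reg.const
  have n : ∀ u z, Reg A fun x => (g x).symm (H x u z) := fun u z =>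
    hg'.apply ((hH.apply (c u)).apply (c z))
  exact Reg.lin₂ fun Y Z => reg_formTrace hg' fun u z => (hg.apply (n Y u)).apply (n Z z)

theorem reg_dAlg (hμ : Reg A μ) (hb : Reg A b) : Reg A fun x => dAlg (μ x) (b x) := by
  have h : ∀ U Y Z, Reg A fun x => b x (μ x U Y) Z := fun U Y Z =>
    (hb.apply ((hμ.apply (Reg.const U)).apply (Reg.const Y))).apply (Reg.const Z)
  exact Reg.lin₃ fun U Y Z => ((h U Y Z).neg.add (h U Z Y)).sub (h Y Z U)

theorem reg_expB_apply (hb : Reg A b) {a : X → GT V} (ha : Reg A a) :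
    Reg A fun x => expB (b x) (a x) :=
  ha.fst.prodMk (ha.snd.add (hb.apply ha.fst))

theorem reg_rcEnd (hg : Reg A fun x => (g x).toLinearMap)
    (hg' : Reg A fun x => (g x).symm.toLinearMap) (hb : Reg A b) (hR : Reg A R) (hH : Reg A H)
    (hδ : Reg A δ) : Reg A fun x => rcEnd (g x) (b x) (R x) (H x) (δ x) := by
  have hB := hR.sub ((reg_sqForm hg hg' hH).const_smul (1 / 4))
  refine Reg.of_apply fun a => reg_expB_apply hb ?_
  have h := reg_expB_apply (hb.neg) (Reg.const a)
  exact ((hg'.apply (hB.apply h.fst)).add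
      ((hg'.apply (hδ.apply (hg'.apply h.snd))).const_smul (1 / 2))).prodMk
    (((hδ.apply h.fst).const_smul (1 / 2)).neg.add (hB.apply (hg'.apply h.snd)).neg)

theorem reg_skewEnd (hg' : Reg A fun x => (g x).symm.toLinearMap) (hb : Reg A b)
    (hδ : Reg A δ) : Reg A fun x => skewEnd (g x) (b x) (δ x) := by
  refine Reg.of_apply fun a => reg_expB_apply hb ?_
  have h := reg_expB_apply (hb.neg) (Reg.const a)
  exact ((Reg.const 0).add ((hg'.apply (hδ.apply (hg'.apply h.snd))).const_smul (1 / 2))).prodMk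
    (((hδ.apply h.fst).const_smul (1 / 2)).add (Reg.const 0))

variable {m : X → Brkt V} {𝒢 : X → GenMetric V}

theorem reg_restrict (hm : Reg A m) : Reg A fun x => restrict (m x) :=
  Reg.of_apply fun _ => Reg.of_apply fun _ => (hm.apply (Reg.const _)).apply (Reg.const _)

theorem reg_liePart (hm : Reg A m) : Reg A fun x => liePart (m x) := by
  simp only [liePart_eq]
  exact Reg.of_apply fun U => Reg.of_apply fun Y =>
    (((reg_restrict hm).apply (Reg.const U)).apply (Reg.const Y)).fst

theorem reg_formPart (hm : Reg A m) : Reg A fun x => formPart (m x) := by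
  simp only [formPart_eq]
  exact Reg.of_apply fun U => Reg.of_apply fun Y =>
    (((reg_restrict hm).apply (Reg.const U)).apply (Reg.const Y)).snd

/-- The inverse metric is itself a block of `𝒢`, so no inversion occurs here; `g` is the one
ingredient that needs one. -/
theorem reg_g_symm (h𝒢 : Reg A fun x => (𝒢 x).toEnd) :
    Reg A fun x => (𝒢 x).g.symm.toLinearMap :=
  Reg.of_apply fun ξ => by
    have : ∀ x, (𝒢 x).g.symm.toLinearMap ξ = ((𝒢 x).toEnd (0, ξ)).1 := fun x =>
      (𝒢 x).g_symm_apply ξ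
    simp only [this]
    exact (h𝒢.apply (Reg.const _)).fst

theorem reg_g (hA : ∀ f ∈ A, (∀ x, f x ≠ 0) → f⁻¹ ∈ A) (h𝒢 : Reg A fun x => (𝒢 x).toEnd) :
    Reg A fun x => (𝒢 x).g.toLinearMap :=
  Reg.symm (e := fun x => (𝒢 x).g.symm) hA (reg_g_symm h𝒢)

theorem reg_b (hg : Reg A fun x => (𝒢 x).g.toLinearMap) (h𝒢 : Reg A fun x => (𝒢 x).toEnd) :
    Reg A fun x => (𝒢 x).b :=
  Reg.of_apply fun U => by
    simp only [GenMetric.b_apply]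
    exact (hg.apply (h𝒢.apply (Reg.const _)).fst).neg

theorem reg_rcAlg (hm : Reg A m) (h𝒢 : Reg A fun x => (𝒢 x).toEnd)
    (hg : Reg A fun x => (𝒢 x).g.toLinearMap) : Reg A fun x => rcAlg (𝒢 x) (m x) :=
  have hμ := reg_liePart hm
  have hb := reg_b hg h𝒢
  have hg' := reg_g_symm h𝒢
  have hH := (reg_formPart hm).add (reg_dAlg hμ hb)
  reg_rcEnd hg hg' hb (reg_ricAlg hg hg' hμ) hH (reg_codiffAlg hg hg' hμ hH)

theorem reg_skewAlg (hm : Reg A m) (h𝒢 : Reg A fun x => (𝒢 x).toEnd)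
    (hg : Reg A fun x => (𝒢 x).g.toLinearMap) : Reg A fun x => skewAlg (𝒢 x) (m x) :=
  have hμ := reg_liePart hm
  have hb := reg_b hg h𝒢
  have hg' := reg_g_symm h𝒢
  have hH := (reg_formPart hm).add (reg_dAlg hμ hb)
  reg_skewEnd hg' hb (reg_codiffAlg hg hg' hμ hH)

/-- The generator `Rc_m - A_m` of the generalized bracket flow. -/
def gauge (𝒢 : GenMetric V) (m : Brkt V) : End ℝ (GT V) := rcAlg 𝒢 m - skewAlg 𝒢 m

theorem reg_gauge (hm : Reg A m) (h𝒢 : Reg A fun x => (𝒢 x).toEnd)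
    (hg : Reg A fun x => (𝒢 x).g.toLinearMap) : Reg A fun x => gauge (𝒢 x) (m x) :=
  (reg_rcAlg hm h𝒢 hg).sub (reg_skewAlg hm h𝒢 hg)

/-- For a continuous family of generalized metrics, the generator depends continuously on time. -/
theorem reg_gauge_of_metric {s : Set ℝ} {𝒢 : ℝ → GenMetric V}
    (h𝒢 : Reg (contDiffAlg 0 s) fun t => (𝒢 t).toEnd) (m : Brkt V) :
    Reg (contDiffAlg 0 s) fun t => gauge (𝒢 t) m := by
  have h : Reg (contAlg s) fun t : s => (𝒢 t).toEnd := fun φ =>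
    continuousOn_iff_continuous_domRestrict.1 (contDiffOn_zero.1 (h𝒢 φ))
  have hg : Reg (contAlg s) fun t : s => (𝒢 t).g.toLinearMap :=
    reg_g (𝒢 := fun t : s => 𝒢 t) (fun f hf h0 => Continuous.inv₀ hf h0) h
  exact fun φ => contDiffOn_zero.2 (continuousOn_iff_continuous_domRestrict.2
    (reg_gauge (m := fun _ : s => m) (𝒢 := fun t : s => 𝒢 t) (Reg.const m) h hg φ))

/-- For a fixed background, the generator depends polynomially on the bracket. -/
theorem reg_gauge_of_bracket (𝒢 : GenMetric V) (hm : Reg A m) :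
    Reg A fun x => gauge 𝒢 (m x) :=
  reg_gauge (𝒢 := fun _ => 𝒢) hm (Reg.const _) (Reg.const _)

end RegularityOfCurvature

/-! ### Infinitesimal properties of the generator `Rc - A`. -/

section Gauge

set_option linter.unusedSectionVars false

open Module Set

variable {V : Type*} [AddCommGroup V] [Module ℝ V] [FiniteDimensional ℝ V]

/-- Trilinear forms on `V ⊕ V*`. -/
abbrev Tri (V : Type*) [AddCommGroup V] [Module ℝ V] : Type _ :=
  GT V →ₗ[ℝ] GT V →ₗ[ℝ] Dual ℝ (GT V)

/-- The form `⟨m(a, b), c⟩ + ⟨m(a, c), b⟩`. -/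
def symmPart (m : Brkt V) : Tri V :=
  m.compr₂ (pairL V) + LinearMap.lflip.toLinearMap ∘ₗ (m.compr₂ (pairL V))

theorem symmPart_apply (m : Brkt V) (a b c : GT V) :
    symmPart m a b c = pairing (m a b) c + pairing (m a c) b := rfl

/-- The restriction of a trilinear form to `V`. -/
def restrict₃ (D : Tri V) : Form3 V :=
  lin₃ fun X Y Z => D (X, 0) (Y, 0) (Z, 0)

theorem restrict₃_apply (D : Tri V) (X Y Z : V) :
    restrict₃ D X Y Z = D (X, 0) (Y, 0) (Z, 0) := by
  have e : ∀ X, ((X, 0) : GT V) = LinearMap.inl ℝ V (Dual ℝ V) X := fun _ => rfl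
  simp only [restrict₃, e]
  rw [lin₃_apply] <;> intros <;> constructor <;> intros <;> simp only [map_add, map_smul,
    LinearMap.add_apply, LinearMap.smul_apply]

theorem restrict₃_symmPart (m : Brkt V) :
    formPart m + flip₂₃ (formPart m) = (2 : ℝ) • restrict₃ (symmPart m) := by
  ext X Y Z
  simp only [LinearMap.add_apply, flip₂₃_apply, formPart_apply, LinearMap.smul_apply,
    restrict₃_apply, symmPart_apply, smul_eq_mul]
  ring

theorem dAlg_add_flip (μ : Prod2 V) (hμ : ∀ X Y, μ X Y = -μ Y X) (b : Form2 V) :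
    dAlg μ b + flip₂₃ (dAlg μ b) = 0 := by
  ext X Y Z
  simp only [LinearMap.add_apply, flip₂₃_apply, dAlg_apply]
  rw [hμ Z Y]; simp

theorem flip₂₃_add (H K : Form3 V) : flip₂₃ (H + K) = flip₂₃ H + flip₂₃ K := by
  ext; simp [flip₂₃_apply]

/-- A Lie bracket on `V` already makes `Ric^B` symmetric, and `db` is skew in its last two slots.
The failure of `Rc - A` to be skew is therefore linear in the failure of `⟨m(·,·),·⟩` to be skew. -/
theorem pairing_gauge (𝒢 : GenMetric V) (m : Brkt V) (hμ : ∀ X Y, liePart m X Y = -liePart m Y X)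
    (hJ : ∀ X Y Z, liePart m (liePart m X Y) Z + liePart m (liePart m Y Z) X +
      liePart m (liePart m Z X) Y = 0) (x y : GT V) :
    pairing (gauge 𝒢 m x) y + pairing x (gauge 𝒢 m y) =
      -codiffAlg (liePart m) 𝒢.g (restrict₃ (symmPart m)) x.1 y.1 := by
  have h := pairing_rcEnd_sub_skewEnd 𝒢.g 𝒢.b (ricAlg (liePart m) 𝒢.g)
    (codiffAlg (liePart m) 𝒢.g (formPart m + dAlg (liePart m) 𝒢.b))
    (formPart m + dAlg (liePart m) 𝒢.b) 𝒢.g_comm 𝒢.b_skew (fun X Y => by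
      simp only [LinearMap.sub_apply, LinearMap.smul_apply]
      rw [ricAlg_comm _ _ 𝒢.g_comm hμ hJ, sqForm_comm _ _ 𝒢.g_comm]) x y
  refine h.trans ?_
  have e : formPart m + dAlg (liePart m) 𝒢.b + flip₂₃ (formPart m + dAlg (liePart m) 𝒢.b) =
      (2 : ℝ) • restrict₃ (symmPart m) := by
    rw [flip₂₃_add, add_add_add_comm, dAlg_add_flip _ hμ, add_zero, restrict₃_symmPart]
  rw [codiffAlg_add_flip, e, codiffAlg_smul]
  simp only [LinearMap.smul_apply, smul_eq_mul]
  ring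

theorem gauge_inr (𝒢 : GenMetric V) (m : Brkt V) (ξ : Dual ℝ V) :
    (gauge 𝒢 m (0, ξ)).1 = 0 :=
  rcEnd_sub_skewEnd_inr _ _ _ _ _ ξ

theorem IsDorfman.symmPart_eq_zero {m : Brkt V} (hm : IsDorfman m) : symmPart m = 0 := by
  ext a b c : 6
  all_goals
    simp only [LinearMap.comp_apply, symmPart_apply]
    rw [hm.2.1]; simp

theorem codiffAlg_zero (μ : Prod2 V) (g : V ≃ₗ[ℝ] Dual ℝ V) : codiffAlg μ g 0 = 0 := by
  simpa using codiffAlg_smul μ g 0 0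

theorem restrict₃_zero : restrict₃ (0 : Tri V) = 0 := by
  ext; simp [restrict₃_apply]

theorem IsDorfman.pairing_gauge {m : Brkt V} (hm : IsDorfman m) (𝒢 : GenMetric V) (x y : GT V) :
    pairing (gauge 𝒢 m x) y + pairing x (gauge 𝒢 m y) = 0 := by
  rw [GenGeom.pairing_gauge 𝒢 m hm.liePart_skew hm.liePart_jacobi, hm.symmPart_eq_zero,
    restrict₃_zero, codiffAlg_zero]
  simp

/-- The commutator of the generator with `𝒢` is the right-hand side of the Ricci flow, because `𝒢`
commutes with `A` and anticommutes with `Rc`. This is what makes gauge transformations absorb the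
motion of the metric. -/
theorem gauge_toEnd (𝒢 : GenMetric V) (m : Brkt V) (a : GT V) :
    gauge 𝒢 m (𝒢.toEnd a) = 𝒢.toEnd (gauge 𝒢 m a) - (2 : ℝ) • 𝒢.toEnd (rcAlg 𝒢 m a) := by
  have h₁ : 𝒢.toEnd (rcAlg 𝒢 m a) = -rcAlg 𝒢 m (𝒢.toEnd a) := toEnd_rcEnd _ _ _ _ _
  have h₂ : 𝒢.toEnd (skewAlg 𝒢 m a) = skewAlg 𝒢 m (𝒢.toEnd a) := toEnd_skewEnd _ _ _
  rw [gauge, LinearMap.sub_apply, LinearMap.sub_apply, map_sub, h₂, h₁]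
  module

theorem CourantIso.gauge_map {W : Type*} [AddCommGroup W] [Module ℝ W] [FiniteDimensional ℝ W]
    {h : V ≃ₗ[ℝ] W} {F : GT V ≃ₗ[ℝ] GT W} {m : Brkt V} {𝒢 : GenMetric V} {m' : Brkt W}
    {𝒢' : GenMetric W} (I : CourantIso h F m 𝒢 m' 𝒢') (hm : IsDorfman m) (hm' : IsDorfman m')
    (a : GT V) : F (gauge 𝒢 m a) = gauge 𝒢' m' (F a) := by
  rw [gauge, LinearMap.sub_apply, map_sub, I.rcAlg_map hm hm', I.skewAlg_map hm hm']; rfl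

/-- The generalized metric `F⁻¹ 𝒢 F`. -/
def GenMetric.pullback {W : Type*} [AddCommGroup W] [Module ℝ W] (F : GT V ≃ₗ[ℝ] GT W)
    (hF : ∀ a b, pairing (F a) (F b) = pairing a b) (𝒢 : GenMetric W) : GenMetric V where
  toEnd := F.symm.toLinearMap ∘ₗ 𝒢.toEnd ∘ₗ F.toLinearMap
  orth a b := by rw [← hF]; simp [𝒢.orth, hF]
  symm a b := by rw [← hF, ← hF _ a]; simp [𝒢.symm]
  pos a ha := by rw [← hF]; simpa using 𝒢.pos (F a) (by simpa using ha)

theorem GenMetric.map_pullback {W : Type*} [AddCommGroup W] [Module ℝ W] (F : GT V ≃ₗ[ℝ] GT W)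
    (hF : ∀ a b, pairing (F a) (F b) = pairing a b) (𝒢 : GenMetric W) (a : GT V) :
    F ((𝒢.pullback F hF).toEnd a) = 𝒢.toEnd (F a) := by
  simp [pullback]

theorem exists_anchor {F : GT V ≃ₗ[ℝ] GT V} (hF : ∀ ξ, (F (0, ξ)).1 = 0) :
    ∃ h : V ≃ₗ[ℝ] V, ∀ a, (F a).1 = h a.1 := by
  let k : V →ₗ[ℝ] V := LinearMap.fst ℝ V (Dual ℝ V) ∘ₗ F.toLinearMap ∘ₗ LinearMap.inl ℝ V _
  have hk : ∀ a, (F a).1 = k a.1 := fun a => by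
    have : a = (a.1, 0) + (0, a.2) := by simp
    conv_lhs => rw [this, map_add, Prod.fst_add, hF, add_zero]
    rfl
  have hs : Function.Surjective k := fun X => by
    obtain ⟨a, ha⟩ := F.surjective (X, 0)
    exact ⟨a.1, by rw [← hk, ha]⟩
  exact ⟨LinearEquiv.ofBijective k ⟨LinearMap.injective_iff_surjective.2 hs, hs⟩, hk⟩

end Gauge

/-! ### Fundamental solutions and the structures they preserve. -/

section Fundamental

set_option linter.unusedSectionVars false

open Module Set

variable {W : Type*} [AddCommGroup W] [Module ℝ W] [FiniteDimensional ℝ W]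

theorem WDeriv.comp {y z : ℝ → End ℝ W} {y' z' : End ℝ W} {t : ℝ} (hy : WDeriv y y' t)
    (hz : WDeriv z z' t) : WDeriv (fun s => y s ∘ₗ z s) (y' ∘ₗ z t + y t ∘ₗ z') t :=
  WDeriv.of_apply fun v => hy.apply (hz.apply_const v)

/-- The fundamental solution of a linear differential equation. -/
theorem exists_fundamental {T : EReal} (hT : 0 < T) {L : ℝ → End ℝ W}
    (hL : Reg (contDiffAlg 0 (timeSet T)) L) :
    ∃ F : ℝ → W ≃ₗ[ℝ] W, F 0 = LinearEquiv.refl ℝ W ∧ ∀ t ∈ timeSet T,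
      WDeriv (fun s => (F s).toLinearMap) (L t ∘ₗ (F t).toLinearMap) t ∧
      WDeriv (fun s => (F s).symm.toLinearMap) (-((F t).symm.toLinearMap ∘ₗ L t)) t := by
  classical
  obtain ⟨y, hy0, hy⟩ := exists_wderiv_linear hT (A := fun t => LinearMap.llcomp ℝ W W W (L t))
    (Reg.of_apply fun l => hL.comp (Reg.const l)) LinearMap.id
  obtain ⟨z, hz0, hz⟩ := exists_wderiv_linear hT
    (A := fun t => -LinearMap.lcomp ℝ W (L t))
    ((Reg.of_apply fun (l : End ℝ W) => ((Reg.const l).comp hL)).neg) LinearMap.id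
  -- With `y' = L y` and `z' = -z L` the product `z y` is constant; in finite dimension a left
  -- inverse is also a right inverse.
  have hzy : ∀ t ∈ timeSet T, z t ∘ₗ y t = LinearMap.id := fun t ht => by
    rw [eq_of_wderiv_zero (T := T) (y := fun t => z t ∘ₗ y t) ?_ t ht, hy0, hz0]; rfl
    intro s hs
    refine ((hz s hs).comp (hy s hs)).congr_deriv ?_
    ext; simp
  have hyz : ∀ t ∈ timeSet T, y t ∘ₗ z t = LinearMap.id := fun t ht =>
    mul_eq_one_comm.1 (hzy t ht)
  let F : ℝ → W ≃ₗ[ℝ] W := fun t => if h : t ∈ timeSet T then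
    LinearEquiv.ofLinearMap (y t) (z t) (hyz t h) (hzy t h) else LinearEquiv.refl ℝ W
  have hF : ∀ t ∈ timeSet T, (F t).toLinearMap = y t := fun t ht => by
    ext; simp [F, ht]
  have hF' : ∀ t ∈ timeSet T, (F t).symm.toLinearMap = z t := fun t ht => by
    ext; simp [F, ht]
  refine ⟨F, ?_, fun t ht => ⟨?_, ?_⟩⟩
  · ext w
    have := LinearMap.congr_fun (hF 0 (zero_mem_timeSet hT)) w
    simpa [hy0] using this
  · rw [hF t ht]
    exact (hy t ht).congr hF ht
  · rw [hF' t ht]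
    exact (hz t ht).congr hF' ht

variable {T : EReal}

theorem linearEquiv_unique {L : ℝ → End ℝ W} (hL : Reg (contDiffAlg 0 (timeSet T)) L)
    {F F' : ℝ → W ≃ₗ[ℝ] W} (h0 : F 0 = F' 0)
    (hF : ∀ t ∈ timeSet T, WDeriv (fun s => (F s).toLinearMap) (L t ∘ₗ (F t).toLinearMap) t)
    (hF' : ∀ t ∈ timeSet T, WDeriv (fun s => (F' s).toLinearMap) (L t ∘ₗ (F' t).toLinearMap) t) :
    ∀ t ∈ timeSet T, F t = F' t := fun t ht => by
  ext w
  exact eqOn_of_wderiv_linear hL (fun s hs => (hF s hs).apply_const w)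
    (fun s hs => (hF' s hs).apply_const w) (by simp [h0]) t ht

variable {V : Type*} [AddCommGroup V] [Module ℝ V] [FiniteDimensional ℝ V]
  {L : ℝ → End ℝ (GT V)} {F : ℝ → GT V ≃ₗ[ℝ] GT V}

theorem pairing_of_skew (h0 : F 0 = LinearEquiv.refl ℝ _)
    (hF : ∀ t ∈ timeSet T, WDeriv (fun s => (F s).toLinearMap) (L t ∘ₗ (F t).toLinearMap) t)
    (hL : ∀ t ∈ timeSet T, ∀ x y, pairing (L t x) y + pairing x (L t y) = 0) :
    ∀ t ∈ timeSet T, ∀ a b, pairing (F t a) (F t b) = pairing a b := fun t ht a b => by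
  have := eq_of_wderiv_zero (T := T) (y := fun t => pairing (F t a) (F t b)) (fun s hs =>
    (WDeriv.of_real (((hF s hs).apply_const a).pairing ((hF s hs).apply_const b))).congr_deriv
      (hL s hs _ _)) t ht
  simpa [h0] using this

/-- As `L` preserves `V*`, the `V`-component of `F (0, ξ)` satisfies a closed linear equation with
initial value zero. -/
theorem fst_inr_of_fst_inr (hLc : Reg (contDiffAlg 0 (timeSet T)) L)
    (h0 : F 0 = LinearEquiv.refl ℝ _)
    (hF : ∀ t ∈ timeSet T, WDeriv (fun s => (F s).toLinearMap) (L t ∘ₗ (F t).toLinearMap) t)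
    (hL : ∀ t ∈ timeSet T, ∀ ξ, (L t (0, ξ)).1 = 0) :
    ∀ t ∈ timeSet T, ∀ ξ, (F t (0, ξ)).1 = 0 := fun t ht ξ => by
  have hr : Reg (contDiffAlg 0 (timeSet T)) fun t =>
      LinearMap.fst ℝ V (Dual ℝ V) ∘ₗ L t ∘ₗ LinearMap.inl ℝ V (Dual ℝ V) :=
    (Reg.const _).comp (hLc.comp (Reg.const _))
  refine eqOn_of_wderiv_linear hr (y := fun t => (F t (0, ξ)).1) (z := fun _ => 0)
    (fun s hs => ?_) (fun s _ => (WDeriv.const _).congr_deriv (map_zero _).symm) (by simp [h0]) t ht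
  refine (((hF s hs).apply_const (0, ξ)).map (LinearMap.fst ℝ V (Dual ℝ V))).congr_deriv ?_
  have e : F s (0, ξ) = ((F s (0, ξ)).1, 0) + (0, (F s (0, ξ)).2) := by simp
  change (L s (F s (0, ξ))).1 = (L s ((F s (0, ξ)).1, 0)).1
  rw [e, map_add, Prod.fst_add, hL s hs, add_zero]
  simp

end Fundamental

/-! ### The correspondence between metric flows and bracket flows. -/

section Flows

set_option linter.unusedSectionVars false

open Module Set

variable {V : Type*} [AddCommGroup V] [Module ℝ V] [FiniteDimensional ℝ V]

/-- The infinitesimal action on brackets as a bracket. -/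
def thetaB (L : End ℝ (GT V)) (m : Brkt V) : Brkt V := m.compr₂ L - m ∘ₗ L - m.compl₂ L

theorem thetaB_apply (L : End ℝ (GT V)) (m : Brkt V) (a b : GT V) :
    thetaB L m a b = Theta L m a b := rfl

theorem reg_thetaB {X : Type*} {A : Subalgebra ℝ (X → ℝ)} {L : X → End ℝ (GT V)}
    {m : X → Brkt V} (hL : Reg A L) (hm : Reg A m) : Reg A fun x => thetaB (L x) (m x) :=
  Reg.of_apply fun a => Reg.of_apply fun b =>
    ((hL.apply ((hm.apply (Reg.const a)).apply (Reg.const b))).sub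
      ((hm.apply (hL.apply (Reg.const a))).apply (Reg.const b))).sub
      ((hm.apply (Reg.const a)).apply (hL.apply (Reg.const b)))

variable {𝒢₀ : GenMetric V} {m₀ : Brkt V} {m : ℝ → Brkt V} {T : EReal}

namespace IsBracketFlow

theorem wderiv (hm : IsBracketFlow 𝒢₀ m₀ m T) {t : ℝ} (ht : t ∈ timeSet T) :
    WDeriv m (-thetaB (gauge 𝒢₀ (m t)) (m t)) t :=
  WDeriv.of_apply fun a => WDeriv.of_apply fun b => WDeriv.of_pairing fun c =>
    hm.eqn t ht.1 ht.2 a b c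

theorem of_wderiv (hT : 0 < T) (h0 : m 0 = m₀) (hs : ∀ t ∈ timeSet T, ∀ a, m t a a = 0)
    (hm : ∀ t ∈ timeSet T, WDeriv m (-thetaB (gauge 𝒢₀ (m t)) (m t)) t) :
    IsBracketFlow 𝒢₀ m₀ m T where
  pos := hT
  init := h0
  skew t h1 h2 := hs t ⟨h1, h2⟩
  eqn t h1 h2 a b c := by
    have := (((hm t ⟨h1, h2⟩).apply_const a).apply_const b).pairing (WDeriv.const (t := t) c)
    refine this.congr_deriv ?_
    rw [show pairing (m t a b) 0 = 0 by simp [pairing], add_zero]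
    rfl

theorem mono (hm : IsBracketFlow 𝒢₀ m₀ m T) {T' : EReal} (h0 : 0 < T') (h : T' ≤ T) :
    IsBracketFlow 𝒢₀ m₀ m T' where
  pos := h0
  init := hm.init
  skew t h1 h2 := hm.skew t h1 (h2.trans_le h)
  eqn t h1 h2 := hm.eqn t h1 (h2.trans_le h)

/-- With the metric fixed, the right-hand side is polynomial in the coefficients of the bracket,
hence `C^1`. -/
theorem eqOn (hm : IsBracketFlow 𝒢₀ m₀ m T) {m' : ℝ → Brkt V} (hm' : IsBracketFlow 𝒢₀ m₀ m' T) :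
    ∀ t ∈ timeSet T, m t = m' t := by
  refine eqOn_of_wderiv_of_reg (v := fun m => -thetaB (gauge 𝒢₀ m) m) ?_ (fun t => hm.wderiv)
    (fun t => hm'.wderiv) (hm.init.trans hm'.init.symm)
  have h := reg_equivFun_symm (V := Brkt V) 1
  exact (reg_thetaB (reg_gauge_of_bracket 𝒢₀ h) h).neg

theorem reg (hm : IsBracketFlow 𝒢₀ m₀ m T) (n : ℕ) : Reg (contDiffAlg n (timeSet T)) m := by
  induction n with
  | zero => exact reg_zero_of_wderiv fun t => hm.wderiv
  | succ n ih =>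
    exact reg_succ_of_wderiv (fun t => hm.wderiv) (reg_thetaB (reg_gauge_of_bracket 𝒢₀ ih) ih).neg

theorem skew' (hm : IsBracketFlow 𝒢₀ m₀ m T) {t : ℝ} (ht : t ∈ timeSet T) (a b : GT V) :
    m t a b = -m t b a := by
  have h := hm.skew t ht.1 ht.2
  have := h (a + b)
  simp only [map_add, LinearMap.add_apply, h, zero_add, add_zero] at this
  exact eq_neg_of_add_eq_zero_right this

end IsBracketFlow

/-- The ordinary differential equation for the value at the identity of a left-invariant solution
of the generalized Ricci flow. -/
def IsMetricFlow (m₀ : Brkt V) (𝒢 : ℝ → GenMetric V) (T : EReal) : Prop :=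
  ∀ t ∈ timeSet T, WDeriv (fun s => (𝒢 s).toEnd)
    (-(2 : ℝ) • ((𝒢 t).toEnd ∘ₗ rcAlg (𝒢 t) m₀)) t

/-- `F` is the family of gauge transformations along the bracket flow `m`. -/
structure IsGaugeFamily (𝒢₀ : GenMetric V) (m : ℝ → Brkt V) (F : ℝ → GT V ≃ₗ[ℝ] GT V)
    (T : EReal) : Prop where
  init : F 0 = LinearEquiv.refl ℝ _
  wderiv : ∀ t ∈ timeSet T,
    WDeriv (fun s => (F s).toLinearMap) ((-gauge 𝒢₀ (m t)) ∘ₗ (F t).toLinearMap) t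

variable {F : ℝ → GT V ≃ₗ[ℝ] GT V}

theorem IsGaugeFamily.reg (hF : IsGaugeFamily 𝒢₀ m F T) (hm : IsBracketFlow 𝒢₀ m₀ m T) (n : ℕ) :
    Reg (contDiffAlg n (timeSet T)) fun t => (F t).toLinearMap := by
  induction n with
  | zero => exact reg_zero_of_wderiv hF.wderiv
  | succ n ih =>
    exact reg_succ_of_wderiv hF.wderiv ((reg_gauge_of_bracket 𝒢₀ (hm.reg n)).neg.comp ih)

theorem IsGaugeFamily.contDiffOn (hF : IsGaugeFamily 𝒢₀ m F T) (hm : IsBracketFlow 𝒢₀ m₀ m T)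
    (a b : GT V) : ContDiffOn ℝ ∞ (fun t => pairing (F t a) b) (timeSet T) :=
  contDiffOn_infty.2 fun n => (((hF.reg hm n).apply (Reg.const a)).pairing (Reg.const b)).mem

theorem IsBracketFlow.exists_gaugeFamily (hm : IsBracketFlow 𝒢₀ m₀ m T) :
    ∃ F, IsGaugeFamily 𝒢₀ m F T := by
  obtain ⟨F, h0, hF⟩ := exists_fundamental hm.pos (L := fun t => -gauge 𝒢₀ (m t))
    (reg_gauge_of_bracket 𝒢₀ (hm.reg 0)).neg
  exact ⟨F, h0, fun t ht => (hF t ht).1⟩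

theorem IsGaugeFamily.eqOn (hF : IsGaugeFamily 𝒢₀ m F T) (hm : IsBracketFlow 𝒢₀ m₀ m T)
    {F' : ℝ → GT V ≃ₗ[ℝ] GT V} (hF' : IsGaugeFamily 𝒢₀ m F' T) : ∀ t ∈ timeSet T, F t = F' t :=
  linearEquiv_unique (reg_gauge_of_bracket 𝒢₀ (hm.reg 0)).neg (hF.init.trans hF'.init.symm)
    hF.wderiv hF'.wderiv

/-- A solution of the metric equation gives rise to a generalized bracket flow. -/
theorem IsMetricFlow.exists_bracketFlow (hm₀ : IsDorfman m₀) {𝒢 : ℝ → GenMetric V}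
    (hT : 0 < T) (h𝒢 : IsMetricFlow m₀ 𝒢 T) :
    ∃ m F, IsBracketFlow (𝒢 0) m₀ m T ∧ IsGaugeFamily (𝒢 0) m F T ∧
      ∀ t ∈ timeSet T, ∃ h, CourantIso h (F t) m₀ (𝒢 t) (m t) (𝒢 0) := by
  have hL := reg_gauge_of_metric (reg_zero_of_wderiv h𝒢) m₀
  obtain ⟨K, hK0, hK⟩ := exists_fundamental hT hL
  have hp := pairing_of_skew hK0 (fun t ht => (hK t ht).1) fun t _ => hm₀.pairing_gauge (𝒢 t)
  have hv := fst_inr_of_fst_inr hL hK0 (fun t ht => (hK t ht).1) fun t _ => gauge_inr (𝒢 t) m₀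
  -- The derivative of `⟨𝒢 K a, K c⟩` vanishes: the contribution of `K` is the commutator of `𝒢`
  -- with the generator, which cancels `-2 𝒢 Rc`.
  have hc : ∀ t ∈ timeSet T, ∀ a, (𝒢 t).toEnd (K t a) = K t ((𝒢 0).toEnd a) := fun t ht a => by
    refine eq_of_pairing_left fun c => ?_
    obtain ⟨c, rfl⟩ := (K t).surjective c
    rw [hp t ht]
    have := eq_of_wderiv_zero (T := T) (y := fun t => pairing ((𝒢 t).toEnd (K t a)) (K t c)) 
      (fun s hs => ?_) t ht
    · simpa [hK0] using this
    · have h1 := fun a => (hK s hs).1.apply_const a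
      refine (WDeriv.of_real (((h𝒢 s hs).apply (h1 a)).pairing (h1 c))).congr_deriv ?_
      have h2 := hm₀.pairing_gauge (𝒢 s) ((𝒢 s).toEnd (K s a)) (K s c)
      rw [gauge_toEnd] at h2
      simp only [pairing_eq_pairL, map_sub, map_add, map_smul, LinearMap.sub_apply,
        LinearMap.add_apply, LinearMap.smul_apply, LinearMap.comp_apply, LinearEquiv.coe_coe,
        smul_eq_mul] at h2 ⊢
      linarith
  let m : ℝ → Brkt V := fun t =>
    (m₀.compl₁₂ (K t).toLinearMap (K t).toLinearMap).compr₂ (K t).symm.toLinearMap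
  have hma : ∀ t a b, m t a b = (K t).symm (m₀ (K t a) (K t b)) := fun t a b => rfl
  have hI : ∀ t ∈ timeSet T, ∃ h, CourantIso h (K t).symm m₀ (𝒢 t) (m t) (𝒢 0) := fun t ht => by
    obtain ⟨h, hh⟩ := exists_anchor (hv t ht)
    refine ⟨h.symm, fun a => ?_, fun a b => ?_, fun a b => ?_, fun a => ?_⟩
    · rw [LinearEquiv.eq_symm_apply, ← hh]; simp
    · rw [← hp t ht]; simp
    · rw [hma]; simp
    · rw [LinearEquiv.symm_apply_eq, ← hc t ht]; simp
  -- Naturality rewrites the generator of the moving metric and fixed bracket as that of the fixed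
  -- metric and moving bracket, which closes the equation for `m`.
  have hg : ∀ t ∈ timeSet T, ∀ a,
      gauge (𝒢 0) (m t) ((K t).symm a) = (K t).symm (gauge (𝒢 t) m₀ a) := fun t ht a => by
    obtain ⟨h, I⟩ := hI t ht
    exact (I.gauge_map hm₀ (hm₀.map I.anchor I.pairing_eq I.bracket_eq) a).symm
  refine ⟨m, fun t => (K t).symm, IsBracketFlow.of_wderiv hT ?_ ?_ fun t ht => ?_,
    ⟨by simp [hK0], fun t ht => (hK t ht).2.congr_deriv ?_⟩, hI⟩
  · refine LinearMap.ext fun a => LinearMap.ext fun b => ?_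
    rw [hma, hK0]; simp
  · intro t _ a
    rw [hma, hm₀.1, map_zero]
  · refine WDeriv.of_apply fun a => WDeriv.of_apply fun b => ?_
    have h1 := fun a => (hK t ht).1.apply_const a
    refine ((hK t ht).2.apply
      (((WDeriv.const m₀).apply (h1 a)).apply (h1 b))).congr_deriv ?_
    have e : ∀ a, gauge (𝒢 0) (m t) a = (K t).symm (gauge (𝒢 t) m₀ (K t a)) := fun a => by
      rw [← hg t ht]; simp
    have e' : (-thetaB (gauge (𝒢 0) (m t)) (m t)) a b = -Theta (gauge (𝒢 0) (m t)) (m t) a b := rfl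
    rw [e', Theta]
    simp only [e, hma]
    simp
    abel
  · refine LinearMap.ext fun a => ?_
    simp [hg t ht]

/-- The equation satisfied by the symmetric part of a solution of the bracket flow. -/
def symmEqn (𝒢₀ : GenMetric V) (m : Brkt V) : End ℝ (Tri V) :=
  lin fun D => lin₃ fun a b c =>
    D (gauge 𝒢₀ m a) b c + D a (gauge 𝒢₀ m b) c + D a b (gauge 𝒢₀ m c) +
      codiffAlg (liePart m) 𝒢₀.g (restrict₃ D) (m a b).1 c.1 +
      codiffAlg (liePart m) 𝒢₀.g (restrict₃ D) (m a c).1 b.1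

theorem symmEqn_apply (𝒢₀ : GenMetric V) (m : Brkt V) (D : Tri V) (a b c : GT V) :
    symmEqn 𝒢₀ m D a b c =
      D (gauge 𝒢₀ m a) b c + D a (gauge 𝒢₀ m b) c + D a b (gauge 𝒢₀ m c) +
      codiffAlg (liePart m) 𝒢₀.g (restrict₃ D) (m a b).1 c.1 +
      codiffAlg (liePart m) 𝒢₀.g (restrict₃ D) (m a c).1 b.1 := by
  have h : ∀ D : Tri V, ∀ a b c, (lin₃ fun a b c =>
      D (gauge 𝒢₀ m a) b c + D a (gauge 𝒢₀ m b) c + D a b (gauge 𝒢₀ m c) +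
      codiffAlg (liePart m) 𝒢₀.g (restrict₃ D) (m a b).1 c.1 +
      codiffAlg (liePart m) 𝒢₀.g (restrict₃ D) (m a c).1 b.1) a b c =
      D (gauge 𝒢₀ m a) b c + D a (gauge 𝒢₀ m b) c + D a b (gauge 𝒢₀ m c) +
      codiffAlg (liePart m) 𝒢₀.g (restrict₃ D) (m a b).1 c.1 +
      codiffAlg (liePart m) 𝒢₀.g (restrict₃ D) (m a c).1 b.1 := fun D a b c => by
    rw [lin₃_apply] <;> intros <;> constructor <;> intros <;>
      simp only [map_add, map_smul, LinearMap.add_apply, LinearMap.smul_apply, Prod.fst_add,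
        Prod.smul_fst, smul_eq_mul] <;> ring
  have radd : ∀ D D' : Tri V, restrict₃ (D + D') = restrict₃ D + restrict₃ D' := fun D D' => by
    ext; simp [restrict₃_apply]
  have rsmul : ∀ (c : ℝ) (D : Tri V), restrict₃ (c • D) = c • restrict₃ D := fun c D => by
    ext; simp [restrict₃_apply]
  rw [symmEqn, lin_apply, h]
  constructor
  · intro D D'
    refine LinearMap.ext fun a => LinearMap.ext fun b => LinearMap.ext fun c => ?_
    refine (h (D + D') a b c).trans (Eq.trans ?_ (congrArg₂ (· + ·) (h D a b c) (h D' a b c)).symm)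
    simp only [radd, codiffAlg_add, LinearMap.add_apply]
    ring
  · intro r D
    refine LinearMap.ext fun a => LinearMap.ext fun b => LinearMap.ext fun c => ?_
    refine (h (r • D) a b c).trans (Eq.trans ?_ (congrArg (r * ·) (h D a b c)).symm)
    simp only [rsmul, codiffAlg_smul, LinearMap.smul_apply, smul_eq_mul]
    ring

theorem reg_symmEqn {X : Type*} {A : Subalgebra ℝ (X → ℝ)} {m : X → Brkt V} (hm : Reg A m) :
    Reg A fun x => symmEqn 𝒢₀ (m x) := by
  have hL := reg_gauge_of_bracket 𝒢₀ hm
  refine Reg.lin fun D => Reg.lin₃ fun a b c => ?_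
  have hδ : Reg A fun x => codiffAlg (liePart (m x)) 𝒢₀.g (restrict₃ D) :=
    reg_codiffAlg (g := fun _ => 𝒢₀.g) (Reg.const _) (Reg.const _) (reg_liePart hm) (Reg.const _)
  have hd : ∀ a b c : GT V, Reg A fun x =>
      codiffAlg (liePart (m x)) 𝒢₀.g (restrict₃ D) (m x a b).1 c.1 := fun a b c =>
    (hδ.apply ((hm.apply (Reg.const a)).apply (Reg.const b)).fst).apply (Reg.const _)
  have h := fun a => hL.apply (Reg.const a)
  exact ((((((Reg.const D).apply (h a)).apply (Reg.const b)).apply (Reg.const c)).add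
    (((Reg.const (D a)).apply (h b)).apply (Reg.const c))).add
    ((Reg.const (D a b)).apply (h c))).add (hd a b c) |>.add (hd a c b)

/-- The gauge transformations along the bracket flow are isomorphisms, and the corresponding
generalized metrics solve the metric equation. -/
theorem IsBracketFlow.exists_metricFlow (hm₀ : IsDorfman m₀) (hm : IsBracketFlow 𝒢₀ m₀ m T)
    (hF : IsGaugeFamily 𝒢₀ m F T) :
    (∀ t ∈ timeSet T, IsDorfman (m t)) ∧ ∃ 𝒢 : ℝ → GenMetric V, 𝒢 0 = 𝒢₀ ∧ IsMetricFlow m₀ 𝒢 T ∧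
      ∀ t ∈ timeSet T, ∃ h, CourantIso h (F t) m₀ (𝒢 t) (m t) 𝒢₀ := by
  classical
  have hL : Reg (contDiffAlg 0 (timeSet T)) fun t => -gauge 𝒢₀ (m t) :=
    (reg_gauge_of_bracket 𝒢₀ (hm.reg 0)).neg
  -- The difference of the two sides solves `y' = -(Rc - A) y` with `y(0) = 0`; the terms with the
  -- generator inside the bracket cancel against the motion of `F`.
  have hb : ∀ t ∈ timeSet T, ∀ a b, F t (m₀ a b) = m t (F t a) (F t b) := fun t ht a b => by
    rw [eq_comm, ← sub_eq_zero]
    refine eqOn_of_wderiv_linear hL (y := fun t => m t (F t a) (F t b) - F t (m₀ a b))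
      (z := fun _ => 0) (fun s hs => ?_) (fun s _ => (WDeriv.const _).congr_deriv (map_zero _).symm)
      (by simp [hF.init, hm.init]) t ht
    have h1 := fun a => (hF.wderiv s hs).apply_const a
    refine ((((hm.wderiv hs).apply (h1 a)).apply (h1 b)).sub (h1 (m₀ a b))).congr_deriv ?_
    simp only [LinearMap.add_apply, LinearMap.neg_apply, thetaB_apply, Theta, LinearMap.comp_apply,
      LinearEquiv.coe_coe, map_neg, map_sub]
    abel
  have hv := fst_inr_of_fst_inr hL hF.init hF.wderiv fun t _ ξ => by
    rw [LinearMap.neg_apply, Prod.fst_neg, gauge_inr, neg_zero]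
  -- Orthogonality of `F` is not available yet, so the ideal property of `V*`, and below it the
  -- Jacobi identity on `V`, are transported from `m₀` by brackets and anchor alone.
  have hmv : ∀ t ∈ timeSet T, ∀ ξ a, (m t (0, ξ) a).1 = 0 := fun t ht ξ a => by
    obtain ⟨h, hh⟩ := exists_anchor (hv t ht)
    obtain ⟨a, rfl⟩ := (F t).surjective a
    obtain ⟨c, hc⟩ := (F t).surjective (0, ξ)
    have hc1 : c.1 = 0 := h.injective (by rw [← hh, hc, map_zero])
    rw [← hc, ← hb t ht, hh, show c = (0, c.2) from Prod.ext hc1 rfl, hm₀.inr_fst, map_zero]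
  have hfst : ∀ t ∈ timeSet T, ∀ a b, (m t a b).1 = liePart (m t) a.1 b.1 := fun t ht a b => by
    have e : ∀ a : GT V, a = (a.1, 0) + (0, a.2) := by simp
    rw [liePart_apply]
    conv_lhs => rw [e a, e b]
    simp only [map_add, LinearMap.add_apply, Prod.fst_add, hmv t ht, hm.skew' ht _ (0, b.2),
      Prod.fst_neg]
    simp
  have hskew : ∀ t ∈ timeSet T, ∀ X Y, liePart (m t) X Y = -liePart (m t) Y X :=
    fun t ht X Y => by rw [liePart_apply, liePart_apply, hm.skew' ht]; rfl
  have hJ : ∀ t ∈ timeSet T, ∀ X Y Z, liePart (m t) (liePart (m t) X Y) Z +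
      liePart (m t) (liePart (m t) Y Z) X + liePart (m t) (liePart (m t) Z X) Y = 0 :=
    fun t ht X Y Z => by
      obtain ⟨a, ha⟩ := (F t).surjective (X, 0)
      obtain ⟨b, hb'⟩ := (F t).surjective (Y, 0)
      obtain ⟨c, hc⟩ := (F t).surjective (Z, 0)
      have := congrArg (fun a => (F t a).1) (hm₀.2.2.2 a b c)
      simpa [hb t ht, ha, hb', hc, hfst t ht] using this
  -- With `m t` regarded as given, moving the generator to the other argument by `pairing_gauge`
  -- makes the equation for the symmetric part linear and homogeneous; it starts at zero because
  -- `m₀` is Dorfman.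
  have hD : ∀ t ∈ timeSet T, symmPart (m t) = 0 := by
    refine eqOn_of_wderiv_linear (A := fun t => symmEqn 𝒢₀ (m t)) (reg_symmEqn (hm.reg 0))
      (z := fun _ => 0) (fun t ht => ?_) (fun s _ => (WDeriv.const _).congr_deriv (map_zero _).symm)
      (by rw [hm.init, hm₀.symmPart_eq_zero])
    refine WDeriv.of_apply fun a => WDeriv.of_apply fun b => WDeriv.of_apply fun c =>
      WDeriv.of_real ?_
    have h1 := fun a b => ((hm.wderiv ht).apply_const a).apply_const b
    refine (((h1 a b).pairing (WDeriv.const c)).add ((h1 a c).pairing (WDeriv.const b))).congr_deriv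
      ?_
    have e1 := pairing_gauge 𝒢₀ (m t) (hskew t ht) (hJ t ht) (m t a b) c
    have e2 := pairing_gauge 𝒢₀ (m t) (hskew t ht) (hJ t ht) (m t a c) b
    rw [symmEqn_apply]
    simp only [symmPart_apply, LinearMap.neg_apply, thetaB_apply, Theta, pairing_eq_pairL, map_sub,
      map_neg, LinearMap.sub_apply, LinearMap.neg_apply, map_zero, add_zero] at e1 e2 ⊢
    linarith
  have hp := pairing_of_skew hF.init hF.wderiv fun t ht x y => by
    have := pairing_gauge 𝒢₀ (m t) (hskew t ht) (hJ t ht) x y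
    rw [hD t ht, restrict₃_zero, codiffAlg_zero] at this
    simp only [pairing_eq_pairL, map_neg, LinearMap.neg_apply, LinearMap.zero_apply] at this ⊢
    linarith
  have hdorf : ∀ t ∈ timeSet T, IsDorfman (m t) := fun t ht => by
    obtain ⟨h, hh⟩ := exists_anchor (hv t ht)
    exact hm₀.map hh (hp t ht) (hb t ht)
  -- The value `𝒢₀` is a filler for times outside `[0, T)`, where orthogonality of `F t` is unknown.
  let 𝒢 : ℝ → GenMetric V := fun t =>
    if h : ∀ a b, pairing (F t a) (F t b) = pairing a b then 𝒢₀.pullback (F t) h else 𝒢₀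
  have h𝒢 : ∀ t ∈ timeSet T, ∀ a, F t ((𝒢 t).toEnd a) = 𝒢₀.toEnd (F t a) := fun t ht a => by
    simp only [𝒢, dif_pos (hp t ht)]
    exact GenMetric.map_pullback _ _ _ _
  have hI : ∀ t ∈ timeSet T, ∃ h, CourantIso h (F t) m₀ (𝒢 t) (m t) 𝒢₀ := fun t ht => by
    obtain ⟨h, hh⟩ := exists_anchor (hv t ht)
    exact ⟨h, hh, hp t ht, hb t ht, h𝒢 t ht⟩
  refine ⟨hdorf, 𝒢, ?_, fun t ht => ?_, hI⟩
  · refine GenMetric.ext_toEnd (LinearMap.ext fun a => ?_)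
    simpa [hF.init] using h𝒢 0 (zero_mem_timeSet hm.pos) a
  · refine WDeriv.of_apply fun a => WDeriv.of_pairing fun c => ?_
    have h1 := fun a => (hF.wderiv t ht).apply_const a
    have e : ∀ s ∈ timeSet T, pairing ((𝒢 s).toEnd a) c = pairing (𝒢₀.toEnd (F s a)) (F s c) :=
      fun s hs => by rw [← h𝒢 s hs, hp s hs]
    refine ((WDeriv.of_real (((h1 a).map 𝒢₀.toEnd).pairing (h1 c))).congr e ht).real.congr_deriv ?_
    obtain ⟨h, I⟩ := hI t ht
    rw [← hp t ht ((-(2 : ℝ) • (𝒢 t).toEnd ∘ₗ rcAlg (𝒢 t) m₀) a) c]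
    have e1 : F t ((-(2 : ℝ) • (𝒢 t).toEnd ∘ₗ rcAlg (𝒢 t) m₀) a) =
        -(2 : ℝ) • 𝒢₀.toEnd (rcAlg 𝒢₀ (m t) (F t a)) := by
      rw [← I.rcAlg_map hm₀ (hdorf t ht), ← h𝒢 t ht]; simp
    have h2 := (hdorf t ht).pairing_gauge 𝒢₀ (𝒢₀.toEnd (F t a)) (F t c)
    rw [gauge_toEnd] at h2
    rw [e1]
    simp only [pairing_eq_pairL, map_sub, map_smul, map_neg, LinearMap.sub_apply,
      LinearMap.smul_apply, LinearMap.comp_apply, LinearEquiv.coe_coe,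
      LinearMap.neg_apply, smul_eq_mul] at h2 ⊢
    linarith

theorem CourantIso.metric_unique {W : Type*} [AddCommGroup W] [Module ℝ W] [FiniteDimensional ℝ W]
    {h h' : V ≃ₗ[ℝ] W} {F : GT V ≃ₗ[ℝ] GT W} {m m₁ : Brkt V} {𝒢 𝒢₁ : GenMetric V} {m' : Brkt W}
    {𝒢' : GenMetric W} (I : CourantIso h F m 𝒢 m' 𝒢') (I' : CourantIso h' F m₁ 𝒢₁ m' 𝒢') :
    𝒢 = 𝒢₁ :=
  GenMetric.ext_toEnd (LinearMap.ext fun a => F.injective (by rw [I.metric_eq, I'.metric_eq]))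

/-- Two metric flows with the same initial value yield bracket flows with the same background. These
coincide, hence so do the gauge families, and the metric is recovered as `F⁻¹ 𝒢₀ F`. -/
theorem IsMetricFlow.eqOn (hm₀ : IsDorfman m₀) (hT : 0 < T) {𝒢 𝒢' : ℝ → GenMetric V}
    (h𝒢 : IsMetricFlow m₀ 𝒢 T) (h𝒢' : IsMetricFlow m₀ 𝒢' T) (h0 : 𝒢 0 = 𝒢' 0) :
    ∀ t ∈ timeSet T, 𝒢 t = 𝒢' t := fun t ht => by
  obtain ⟨m, F, hm, hF, hI⟩ := h𝒢.exists_bracketFlow hm₀ hT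
  obtain ⟨m', F', hm', hF', hI'⟩ := h𝒢'.exists_bracketFlow hm₀ hT
  rw [← h0] at hm' hF' hI'
  have e := hm.eqOn hm'
  have hF'' : IsGaugeFamily (𝒢 0) m F' T := ⟨hF'.init, fun s hs => e s hs ▸ hF'.wderiv s hs⟩
  obtain ⟨h, I⟩ := hI t ht
  obtain ⟨h', I'⟩ := hI' t ht
  rw [← hF.eqOn hm hF'' t ht, ← e t ht] at I'
  exact I.metric_unique I'

end Flows

/-! ### Dorfman brackets built from a Lie bracket and a closed form, and lifts of linear
isomorphisms. -/

section Lift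

set_option linter.unusedSectionVars false

variable {V : Type*} [AddCommGroup V] [Module ℝ V] [FiniteDimensional ℝ V]
  {W : Type*} [AddCommGroup W] [Module ℝ W] [FiniteDimensional ℝ W]

/-- The `V`-part of the Jacobi identity is that of `μ`. In the `V*`-part, the terms with covectors
cancel by the Jacobi identity of `μ`, and the terms with `H` form `dH`, which `hd` annihilates. -/
theorem isDorfman_dorfman {μ : Prod2 V} {H : Form3 V} (hμ : ∀ X, μ X X = 0)
    (hJ : ∀ X Y Z, μ (μ X Y) Z + μ (μ Y Z) X + μ (μ Z X) Y = 0)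
    (h₁ : ∀ X Y, H X X Y = 0) (h₂ : ∀ X Y, H X Y Y = 0)
    (hd : ∀ X Y Z W, -H (μ X Y) Z W + H (μ X Z) Y W - H (μ X W) Y Z - H (μ Y Z) X W
      + H (μ Y W) X Z - H (μ Z W) X Y = 0) : IsDorfman (dorfman μ H) := by
  have sμ : ∀ X Y, μ X Y = -μ Y X := fun X Y => by
    have := hμ (X + Y)
    simp only [map_add, LinearMap.add_apply, hμ, zero_add, add_zero] at this
    exact eq_neg_of_add_eq_zero_right this
  have s₁ : ∀ X Y Z, H X Y Z = -H Y X Z := fun X Y Z => by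
    have := h₁ (X + Y) Z
    simp only [map_add, LinearMap.add_apply, h₁, zero_add, add_zero] at this
    linarith
  have s₂ : ∀ X Y Z, H X Y Z = -H X Z Y := fun X Y Z => by
    have := h₂ X (Y + Z)
    simp only [map_add, LinearMap.add_apply, h₂, zero_add, add_zero] at this
    linarith
  refine ⟨fun a => ?_, fun a b c => ?_, fun ξ η => ?_, fun a b c => ?_⟩
  · have : H a.1 a.1 = 0 := LinearMap.ext fun Y => h₁ a.1 Y
    rw [dorfman_apply, hμ, this]
    simp
  · simp only [pairing, dorfman_apply, LinearMap.add_apply, LinearMap.neg_apply,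
      LinearMap.comp_apply]
    rw [sμ c.1 b.1, s₂ a.1 c.1 b.1, map_neg]
    ring
  · simp [dorfman_apply]
  · refine Prod.ext (hJ _ _ _) (LinearMap.ext fun z => ?_)
    have j : ∀ X Y Z, μ (μ X Y) Z = μ X (μ Y Z) - μ Y (μ X Z) := fun X Y Z => by
      have := hJ X Y Z
      rw [sμ (μ Y Z) X, sμ (μ Z X) Y, sμ Z X, map_neg] at this
      rw [← sub_eq_zero, ← this]
      abel
    simp only [dorfman_apply, Prod.snd_add, LinearMap.add_apply, LinearMap.neg_apply,
      LinearMap.comp_apply, j _ _ z, map_sub, Prod.snd_zero, LinearMap.zero_apply]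
    have d := hd a.1 b.1 c.1 z
    have e : ∀ X Y Z, H X Y Z = H Y Z X := fun X Y Z => by rw [s₁ X Y Z, s₂ Y X Z, neg_neg]
    rw [e (μ a.1 z), e (μ b.1 z), e (μ c.1 z), sμ a.1 c.1, s₁ a.1 c.1 (μ b.1 z)] at d
    simp only [map_neg, LinearMap.neg_apply] at d
    linarith

/-- The lift `(v, ξ) ↦ (h v, ξ ∘ h⁻¹)` of `h : V ≃ W` to `V ⊕ V* ≃ W ⊕ W*`. -/
def lift (h : V ≃ₗ[ℝ] W) : GT V ≃ₗ[ℝ] GT W := h.prodCongr h.dualMap.symm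

theorem lift_apply (h : V ≃ₗ[ℝ] W) (a : GT V) :
    lift h a = (h a.1, a.2 ∘ₗ h.symm.toLinearMap) := rfl

theorem pairing_lift (h : V ≃ₗ[ℝ] W) (a b : GT V) :
    pairing (lift h a) (lift h b) = pairing a b := by
  simp [pairing, lift_apply]

theorem courantIso_lift {h : V ≃ₗ[ℝ] W} {μ : Prod2 V} {H : Form3 V} {μ' : Prod2 W} {H' : Form3 W}
    {𝒢 : GenMetric V} {𝒢' : GenMetric W} (hμ : ∀ X Y, μ' (h X) (h Y) = h (μ X Y))
    (hH : ∀ X Y Z, H' (h X) (h Y) (h Z) = H X Y Z)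
    (h𝒢 : ∀ a, lift h (𝒢.toEnd a) = 𝒢'.toEnd (lift h a)) :
    CourantIso h (lift h) (dorfman μ H) 𝒢 (dorfman μ' H') 𝒢' where
  anchor _ := rfl
  pairing_eq := pairing_lift h
  metric_eq := h𝒢
  bracket_eq a b := by
    refine Prod.ext (hμ _ _).symm (LinearMap.ext fun z => ?_)
    obtain ⟨z, rfl⟩ := h.surjective z
    simp [lift_apply, dorfman_apply, hμ, hH]

/-- Transport of `g` and `b` does not involve the bracket, so zero brackets serve to form an
isomorphism. -/
theorem b_lift {h : V ≃ₗ[ℝ] W} {𝒢 : GenMetric V} {𝒢' : GenMetric W}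
    (h𝒢 : ∀ a, lift h (𝒢.toEnd a) = 𝒢'.toEnd (lift h a)) (X Y : V) :
    𝒢'.b (h X) (h Y) = 𝒢.b X Y := by
  have I : CourantIso h (lift h) (dorfman 0 0) 𝒢 (dorfman 0 0) 𝒢' :=
    courantIso_lift (by simp) (by simp) h𝒢
  have := congrArg Prod.snd (I.map_expB_inl X)
  simpa [lift_apply, expB_apply] using (LinearMap.congr_fun this (h Y)).symm

theorem g_lift {h : V ≃ₗ[ℝ] W} {𝒢 : GenMetric V} {𝒢' : GenMetric W}
    (h𝒢 : ∀ a, lift h (𝒢.toEnd a) = 𝒢'.toEnd (lift h a)) (X Y : V) :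
    𝒢'.g (h X) (h Y) = 𝒢.g X Y := by
  have I : CourantIso h (lift h) (dorfman 0 0) 𝒢 (dorfman 0 0) 𝒢' :=
    courantIso_lift (by simp) (by simp) h𝒢
  exact I.g_map X Y

end Lift

/-! ### Reduction of left-invariant geometry on the group to its Lie algebra. -/

section LeftInvariant

set_option linter.unusedSectionVars false

variable {E : Type*} [NormedAddCommGroup E] [NormedSpace ℝ E] [FiniteDimensional ℝ E]
  {G : Type*} [TopologicalSpace G] [ChartedSpace E G] [Group G]

theorem mdifferentiable_mul_left [LieGroup 𝓘(ℝ, E) ∞ G] (x : G) :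
    MDifferentiable 𝓘(ℝ, E) 𝓘(ℝ, E) (x * · : G → G) :=
  (contMDiff_mul_left (I := 𝓘(ℝ, E)) (n := ∞) (a := x)).mdifferentiable (by simp)

variable (E G) in
theorem lieGroup_minSmoothness [LieGroup 𝓘(ℝ, E) ∞ G] :
    LieGroup 𝓘(ℝ, E) (minSmoothness ℝ 3) G := by
  rw [minSmoothness_of_isRCLikeNormedField]
  exact LieGroup.of_le (n := ∞) (WithTop.coe_le_coe.2 le_top : ((3 : ℕ∞) : WithTop ℕ∞) ≤ _)

theorem dL_mulInvariantVectorField [LieGroup 𝓘(ℝ, E) ∞ G] (x y : G)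
    (v : GroupLieAlgebra 𝓘(ℝ, E) G) :
    dL x y (mulInvariantVectorField v y) = mulInvariantVectorField v (x * y) := by
  have e : ((x * y) * · : G → G) = (x * ·) ∘ (y * ·) := by ext z; simp [mul_assoc]
  unfold mulInvariantVectorField
  rw [e]
  exact (mfderiv_comp_apply_of_eq (I' := 𝓘(ℝ, E)) (1 : G) (mdifferentiable_mul_left x y)
    (mdifferentiable_mul_left y 1) (mul_one y) v).symm

theorem mulInvariantVectorField_one (v : GroupLieAlgebra 𝓘(ℝ, E) G) :
    mulInvariantVectorField v 1 = v := by
  have e : ((1 : G) * · : G → G) = id := by ext z; simp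
  unfold mulInvariantVectorField
  rw [e, mfderiv_id]
  rfl

/-- The left trivialization of the tangent bundle. -/
def leftTriv [LieGroup 𝓘(ℝ, E) ∞ G] (x : G) :
    GroupLieAlgebra 𝓘(ℝ, E) G ≃ₗ[ℝ] TangentSpace 𝓘(ℝ, E) x where
  toFun v := mulInvariantVectorField v x
  invFun w := (mfderiv 𝓘(ℝ, E) 𝓘(ℝ, E) (x⁻¹ * ·) x w : TangentSpace 𝓘(ℝ, E) (x⁻¹ * x))
  map_add' v w := by simp [mulInvariantVectorField_add]
  map_smul' c v := by simp [mulInvariantVectorField_smul]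
  left_inv v := by
    have h : ∀ z : G, z = 1 → (mulInvariantVectorField v z : E) = v := by
      rintro z rfl
      exact mulInvariantVectorField_one v
    exact (dL_mulInvariantVectorField x⁻¹ x v).trans (h _ (inv_mul_cancel x))
  right_inv w := by
    have e : (x * · : G → G) ∘ (x⁻¹ * ·) = id := by ext z; simp
    have h := mfderiv_comp_apply_of_eq (I := 𝓘(ℝ, E)) (I' := 𝓘(ℝ, E)) (I'' := 𝓘(ℝ, E)) (x : G)
      (mdifferentiable_mul_left x 1)
      (mdifferentiable_mul_left x⁻¹ x) (inv_mul_cancel x) w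
    rw [e, mfderiv_id] at h
    exact h.symm

variable [LieGroup 𝓘(ℝ, E) ∞ G]

theorem leftTriv_one (v : GroupLieAlgebra 𝓘(ℝ, E) G) : leftTriv 1 v = v :=
  mulInvariantVectorField_one v

theorem leftTriv_one_eq : leftTriv (1 : G) = LinearEquiv.refl ℝ (TangentSpace 𝓘(ℝ, E) (1 : G)) :=
  LinearEquiv.ext mulInvariantVectorField_one

theorem dL_leftTriv (x y : G) (v : GroupLieAlgebra 𝓘(ℝ, E) G) :
    dL x y (leftTriv y v) = leftTriv (x * y) v := dL_mulInvariantVectorField x y v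

theorem dL_eq (x y : G) : (dL x y).toLinearMap =
    ((leftTriv y).symm.trans (leftTriv (x * y)) :
      TangentSpace 𝓘(ℝ, E) y ≃ₗ[ℝ] TangentSpace 𝓘(ℝ, E) (x * y)).toLinearMap := by
  ext v
  obtain ⟨v, rfl⟩ := (leftTriv y).surjective v
  simpa using dL_leftTriv x y v

theorem leftExt_apply (x y : G) (v : TangentSpace 𝓘(ℝ, E) x) :
    leftExt x v y = leftTriv y ((leftTriv x).symm v) := rfl

theorem leftExt_self (x : G) (v : TangentSpace 𝓘(ℝ, E) x) : leftExt x v x = v :=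
  (leftTriv x).apply_symm_apply v

theorem leftExt_leftExt (x y : G) (v : TangentSpace 𝓘(ℝ, E) x) :
    leftExt y (leftExt x v y) = leftExt x v := by
  ext z
  simp [leftExt_apply]

/-- The left-invariant field of products that is the Lie bracket of left-invariant vector fields. -/
def lieProd (x : G) : Prod2 (TangentSpace 𝓘(ℝ, E) x) :=
  ((lin₂ fun X Y : GroupLieAlgebra 𝓘(ℝ, E) G => ⁅X, Y⁆).compl₁₂ (leftTriv x).symm.toLinearMap
    (leftTriv x).symm.toLinearMap).compr₂ (leftTriv x).toLinearMap

theorem lin₂_lie (X Y : GroupLieAlgebra 𝓘(ℝ, E) G) :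
    lin₂ (fun X Y : GroupLieAlgebra 𝓘(ℝ, E) G => ⁅X, Y⁆) X Y = ⁅X, Y⁆ := by
  have := lieGroup_minSmoothness E G
  have := FiniteDimensional.complete ℝ E
  exact lin₂_apply (f := fun X Y : GroupLieAlgebra 𝓘(ℝ, E) G => ⁅X, Y⁆)
    (fun v => ⟨fun _ _ => add_lie _ _ _, fun _ _ => smul_lie _ _ _⟩)
    (fun v => ⟨fun _ _ => lie_add _ _ _, fun _ _ => lie_smul _ _ _⟩) X Y

theorem lieProd_leftTriv (x : G) (u v : GroupLieAlgebra 𝓘(ℝ, E) G) :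
    lieProd x (leftTriv x u) (leftTriv x v) = leftTriv x ⁅u, v⁆ := by
  simp [lieProd, lin₂_lie]

theorem lieProd_leftExt (x y : G) (u v : TangentSpace 𝓘(ℝ, E) x) :
    lieProd y (leftExt x u y) (leftExt x v y) = leftExt x (lieProd x u v) y := by
  obtain ⟨u, rfl⟩ := (leftTriv x).surjective u
  obtain ⟨v, rfl⟩ := (leftTriv x).surjective v
  simp [leftExt_apply, lieProd_leftTriv]

theorem lieB_leftExt (x : G) (u v : TangentSpace 𝓘(ℝ, E) x) :
    lieB (leftExt x u) (leftExt x v) = leftExt x (lieProd x u v) := by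
  have := lieGroup_minSmoothness E G
  have := FiniteDimensional.complete ℝ E
  obtain ⟨u, rfl⟩ := (leftTriv x).surjective u
  obtain ⟨v, rfl⟩ := (leftTriv x).surjective v
  have e : ∀ w : GroupLieAlgebra 𝓘(ℝ, E) G, leftExt x (leftTriv x w) = mulInvariantVectorField w := fun w => by
    ext z
    exact congrArg (leftTriv z) ((leftTriv x).symm_apply_apply w)
  rw [lieProd_leftTriv, e, e, e, GroupLieAlgebra.bracket_def, mulInvariantVector_mlieBracket]
  rfl

/-- Invariant tensors evaluated on left-invariant fields are constant; dropping their derivatives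
turns the differential formulas into the algebraic ones. -/
theorem der_of_const {f : G → ℝ} (h : ∀ y z, f y = f z) (U : VField E G) (x : G) :
    der U f x = 0 := by
  have : f = fun _ => f x := funext fun y => h y x
  rw [this, der, mfderiv_const]
  rfl

section Invariant

variable {g : FieldMetric E G} {b : Field2 E G} {H : Field3 E G}

theorem nabla_leftExt_self (hg : ∀ x y u v, g y (leftExt x u y) (leftExt x v y) = g x u v)
    (x : G) (u v : TangentSpace 𝓘(ℝ, E) x) :
    nabla g (leftExt x u) (leftExt x v) x = nablaAlg (lieProd x) (g x) u v := by
  unfold nabla nablaAlg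
  congr 2
  funext w
  have d : ∀ (U : VField E G) a b, der U (fun y => g y (leftExt x a y) (leftExt x b y)) x = 0 :=
    fun U a b => der_of_const (fun y z => (hg x y a b).trans (hg x z a b).symm) U x
  simp only [d, lieB_leftExt, leftExt_self]
  ring

/-- Naturality of the algebraic connection under translation from `x` to `y` makes the covariant
derivative left-invariant again, so second covariant derivatives can be computed the same way. -/
theorem nabla_leftExt (hg : ∀ x y u v, g y (leftExt x u y) (leftExt x v y) = g x u v)
    (x : G) (u v : TangentSpace 𝓘(ℝ, E) x) :
    nabla g (leftExt x u) (leftExt x v) = leftExt x (nablaAlg (lieProd x) (g x) u v) := by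
  ext y
  rw [← leftExt_leftExt x y u, ← leftExt_leftExt x y v, nabla_leftExt_self hg]
  exact nablaAlg_map (h := (leftTriv x).symm.trans (leftTriv y)) (hg x y) (lieProd_leftExt x y) u v

theorem ric_eq (hg : ∀ x y u v, g y (leftExt x u y) (leftExt x v y) = g x u v) (x : G) :
    ric g x = ricAlg (lieProd x) (g x) := by
  unfold ric ricAlg riem riemAlg
  simp only [lieB_leftExt, nabla_leftExt hg, Pi.sub_apply, leftExt_self]

theorem d2_eq (hb : ∀ x y u v, b y (leftExt x u y) (leftExt x v y) = b x u v) (x : G) :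
    d2 b x = dAlg (lieProd x) (b x) := by
  unfold d2 dAlg
  congr 1
  funext u v w
  have d : ∀ (U : VField E G) v w, der U (fun y => b y (leftExt x v y) (leftExt x w y)) x = 0 :=
    fun U v w => der_of_const (fun y z => (hb x y v w).trans (hb x z v w).symm) U x
  simp only [d, lieB_leftExt, leftExt_self]
  ring

theorem codiff_eq (hg : ∀ x y u v, g y (leftExt x u y) (leftExt x v y) = g x u v)
    (hH : ∀ x y u v w, H y (leftExt x u y) (leftExt x v y) (leftExt x w y) = H x u v w) (x : G) :
    codiff g H x = codiffAlg (lieProd x) (g x) (H x) := by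
  unfold codiff codiffAlg nablaForm
  congr 1
  funext v w
  have d : ∀ (U : VField E G) a b c,
      der U (fun y => H y (leftExt x a y) (leftExt x b y) (leftExt x c y)) x = 0 :=
    fun U a b c => der_of_const (fun y z => (hH x y a b c).trans (hH x z a b c).symm) U x
  simp only [d, nabla_leftExt hg, leftExt_self]
  simp only [zero_sub]

theorem d3_eq (hH : ∀ x y u v w, H y (leftExt x u y) (leftExt x v y) (leftExt x w y) = H x u v w)
    (x : G) (u v w z : TangentSpace 𝓘(ℝ, E) x) :
    d3 H x u v w z = -H x (lieProd x u v) w z + H x (lieProd x u w) v z - H x (lieProd x u z) v w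
      - H x (lieProd x v w) u z + H x (lieProd x v z) u w - H x (lieProd x w z) u v := by
  have d : ∀ (U : VField E G) a b c,
      der U (fun y => H y (leftExt x a y) (leftExt x b y) (leftExt x c y)) x = 0 :=
    fun U a b c => der_of_const (fun y z => (hH x y a b c).trans (hH x z a b c).symm) U x
  unfold d3
  simp only [d, lieB_leftExt, leftExt_self]
  ring

end Invariant

/-- The lift of the left trivialization to `𝔤 ⊕ 𝔤* ≃ T_xG ⊕ T_x*G`. -/
abbrev liftTriv (x : G) :
    GT (GroupLieAlgebra 𝓘(ℝ, E) G) ≃ₗ[ℝ] GT (TangentSpace 𝓘(ℝ, E) x) :=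
  lift (leftTriv x)

theorem IsClosedLeftInvariant3Form.leftTriv_apply {H : Field3 E G}
    (hH : IsClosedLeftInvariant3Form H) (x : G) (u v w : GroupLieAlgebra 𝓘(ℝ, E) G) :
    H x (leftTriv x u) (leftTriv x v) (leftTriv x w) = H 1 u v w := by
  obtain ⟨x, rfl⟩ : ∃ x', x = x' * 1 := ⟨x, (mul_one x).symm⟩
  have := hH.invariant x 1 (leftTriv 1 u) (leftTriv 1 v) (leftTriv 1 w)
  rwa [dL_leftTriv, dL_leftTriv, dL_leftTriv, leftTriv_one, leftTriv_one, leftTriv_one] at this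

theorem IsClosedLeftInvariant3Form.leftExt_apply {H : Field3 E G}
    (hH : IsClosedLeftInvariant3Form H) (x y : G) (u v w : TangentSpace 𝓘(ℝ, E) x) :
    H y (leftExt x u y) (leftExt x v y) (leftExt x w y) = H x u v w := by
  obtain ⟨u, rfl⟩ := (leftTriv x).surjective u
  obtain ⟨v, rfl⟩ := (leftTriv x).surjective v
  obtain ⟨w, rfl⟩ := (leftTriv x).surjective w
  simp [GenGeom.leftExt_apply, hH.leftTriv_apply]

theorem IsClosedLeftInvariant3Form.isDorfman {H : Field3 E G}
    (hH : IsClosedLeftInvariant3Form H) : IsDorfman (groupBracket H) := by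
  have := lieGroup_minSmoothness E G
  have := FiniteDimensional.complete ℝ E
  refine isDorfman_dorfman (fun X => ?_) (fun X Y Z => ?_) (hH.alt₁ 1) (hH.alt₂ 1)
    fun X Y Z W => ?_
  · rw [lin₂_lie, lie_self]
  · simp only [lin₂_lie]
    rw [← lie_skew ⁅Y, Z⁆ X, ← lie_skew ⁅Z, X⁆ Y, ← lie_skew ⁅X, Y⁆ Z, ← neg_add, ← neg_add,
      neg_eq_zero, ← lie_jacobi X Y Z]
    abel
  · have h := d3_eq hH.leftExt_apply 1 X Y Z W
    rw [hH.closed] at h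
    have e : ∀ u v : GroupLieAlgebra 𝓘(ℝ, E) G, lieProd (1 : G) u v = ⁅u, v⁆ := fun u v => by
      simpa [leftTriv_one] using lieProd_leftTriv (1 : G) u v
    simp only [lin₂_lie]
    simp only [e] at h
    exact h.symm

theorem isLeftInvariant_iff {𝒢 : FieldGenMetric E G} : IsLeftInvariant 𝒢 ↔
    ∀ x a, liftTriv x ((𝒢 1).toEnd a) = (𝒢 x).toEnd (liftTriv x a) := by
  have key : IsLeftInvariant 𝒢 ↔ ∀ (x y : G) a,
      lift ((leftTriv y).symm.trans (leftTriv (x * y))) ((𝒢 y).toEnd a) =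
        (𝒢 (x * y)).toEnd (lift ((leftTriv y).symm.trans (leftTriv (x * y))) a) := by
    -- The translation from `y` to `xy` is the trivialization at `xy` after the inverse of that at
    -- `y`; written through its lift, invariance can be compared with the identity fibre.
    refine forall₂_congr fun x y => ?_
    rw [dL_eq]
    have e : ∀ v : TangentSpace 𝓘(ℝ, E) y, dL x y v = ((leftTriv y).symm.trans (leftTriv (x * y))) v := fun v =>
      LinearMap.congr_fun (dL_eq x y) v
    simp only [e]
    generalize ((leftTriv y).symm.trans (leftTriv (x * y)) : TangentSpace 𝓘(ℝ, E) y ≃ₗ[ℝ] _) = h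
    constructor
    · intro H a
      obtain ⟨h1, h2⟩ := H a.1 (a.2 ∘ₗ h.symm.toLinearMap)
      have ea : (a.2 ∘ₗ h.symm.toLinearMap) ∘ₗ h.toLinearMap = a.2 := by ext; simp
      rw [ea] at h1 h2
      refine Prod.ext h1.symm ?_
      rw [lift_apply]
      change ((𝒢 y).toEnd (a.1, a.2)).2 ∘ₗ _ = _
      rw [← h2]
      ext; simp [lift_apply]
    · intro H v η
      have ea : lift h (v, η ∘ₗ h.toLinearMap) = (h v, η) := by
        rw [lift_apply]
        exact Prod.ext rfl (by ext; simp)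
      rw [← ea, ← H]
      exact ⟨rfl, by ext; simp [lift_apply]⟩
  rw [key]
  constructor
  · intro H x a
    obtain ⟨x, rfl⟩ : ∃ x', x = x' * 1 := ⟨x, (mul_one x).symm⟩
    have e : (leftTriv (1 : G)).symm.trans (leftTriv (x * 1)) =
        (leftTriv (x * 1) : GroupLieAlgebra 𝓘(ℝ, E) G ≃ₗ[ℝ] _) := by
      rw [leftTriv_one_eq]
      rfl
    have := H x 1 a
    rwa [e] at this
  · intro H x y a
    obtain ⟨a, rfl⟩ := (liftTriv y).surjective a
    have e : ∀ a : GT (GroupLieAlgebra 𝓘(ℝ, E) G),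
        lift ((leftTriv y).symm.trans (leftTriv (x * y))) (liftTriv y a) = liftTriv (x * y) a := fun a => by
      refine Prod.ext ?_ ?_
      · change leftTriv (x * y) ((leftTriv y).symm (leftTriv y a.1)) = leftTriv (x * y) a.1
        rw [LinearEquiv.symm_apply_apply]
      · ext w
        change a.2 ((leftTriv y).symm (leftTriv y ((leftTriv (x * y)).symm w))) =
          a.2 ((leftTriv (x * y)).symm w)
        rw [LinearEquiv.symm_apply_apply]
    rw [← H, e, e, H]

namespace IsLeftInvariant

variable {𝒢 : FieldGenMetric E G} {H : Field3 E G}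

theorem g_leftExt (h𝒢 : IsLeftInvariant 𝒢) (x y : G) (u v : TangentSpace 𝓘(ℝ, E) x) :
    (𝒢 y).g (leftExt x u y) (leftExt x v y) = (𝒢 x).g u v := by
  obtain ⟨u, rfl⟩ := (leftTriv x).surjective u
  obtain ⟨v, rfl⟩ := (leftTriv x).surjective v
  rw [g_lift (isLeftInvariant_iff.1 h𝒢 x), leftExt_apply, leftExt_apply,
    LinearEquiv.symm_apply_apply, LinearEquiv.symm_apply_apply, g_lift (isLeftInvariant_iff.1 h𝒢 y)]

theorem b_leftExt (h𝒢 : IsLeftInvariant 𝒢) (x y : G) (u v : TangentSpace 𝓘(ℝ, E) x) :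
    (𝒢 y).b (leftExt x u y) (leftExt x v y) = (𝒢 x).b u v := by
  obtain ⟨u, rfl⟩ := (leftTriv x).surjective u
  obtain ⟨v, rfl⟩ := (leftTriv x).surjective v
  rw [b_lift (isLeftInvariant_iff.1 h𝒢 x), leftExt_apply, leftExt_apply,
    LinearEquiv.symm_apply_apply, LinearEquiv.symm_apply_apply, b_lift (isLeftInvariant_iff.1 h𝒢 y)]

theorem genRic_eq (h𝒢 : IsLeftInvariant 𝒢) (hH : IsClosedLeftInvariant3Form H) (x : G) :
    genRic H 𝒢 x = rcAlg (𝒢 x) (dorfman (lieProd x) (H x)) := by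
  have hd : d2 (fun y => (𝒢 y).b) = fun y => dAlg (lieProd y) (𝒢 y).b :=
    funext fun y => d2_eq h𝒢.b_leftExt y
  have hH' : ∀ x y u v w, (H + d2 fun y => (𝒢 y).b) y (leftExt x u y) (leftExt x v y)
      (leftExt x w y) = (H + d2 fun y => (𝒢 y).b) x u v w := fun x y u v w => by
    simp only [hd, Pi.add_apply, LinearMap.add_apply, hH.leftExt_apply, dAlg_apply,
      lieProd_leftExt, h𝒢.b_leftExt]
  unfold genRic rcAlg
  simp only [liePart_dorfman, formPart_dorfman]
  rw [ric_eq h𝒢.g_leftExt, codiff_eq h𝒢.g_leftExt hH', hd]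
  rfl

/-- The left trivialization is an isomorphism from the structure on `𝔤 ⊕ 𝔤*` to the one on the fibre
at `x`, so naturality reduces the flow to a single equation at the identity. -/
theorem genRic_liftTriv (h𝒢 : IsLeftInvariant 𝒢) (hH : IsClosedLeftInvariant3Form H) (x : G)
    (a : GT (GroupLieAlgebra 𝓘(ℝ, E) G)) :
    genRic H 𝒢 x (liftTriv x a) = liftTriv x (rcAlg (𝒢 1) (groupBracket H) a) := by
  have I : CourantIso (leftTriv x) (liftTriv x) (groupBracket H) (𝒢 1)
      (dorfman (lieProd x) (H x)) (𝒢 x) :=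
    courantIso_lift (fun X Y => by rw [lieProd_leftTriv, lin₂_lie]) (hH.leftTriv_apply x)
      (isLeftInvariant_iff.1 h𝒢 x)
  rw [h𝒢.genRic_eq hH, I.rcAlg_map hH.isDorfman
    (hH.isDorfman.map I.anchor I.pairing_eq I.bracket_eq)]

theorem ext {𝒢' : FieldGenMetric E G} (h𝒢 : IsLeftInvariant 𝒢) (h𝒢' : IsLeftInvariant 𝒢')
    (h : 𝒢 1 = 𝒢' 1) : 𝒢 = 𝒢' := by
  funext x
  refine GenMetric.ext_toEnd (LinearMap.ext fun a => ?_)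
  obtain ⟨a, rfl⟩ := (liftTriv x).surjective a
  rw [← isLeftInvariant_iff.1 h𝒢, ← isLeftInvariant_iff.1 h𝒢', h]

end IsLeftInvariant

theorem liftTriv_one (a : GT (GroupLieAlgebra 𝓘(ℝ, E) G)) : liftTriv (1 : G) a = a := by
  refine Prod.ext (leftTriv_one a.1) (LinearMap.ext fun v => ?_)
  have h : (leftTriv (1 : G)).symm v = v := by
    rw [LinearEquiv.symm_apply_eq, leftTriv_one]
  exact congrArg a.2 h

theorem IsGenRicciFlow.isMetricFlow {H : Field3 E G} (hH : IsClosedLeftInvariant3Form H)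
    {𝒢 : ℝ → FieldGenMetric E G} {T : EReal} (h𝒢 : IsGenRicciFlow H 𝒢 T) :
    IsMetricFlow (groupBracket H) (fun t => 𝒢 t 1) T := fun t ht =>
  WDeriv.of_apply fun a => WDeriv.of_pairing fun c => by
    have h := (h𝒢.invariant t ht.1 ht.2).genRic_liftTriv hH 1 a
    rw [liftTriv_one, liftTriv_one] at h
    have := h𝒢.eqn t ht.1 ht.2 1 a c
    rwa [h] at this

theorem isGenRicciFlow_of_isMetricFlow {H : Field3 E G} (hH : IsClosedLeftInvariant3Form H)
    {𝒢 : ℝ → FieldGenMetric E G} {T : EReal} (hT : 0 < T)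
    (hi : ∀ t ∈ timeSet T, IsLeftInvariant (𝒢 t))
    (h𝒢 : IsMetricFlow (groupBracket H) (fun t => 𝒢 t 1) T) : IsGenRicciFlow H 𝒢 T where
  pos := hT
  invariant t h1 h2 := hi t ⟨h1, h2⟩
  eqn t h1 h2 x a c := by
    obtain ⟨a, rfl⟩ := (liftTriv x).surjective a
    obtain ⟨c, rfl⟩ := (liftTriv x).surjective c
    have ht : t ∈ timeSet T := ⟨h1, h2⟩
    have := WDeriv.of_real (((h𝒢 t ht).apply_const a).pairing (WDeriv.const (t := t) c))
    refine ((this.congr (fun s hs => ?_) ht).congr_deriv ?_).real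
    · rw [← isLeftInvariant_iff.1 (hi s hs), pairing_lift]
    · rw [(hi t ht).genRic_liftTriv hH, ← isLeftInvariant_iff.1 (hi t ht), ← map_smul,
        pairing_lift]
      simp [pairing]

/-- The left-invariant generalized metric with a given value at the identity. -/
def invariantExt (𝒢 : GenMetric (GroupLieAlgebra 𝓘(ℝ, E) G)) : FieldGenMetric E G := fun x =>
  𝒢.pullback (liftTriv x).symm fun a b => by
    rw [← pairing_lift (leftTriv x), LinearEquiv.apply_symm_apply, LinearEquiv.apply_symm_apply]

theorem invariantExt_one (𝒢 : GenMetric (GroupLieAlgebra 𝓘(ℝ, E) G)) :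
    invariantExt 𝒢 (1 : G) = 𝒢 := by
  have h : ∀ a : GT (GroupLieAlgebra 𝓘(ℝ, E) G), (liftTriv (1 : G)).symm a = a := fun a => by
    rw [LinearEquiv.symm_apply_eq, liftTriv_one]
  refine GenMetric.ext_toEnd (LinearMap.ext fun a => ?_)
  have := 𝒢.map_pullback (liftTriv (1 : G)).symm (fun a b => by rw [h, h]) a
  rwa [h, h] at this

theorem isLeftInvariant_invariantExt (𝒢 : GenMetric (GroupLieAlgebra 𝓘(ℝ, E) G)) :
    IsLeftInvariant (invariantExt 𝒢) := by
  rw [isLeftInvariant_iff, invariantExt_one]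
  intro x a
  refine (liftTriv x).symm.injective ?_
  rw [invariantExt, GenMetric.map_pullback, LinearEquiv.symm_apply_apply,
    LinearEquiv.symm_apply_apply]

end LeftInvariant

/-! ### Comparison of maximal intervals. -/

section Maximal

set_option linter.unusedSectionVars false

variable {E : Type*} [NormedAddCommGroup E] [NormedSpace ℝ E] [FiniteDimensional ℝ E]
  {G : Type*} [TopologicalSpace G] [ChartedSpace E G] [Group G] [LieGroup 𝓘(ℝ, E) ∞ G]
  {H : Field3 E G}

/-- By uniqueness any solution on a longer interval extends the given one, so maximality bounds
every solution with the same data, not only extensions. -/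
theorem IsMaximalBracketFlow.le {V : Type*} [AddCommGroup V] [Module ℝ V] [FiniteDimensional ℝ V]
    {𝒢₀ : GenMetric V} {m₀ : Brkt V} {m m' : ℝ → Brkt V} {T T' : EReal}
    (hm : IsMaximalBracketFlow 𝒢₀ m₀ m T) (hm' : IsBracketFlow 𝒢₀ m₀ m' T') : T' ≤ T := by
  rcases le_total T' T with h | h
  · exact h
  · exact hm.2 m' T' hm' fun t h1 h2 => (hm'.mono hm.1.pos h).eqOn hm.1 t ⟨h1, h2⟩

theorem IsMaximalBracketFlow.unique {V : Type*} [AddCommGroup V] [Module ℝ V]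
    [FiniteDimensional ℝ V] {𝒢₀ : GenMetric V} {m₀ : Brkt V} {m m' : ℝ → Brkt V} {T T' : EReal}
    (hm : IsMaximalBracketFlow 𝒢₀ m₀ m T) (hm' : IsMaximalBracketFlow 𝒢₀ m₀ m' T') : T = T' :=
  le_antisymm (hm'.le hm.1) (hm.le hm'.1)

theorem IsGenRicciFlow.mono {𝒢 : ℝ → FieldGenMetric E G} {T T' : EReal}
    (h𝒢 : IsGenRicciFlow H 𝒢 T) (h0 : 0 < T') (h : T' ≤ T) : IsGenRicciFlow H 𝒢 T' where
  pos := h0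
  invariant t h1 h2 := h𝒢.invariant t h1 (h2.trans_le h)
  eqn t h1 h2 := h𝒢.eqn t h1 (h2.trans_le h)

theorem IsGenRicciFlow.eqOn (hH : IsClosedLeftInvariant3Form H) {𝒢 𝒢' : ℝ → FieldGenMetric E G}
    {T : EReal} (h𝒢 : IsGenRicciFlow H 𝒢 T) (h𝒢' : IsGenRicciFlow H 𝒢' T) (h0 : 𝒢 0 = 𝒢' 0) :
    ∀ t ∈ timeSet T, 𝒢 t = 𝒢' t := fun t ht =>
  (h𝒢.invariant t ht.1 ht.2).ext (h𝒢'.invariant t ht.1 ht.2)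
    ((h𝒢.isMetricFlow hH).eqOn hH.isDorfman h𝒢.pos (h𝒢'.isMetricFlow hH) (congrFun h0 1) t ht)

theorem IsMaximalGenRicciFlow.le (hH : IsClosedLeftInvariant3Form H)
    {𝒢 𝒢' : ℝ → FieldGenMetric E G} {T T' : EReal} (h𝒢 : IsMaximalGenRicciFlow H 𝒢 T)
    (h𝒢' : IsGenRicciFlow H 𝒢' T') (h0 : 𝒢' 0 = 𝒢 0) : T' ≤ T := by
  rcases le_total T' T with h | h
  · exact h
  · exact h𝒢.2 𝒢' T' h𝒢' fun t h1 h2 => (h𝒢'.mono h𝒢.1.pos h).eqOn hH h𝒢.1 h0 t ⟨h1, h2⟩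

theorem IsBracketFlow.exists_genRicciFlow (hH : IsClosedLeftInvariant3Form H)
    {𝒢₀ : FieldGenMetric E G} (h₀ : IsLeftInvariant 𝒢₀)
    {m : ℝ → Brkt (GroupLieAlgebra 𝓘(ℝ, E) G)} {T : EReal}
    (hm : IsBracketFlow (𝒢₀ 1) (groupBracket H) m T) :
    ∃ 𝒢 : ℝ → FieldGenMetric E G, 𝒢 0 = 𝒢₀ ∧ IsGenRicciFlow H 𝒢 T := by
  obtain ⟨F, hF⟩ := hm.exists_gaugeFamily
  obtain ⟨-, 𝒢, h0, h𝒢, -⟩ := hm.exists_metricFlow hH.isDorfman hF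
  refine ⟨fun t => invariantExt (𝒢 t), ?_, isGenRicciFlow_of_isMetricFlow hH hm.pos
    (fun t _ => isLeftInvariant_invariantExt _) ?_⟩
  · exact (isLeftInvariant_invariantExt _).ext h₀ ((invariantExt_one _).trans h0)
  · simpa only [invariantExt_one] using h𝒢

theorem IsMaximalGenRicciFlow.exists_isMaximalBracketFlow (hH : IsClosedLeftInvariant3Form H)
    {𝒢 : ℝ → FieldGenMetric E G} {T : EReal} (h𝒢 : IsMaximalGenRicciFlow H 𝒢 T) :
    ∃ m, IsMaximalBracketFlow (𝒢 0 1) (groupBracket H) m T := by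
  obtain ⟨m, -, hm, -⟩ := (h𝒢.1.isMetricFlow hH).exists_bracketFlow hH.isDorfman h𝒢.1.pos
  refine ⟨m, hm, fun m' T' hm' _ => ?_⟩
  -- A longer bracket flow would yield a Ricci flow with the same initial metric on the longer
  -- interval, contrary to maximality.
  obtain ⟨𝒢', h0, h𝒢'⟩ :=
    hm'.exists_genRicciFlow hH (h𝒢.1.invariant 0 le_rfl (by exact_mod_cast h𝒢.1.pos))
  exact h𝒢.le hH h𝒢' h0

theorem IsMaximalBracketFlow.exists_isMaximalGenRicciFlow (hH : IsClosedLeftInvariant3Form H)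
    {𝒢₀ : FieldGenMetric E G} (h₀ : IsLeftInvariant 𝒢₀)
    {m : ℝ → Brkt (GroupLieAlgebra 𝓘(ℝ, E) G)} {T : EReal}
    (hm : IsMaximalBracketFlow (𝒢₀ 1) (groupBracket H) m T) :
    ∃ 𝒢 : ℝ → FieldGenMetric E G, 𝒢 0 = 𝒢₀ ∧ IsMaximalGenRicciFlow H 𝒢 T := by
  obtain ⟨𝒢, h0, h𝒢⟩ := hm.1.exists_genRicciFlow hH h₀
  refine ⟨𝒢, h0, h𝒢, fun 𝒢' T' h𝒢' he => ?_⟩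
  obtain ⟨m', -, hm', -⟩ := (h𝒢'.isMetricFlow hH).exists_bracketFlow hH.isDorfman h𝒢'.pos
  rw [he 0 le_rfl (by exact_mod_cast h𝒢.pos), h0] at hm'
  exact hm.le hm'

end Maximal

end GenGeom

end

theorem theoremD {E : Type*} [NormedAddCommGroup E] [NormedSpace ℝ E] [FiniteDimensional ℝ E]
    {G : Type*} [TopologicalSpace G] [ChartedSpace E G] [Group G] [LieGroup 𝓘(ℝ, E) ∞ G]
    (H : GenGeom.Field3 E G) (hH : GenGeom.IsClosedLeftInvariant3Form H) :
    -- maximal solutions of the two flows: same interval, and gauge equivalence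
    (∀ (𝒢 : ℝ → GenGeom.FieldGenMetric E G) (T : EReal)
        (m : ℝ → GenGeom.Brkt (GroupLieAlgebra 𝓘(ℝ, E) G)) (T' : EReal),
      GenGeom.IsMaximalGenRicciFlow H 𝒢 T →
      GenGeom.IsMaximalBracketFlow (𝒢 0 1) (GenGeom.groupBracket H) m T' →
      T = T' ∧
      (∀ t : ℝ, 0 ≤ t → (t : EReal) < T → GenGeom.IsDorfman (m t)) ∧
      ∃ F : ℝ → (GenGeom.GT (GroupLieAlgebra 𝓘(ℝ, E) G) ≃ₗ[ℝ]
          GenGeom.GT (GroupLieAlgebra 𝓘(ℝ, E) G)),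
        F 0 = LinearEquiv.refl ℝ _ ∧
        (∀ a b, ContDiffOn ℝ ∞ (fun t => GenGeom.pairing (F t a) b)
          {t : ℝ | 0 ≤ t ∧ (t : EReal) < T}) ∧
        ∀ t : ℝ, 0 ≤ t → (t : EReal) < T →
          GenGeom.IsIsometry (F t) (GenGeom.groupBracket H) (𝒢 t 1) (m t) (𝒢 0 1)) ∧
    -- every maximal generalized Ricci flow has its generalized bracket flow
    (∀ (𝒢 : ℝ → GenGeom.FieldGenMetric E G) (T : EReal),
      GenGeom.IsMaximalGenRicciFlow H 𝒢 T →
      ∃ m : ℝ → GenGeom.Brkt (GroupLieAlgebra 𝓘(ℝ, E) G),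
        GenGeom.IsMaximalBracketFlow (𝒢 0 1) (GenGeom.groupBracket H) m T) ∧
    -- every maximal generalized bracket flow comes from a generalized Ricci flow
    (∀ (𝒢₀ : GenGeom.FieldGenMetric E G)
        (m : ℝ → GenGeom.Brkt (GroupLieAlgebra 𝓘(ℝ, E) G)) (T' : EReal),
      GenGeom.IsLeftInvariant 𝒢₀ →
      GenGeom.IsMaximalBracketFlow (𝒢₀ 1) (GenGeom.groupBracket H) m T' →
      ∃ 𝒢 : ℝ → GenGeom.FieldGenMetric E G,
        𝒢 0 = 𝒢₀ ∧ GenGeom.IsMaximalGenRicciFlow H 𝒢 T') := by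
  refine ⟨fun 𝒢 T m T' h𝒢 hm => ?_, fun 𝒢 T h𝒢 => h𝒢.exists_isMaximalBracketFlow hH,
    fun 𝒢₀ m T' h₀ hm => hm.exists_isMaximalGenRicciFlow hH h₀⟩
  obtain ⟨m₁, hm₁⟩ := h𝒢.exists_isMaximalBracketFlow hH
  obtain rfl : T = T' := hm₁.unique hm
  obtain ⟨F, hF⟩ := hm.1.exists_gaugeFamily
  obtain ⟨hD, 𝒢₁, h0, h𝒢₁, hI⟩ := hm.1.exists_metricFlow hH.isDorfman hF
  refine ⟨rfl, fun t h1 h2 => hD t ⟨h1, h2⟩, F, hF.init, hF.contDiffOn hm.1, fun t h1 h2 => ?_⟩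
  obtain ⟨h, I⟩ := hI t ⟨h1, h2⟩
  -- The metrics obtained by pulling `𝒢 0 1` back along the gauge family agree with the given flow
  -- by uniqueness of the metric equation.
  rw [h𝒢₁.eqOn hH.isDorfman hm.1.pos (h𝒢.1.isMetricFlow hH) h0 t ⟨h1, h2⟩] at I
  exact ⟨⟨h, I.anchor⟩, I.pairing_eq, I.bracket_eq, I.metric_eq⟩
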